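/- Let $d\in\{2,3\}$, let $\mathcal V$ be the unit cell of a lattice in $\mathbb R^d$, and write $\langle\cdot\rangle$ for the average over $\mathcal V$. Let $\mathcal J=\frac1d I\otimes I$ and $\mathcal K=\mathcal I-\mathcal J$ be the spherical and deviatoric projectors on symmetric second-order tensors, write $\mathcal A::\mathcal B=\mathcal A_{ijkl}\mathcal B_{ijkl}$, and set $n_{\mathcal P}=\mathcal P::\mathcal P$ for $\mathcal P\in\{\mathcal J,\mathcal K\}$. Fix a periodic measurable partition of $\mathbb R^d$ into finitely many phases $1,\dots,\Phi$, each of positive volume in the cell; let $V_\phi$ be the part of $\mathcal V$ occupied by phase $\phi$, $\chi_\phi$ its (periodic) indicator function, and $\langle\cdot\rangle_\phi$ the average over $V_\phi$. For positive moduli $(\kappa_\phi,\mu_\phi)_{\phi}$ consider the periodic medium $$\mathcal L(x)=\sum_\phi\chi_\phi(x)\,\mathcal L_\phi,\qquad \mathcal L_\phi=d\kappa_\phi\mathcal J+2\mu_\phi\mathcal K .$$ The strain field solution for a macroscopic strain $\bar\varepsilon$ (a symmetric tensor) is $\varepsilon=\bar\varepsilon+\nabla_s u$ with $u\in H^1_{\rm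 per}(\mathcal V,\mathbb R^d)$ and $\nabla\cdot(\mathcal L:\varepsilon)=0$ weakly. The effective tensor $\tilde{\mathcal L}$ of a medium is the elasticity tensor such that $\langle\mathcal L:\varepsilon\rangle=\tilde{\mathcal L}:\bar\varepsilon$ for all $\bar\varepsilon$; the medium is macroscopically isotropic if $\tilde{\mathcal L}$ is an isotropic tensor. Fix $\kappa_0,\mu_0>0$ and put $\mathcal L_0=d\kappa_0\mathcal J+2\mu_0\mathcal K$, $\delta\mathcal L_\phi=\mathcal L_\phi-\mathcal L_0$, $\delta p_\phi=n_{\mathcal P}^{-1}\,\delta\mathcal L_\phi::\mathcal P$ (so $\delta p_\phi=d(\kappa_\phi-\kappa_0)$ for $\mathcal P=\mathcal J$ and $\delta p_\phi=2(\mu_\phi-\mu_0)$ for $\mathcal P=\mathcal K$), $\|\delta\mathcal L\|=\max_\phi\max(|d(\kappa_\phi-\kappa_0)|,|2(\mu_\phi-\mu_0)|)$, and $\lambda_{\mathcal P}=\hat\Gamma_0(\xi)::\mathcal P$ for an arbitrary $\xi\ne0$, where $$\hat\Gamma_0(\xi)=\frac{1}{4\mu_0|\xi|^2}\sum_{i=1}^d(\xi\otimes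 e_i+e_i\otimes\xi)\otimes(\xi\otimes e_i+e_i\otimes\xi)-\frac{1}{\mu_0|\xi|^4}\,\frac{d\kappa_0+(d-2)\mu_0}{d\kappa_0+2(d-1)\mu_0}\;\xi\otimes\xi\otimes\xi\otimes\xi$$ is the Green's tensor of $\mathcal L_0$. **Lemma 5.** Let $\mathcal P=\mathcal J$ or $\mathcal P=\mathcal K$, let $\phi$ be a phase and $\bar\varepsilon$ a macroscopic strain. As $\|\delta\mathcal L\|\to0$ with the phase geometry fixed, over all positive phase moduli with mean values $\langle\kappa\rangle=\kappa_0$, $\langle\mu\rangle=\mu_0$ for which the medium is macroscopically isotropic and remains so under all sufficiently small changes of the modulus $p_\phi$ of phase $\phi$ (that is, $\mathcal L+t\chi_\phi\mathcal P$ is macroscopically isotropic for all $t$ in some neighbourhood of $0$, which may depend on the moduli), the strain field solution satisfies $$\langle\varepsilon:\mathcal P:\varepsilon\rangle_\phi=\bigl(1-2\lambda_{\mathcal P}n_{\mathcal P}^{-1}\delta p_\phi\bigr)\,\bar\varepsilon:\mathcal P:\bar\varepsilon+o(\|\delta\mathcal L\|).$$ -/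

import Mathlib

open MeasureTheory Filter Topology

noncomputable section

/-- Physical space `ℝ^d`. -/
abbrev Space (d : ℕ) : Type := EuclideanSpace ℝ (Fin d)

/-- Second-order tensors, as arrays `τ_ij`. -/
abbrev Tensor2 (d : ℕ) : Type := Matrix (Fin d) (Fin d) ℝ

/-- Fourth-order tensors, as arrays `A_ijkl`. -/
abbrev Tensor4 (d : ℕ) : Type := Fin d → Fin d → Fin d → Fin d → ℝ

/-- Kronecker symbol. -/
def kron {d : ℕ} (i j : Fin d) : ℝ := if i = j then 1 else 0

/-- `A : τ`, that is `A_ijkl τ_kl`. -/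
def Tensor4.app {d : ℕ} (A : Tensor4 d) (τ : Tensor2 d) : Tensor2 d :=
  Matrix.of fun i j => ∑ k, ∑ l, A i j k l * τ k l

/-- `σ : τ`, that is `σ_ij τ_ij`. -/
def ddot {d : ℕ} (σ τ : Tensor2 d) : ℝ := ∑ i, ∑ j, σ i j * τ i j

/-- `A :: B`, that is `A_ijkl B_ijkl`. -/
def qdot {d : ℕ} (A B : Tensor4 d) : ℝ :=
  ∑ i, ∑ j, ∑ k, ∑ l, A i j k l * B i j k l

/-- `τ : A : τ`. -/
def quadForm {d : ℕ} (A : Tensor4 d) (τ : Tensor2 d) : ℝ := ddot τ (A.app τ)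

/-- The identity on symmetric second-order tensors. -/
def idT (d : ℕ) : Tensor4 d := fun i j k l =>
  (1 / 2 : ℝ) * (kron i k * kron j l + kron i l * kron j k)

/-- The spherical projector `𝒥 = (1/d) I ⊗ I`. -/
def sphT (d : ℕ) : Tensor4 d := fun i j k l => (1 / (d : ℝ)) * (kron i j * kron k l)

/-- The deviatoric projector `𝒦`. -/
def devT (d : ℕ) : Tensor4 d := idT d - sphT d

/-- The isotropic elasticity tensor `d κ 𝒥 + 2 μ 𝒦` with bulk modulus `κ`, shear modulus `μ`. -/
def isoStiffness (d : ℕ) (κ μ : ℝ) : Tensor4 d :=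
  ((d : ℝ) * κ) • sphT d + (2 * μ) • devT d

/-- The Green's tensor `Γ̂₀(ξ)` (for `ξ ≠ 0`) of the homogeneous isotropic medium with
moduli `κ₀, μ₀`:
`(α₀/|ξ|²) ∑ₘ ψₘ ⊗ ψₘ + (β₀/|ξ|⁴) ψ ⊗ ψ` with `ψₘ = ξ ⊗ eₘ + eₘ ⊗ ξ` and `ψ = ξ ⊗ ξ`. -/
def greenTensor {d : ℕ} (κ₀ μ₀ : ℝ) (ξ : Space d) : Tensor4 d := fun i j k l =>
  (1 / (4 * μ₀)) / ‖ξ‖ ^ 2 *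
      ∑ m, (ξ i * kron m j + kron m i * ξ j) * (ξ k * kron m l + kron m k * ξ l)
    + (-(1 / μ₀) * (((d : ℝ) * κ₀ + ((d : ℝ) - 2) * μ₀) /
          ((d : ℝ) * κ₀ + 2 * ((d : ℝ) - 1) * μ₀))) / ‖ξ‖ ^ 4 *
      ((ξ i * ξ j) * (ξ k * ξ l))

/-- Minor and major index symmetries. -/
def Tensor4.IsSymmetric {d : ℕ} (A : Tensor4 d) : Prop :=
  ∀ i j k l, A i j k l = A j i k l ∧ A i j k l = A k l i j

/-- Isotropy of a fourth-order tensor: invariance under all orthogonal changes of frame. -/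
def Tensor4.IsIsotropic {d : ℕ} (A : Tensor4 d) : Prop :=
  ∀ Q ∈ Matrix.orthogonalGroup (Fin d) ℝ, ∀ i j k l,
    ∑ p, ∑ q, ∑ r, ∑ s, Q i p * Q j q * Q k r * Q l s * A p q r s = A i j k l

/-- The unit cell of the lattice generated by the basis `a`. -/
def cell {d : ℕ} (a : Module.Basis (Fin d) ℝ (Space d)) : Set (Space d) :=
  ZSpan.fundamentalDomain a

/-- Periodicity with respect to the lattice generated by `a`. -/
def IsPeriodic {d : ℕ} {X : Type*} (a : Module.Basis (Fin d) ℝ (Space d))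
    (f : Space d → X) : Prop :=
  ∀ i x, f (x + a i) = f x

/-- Membership in `L²_per`. -/
def IsL2Per {d : ℕ} (a : Module.Basis (Fin d) ℝ (Space d)) (f : Space d → ℝ) : Prop :=
  IsPeriodic a f ∧ MemLp f 2 (volume.restrict (cell a))

/-- Smooth periodic scalar (test) functions. -/
def IsSmoothPer {d : ℕ} (a : Module.Basis (Fin d) ℝ (Space d)) (f : Space d → ℝ) : Prop :=
  IsPeriodic a f ∧ ContDiff ℝ (⊤ : ℕ∞) f

/-- The partial derivative `∂_j f`. -/
def partialDeriv {d : ℕ} (j : Fin d) (f : Space d → ℝ) (x : Space d) : ℝ :=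
  fderiv ℝ f x (EuclideanSpace.single j 1)

/-- `u ∈ H¹_per` with weak gradient `g`. -/
def HasWeakGradPer {d : ℕ} (a : Module.Basis (Fin d) ℝ (Space d))
    (u : Space d → ℝ) (g : Fin d → Space d → ℝ) : Prop :=
  IsL2Per a u ∧ (∀ j, IsL2Per a (g j)) ∧
    ∀ w : Space d → ℝ, IsSmoothPer a w → ∀ j,
      ∫ x in cell a, u x * partialDeriv j w x = -∫ x in cell a, g j x * w x

/-- `ε` is the strain field solution for the periodic elasticity tensor field `C` and the
macroscopic strain `εbar`: it is a periodic square-integrable field of the form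
`ε = εbar + ∇ₛu` with `u ∈ H¹_per`, and the stress `σ = C : ε` satisfies `∇·σ = 0` weakly
(against all smooth periodic vector fields). -/
structure IsStrainSolution {d : ℕ} (a : Module.Basis (Fin d) ℝ (Space d))
    (C : Space d → Tensor4 d) (εbar : Tensor2 d) (ε : Space d → Tensor2 d) : Prop where
  l2 : ∀ i j, IsL2Per a (fun x => ε x i j)
  compatible : ∃ (u : Fin d → Space d → ℝ) (G : Fin d → Fin d → Space d → ℝ),
    (∀ i, HasWeakGradPer a (u i) (G i)) ∧
      ∀ᵐ x, ∀ i j, ε x i j = εbar i j + (1 / 2 : ℝ) * (G i j x + G j i x)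
  equilibrium : ∀ v : Fin d → Space d → ℝ, (∀ i, IsSmoothPer a (v i)) →
    ∫ x in cell a, ∑ i, ∑ j, (C x).app (ε x) i j * partialDeriv j (v i) x = 0

/-- `A` is the effective elasticity tensor of the medium `C`: `⟨σ⟩ = A : ⟨ε⟩` for every
macroscopic strain `⟨ε⟩ = εbar`. -/
def IsEffectiveTensor {d : ℕ} (a : Module.Basis (Fin d) ℝ (Space d))
    (C : Space d → Tensor4 d) (A : Tensor4 d) : Prop :=
  A.IsSymmetric ∧
    ∀ (εbar : Tensor2 d) (ε : Space d → Tensor2 d), εbar.IsSymm →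
      IsStrainSolution a C εbar ε →
        ∀ i j, ⨍ x in cell a, (C x).app (ε x) i j = A.app εbar i j

/-- Macroscopic isotropy: the effective elasticity tensor is isotropic. -/
def MacroscopicallyIsotropic {d : ℕ} (a : Module.Basis (Fin d) ℝ (Space d))
    (C : Space d → Tensor4 d) : Prop :=
  ∃ A : Tensor4 d, IsEffectiveTensor a C A ∧ A.IsIsotropic

/-- The part of the unit cell that is occupied by phase `φ`. -/
def phaseDomain {d Φ : ℕ} (a : Module.Basis (Fin d) ℝ (Space d))
    (phase : Space d → Fin Φ) (φ : Fin Φ) : Set (Space d) :=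
  cell a ∩ {x | phase x = φ}

/-- The piecewise homogeneous elasticity tensor field `∑ φ, χ_φ(x) (d κ_φ 𝒥 + 2 μ_φ 𝒦)`. -/
def phaseStiffness {d Φ : ℕ} (phase : Space d → Fin Φ) (κ μ : Fin Φ → ℝ) :
    Space d → Tensor4 d :=
  fun x => isoStiffness d (κ (phase x)) (μ (phase x))

/-- `C + t χ_φ P`. -/
def perturbPhase {d Φ : ℕ} (phase : Space d → Fin Φ) (C : Space d → Tensor4 d) (φ : Fin Φ)
    (P : Tensor4 d) (t : ℝ) : Space d → Tensor4 d :=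
  fun x => C x + (if phase x = φ then t else 0) • P

/-- `‖δℒ‖ = sup max(|d δκ|, |2 δμ|)`, the supremum being over the phases. -/
def contrast (d : ℕ) {Φ : ℕ} (κ₀ μ₀ : ℝ) (κ μ : Fin Φ → ℝ) : ℝ :=
  ⨆ ψ, max |(d : ℝ) * (κ ψ - κ₀)| |2 * (μ ψ - μ₀)|

/-- `δp_φ = n_P⁻¹ δℒ_φ :: P` with `n_P = P :: P`. -/
def phaseContrast {d Φ : ℕ} (κ₀ μ₀ : ℝ) (κ μ : Fin Φ → ℝ) (P : Tensor4 d) (φ : Fin Φ) : ℝ :=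
  (qdot P P)⁻¹ * qdot (isoStiffness d (κ φ) (μ φ) - isoStiffness d κ₀ μ₀) P

end

noncomputable section

/-! ### Algebra of fourth-order tensors -/

section Algebra

variable {d : ℕ}

/-! Strain fields live in the Hilbert space `TensorField` of square-integrable tensor fields on the
cell. The symmetrized gradients of periodic displacements form a closed subspace `strainSpace` (Korn
and Poincaré, both read off from Parseval). The strain solution is s + e, with s the constant
macroscopic strain and e in this subspace, and equilibrium says that the stress is orthogonal to the
subspace. The stiffness is T₀ + R, with T₀ the homogeneous reference and R of size `contrast`. Since
T₀ s is constant, it is orthogonal to strains, and coercivity gives e = -Γ R s + O(‖R‖²), where Γ is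
the Green operator of T₀. Hence the energy of X = χ_φ P in phase φ is ⟪X s, s⟫ - 2 ⟪X s, Γ R s⟫ +
O(‖R‖²) (`abs_energy_sub_le`).

For a single macroscopic strain the first-order term depends on the geometry. Its sum over the tight
frame P : (eᵢ ⊗ eⱼ) does not. On the n-th plane wave Γ acts as the Green's tensor at the n-th dual
lattice vector, and the contraction of that tensor with P is the same number λ for every nonzero
wave vector. So the partial trace of Γ over the range of P is λ times the identity on scalar fields
of zero mean (`sum_inner_greenOp`). The fluctuation of p has zero mean, and pairing it with χ_φ
gives λ δp_φ |V_φ|.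

Isotropy turns traces back into values. By reciprocity (`energy_sub_eq`), the derivative of the
macroscopic energy with respect to p_φ is the energy of phase φ. As the energy stays isotropic for
all p_φ nearby, so does its derivative (`decomposesAlong_phase_energy`). It is therefore a
combination of the quadratic forms of P and of the complementary projector P', with coefficients
given by its two partial traces. The P trace is computed to first order as above. The P' trace is of
second order, because X annihilates the range of P' (`exists_trace_energy_bound`). Altogether the
remainder is quadratic in the contrast, which is stronger than required. -/

lemma kron_comm (i j : Fin d) : kron i j = kron j i := by
  simp only [kron, eq_comm]

lemma sum_kron_mul (i : Fin d) (f : Fin d → ℝ) : ∑ j, kron i j * f j = f i := by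
  simp [kron]

lemma sum_mul_kron (i : Fin d) (f : Fin d → ℝ) : ∑ j, f j * kron i j = f i := by
  simp [kron]

lemma sum_kron_mul' (i : Fin d) (f : Fin d → ℝ) : ∑ j, kron j i * f j = f i := by
  simp [kron]

lemma idT_app_apply (τ : Tensor2 d) (i j : Fin d) :
    (idT d).app τ i j = (1 / 2 : ℝ) * (τ i j + τ j i) := by
  have h : ∀ k, ∑ l, idT d i j k l * τ k l =
      (1 / 2 : ℝ) * (kron i k * τ k j + kron j k * τ k i) := by
    intro k
    have : ∀ l, idT d i j k l * τ k l = (1 / 2 : ℝ) * kron i k * (kron j l * τ k l)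
        + (1 / 2 : ℝ) * kron j k * (kron i l * τ k l) := by
      intro l; simp only [idT]; ring
    simp only [this, Finset.sum_add_distrib, ← Finset.mul_sum, sum_kron_mul]
    ring
  simp only [Tensor4.app, Matrix.of_apply, h, ← Finset.mul_sum, Finset.sum_add_distrib,
    sum_kron_mul]

lemma sphT_app_apply (τ : Tensor2 d) (i j : Fin d) :
    (sphT d).app τ i j = (1 / (d : ℝ)) * kron i j * ∑ k, τ k k := by
  have h : ∀ k, ∑ l, sphT d i j k l * τ k l = (1 / (d : ℝ)) * kron i j * τ k k := by
    intro k
    have : ∀ l, sphT d i j k l * τ k l = (1 / (d : ℝ)) * kron i j * (kron k l * τ k l) := by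
      intro l; simp only [sphT]; ring
    simp only [this, ← Finset.mul_sum, sum_kron_mul]
  simp only [Tensor4.app, Matrix.of_apply, h, ← Finset.mul_sum]

lemma app_sub (A B : Tensor4 d) (τ : Tensor2 d) : (A - B).app τ = A.app τ - B.app τ := by
  ext i j
  simp [Tensor4.app, sub_mul, Finset.sum_sub_distrib]

lemma app_add (A B : Tensor4 d) (τ : Tensor2 d) : (A + B).app τ = A.app τ + B.app τ := by
  ext i j
  simp [Tensor4.app, add_mul, Finset.sum_add_distrib]

lemma app_smul (c : ℝ) (A : Tensor4 d) (τ : Tensor2 d) : (c • A).app τ = c • A.app τ := by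
  ext i j
  simp [Tensor4.app, mul_assoc, Finset.mul_sum]

lemma quadForm_eq_sum (A : Tensor4 d) (τ : Tensor2 d) :
    quadForm A τ = ∑ i, ∑ j, τ i j * A.app τ i j := rfl

lemma quadForm_add (A B : Tensor4 d) (τ : Tensor2 d) :
    quadForm (A + B) τ = quadForm A τ + quadForm B τ := by
  simp [quadForm_eq_sum, app_add, mul_add, Finset.sum_add_distrib]

lemma quadForm_smul (c : ℝ) (A : Tensor4 d) (τ : Tensor2 d) :
    quadForm (c • A) τ = c * quadForm A τ := by
  simp [quadForm_eq_sum, app_smul, Finset.mul_sum, mul_left_comm]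

/-! ### Composition of fourth-order tensors and complementary projectors -/

/-- Composition of fourth-order tensors, `A_ijmn B_mnkl`. -/
def tcomp (A B : Tensor4 d) : Tensor4 d := fun i j k l => ∑ m, ∑ n, A i j m n * B m n k l

lemma tcomp_apply (A B : Tensor4 d) (i j k l : Fin d) :
    tcomp A B i j k l = A.app (Matrix.of fun m n => B m n k l) i j := rfl

lemma sphT_tcomp_sphT (hd : d ≠ 0) : tcomp (sphT d) (sphT d) = sphT d := by
  have hd' : (d : ℝ) ≠ 0 := by exact_mod_cast hd
  ext i j k l
  rw [tcomp_apply, sphT_app_apply]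
  simp only [Matrix.of_apply, sphT, kron]
  simp
  field_simp

lemma idT_tcomp (B : Tensor4 d) (h : ∀ i j k l, B i j k l = B j i k l) :
    tcomp (idT d) B = B := by
  ext i j k l
  rw [tcomp_apply, idT_app_apply]
  simp only [Matrix.of_apply]
  rw [h j i]; ring

lemma idT_symm_minor (i j k l : Fin d) : idT d i j k l = idT d j i k l := by
  simp only [idT]; ring

lemma sphT_symm_minor (i j k l : Fin d) : sphT d i j k l = sphT d j i k l := by
  simp only [sphT, kron_comm i j]

lemma idT_symm_major (i j k l : Fin d) : idT d i j k l = idT d k l i j := by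
  simp only [idT, kron_comm k i, kron_comm l j, kron_comm k j, kron_comm l i]; ring

lemma sphT_symm_major (i j k l : Fin d) : sphT d i j k l = sphT d k l i j := by
  simp only [sphT]; ring

/-- Both tensors have the major symmetry, so this is the transpose of the product in the other
order, where `idT_tcomp` applies. -/
lemma sphT_tcomp_idT : tcomp (sphT d) (idT d) = sphT d := by
  ext i j k l
  have : tcomp (sphT d) (idT d) i j k l = tcomp (idT d) (sphT d) k l i j := by
    simp only [tcomp]
    refine Finset.sum_congr rfl fun m _ => Finset.sum_congr rfl fun n _ => ?_
    rw [sphT_symm_major i j, idT_symm_major m n]; ring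
  rw [this, idT_tcomp _ sphT_symm_minor, sphT_symm_major]

lemma tcomp_sub (A B C : Tensor4 d) : tcomp A (B - C) = tcomp A B - tcomp A C := by
  ext i j k l; simp [tcomp, mul_sub, Finset.sum_sub_distrib]

lemma sub_tcomp (A B C : Tensor4 d) : tcomp (A - B) C = tcomp A C - tcomp B C := by
  ext i j k l; simp [tcomp, sub_mul, Finset.sum_sub_distrib]

/-- A pair of complementary orthogonal projectors on symmetric second-order tensors. -/
structure IsProjectorPair (P P' : Tensor4 d) : Prop where
  minor : ∀ i j k l, P i j k l = P j i k l
  minor' : ∀ i j k l, P' i j k l = P' j i k l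
  major : ∀ i j k l, P i j k l = P k l i j
  major' : ∀ i j k l, P' i j k l = P' k l i j
  idem : tcomp P P = P
  idem' : tcomp P' P' = P'
  orth : tcomp P P' = 0
  orth' : tcomp P' P = 0
  add : P + P' = idT d
  pos : 0 < qdot P P
  pos' : 0 < qdot P' P'

lemma IsProjectorPair.swap {P P' : Tensor4 d} (h : IsProjectorPair P P') :
    IsProjectorPair P' P :=
  ⟨h.minor', h.minor, h.major', h.major, h.idem', h.idem, h.orth', h.orth,
    by rw [add_comm, h.add], h.pos', h.pos⟩

lemma qdot_pos {A : Tensor4 d} {i j k l : Fin d} (h : A i j k l ≠ 0) : 0 < qdot A A := by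
  unfold qdot
  refine Finset.sum_pos' (fun i _ => ?_) ⟨i, Finset.mem_univ _, ?_⟩
  · exact Finset.sum_nonneg fun _ _ => Finset.sum_nonneg fun _ _ =>
      Finset.sum_nonneg fun _ _ => mul_self_nonneg _
  refine Finset.sum_pos' (fun i _ => ?_) ⟨j, Finset.mem_univ _, ?_⟩
  · exact Finset.sum_nonneg fun _ _ => Finset.sum_nonneg fun _ _ => mul_self_nonneg _
  refine Finset.sum_pos' (fun i _ => ?_) ⟨k, Finset.mem_univ _, ?_⟩
  · exact Finset.sum_nonneg fun _ _ => mul_self_nonneg _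
  refine Finset.sum_pos' (fun i _ => mul_self_nonneg _) ⟨l, Finset.mem_univ _, ?_⟩
  exact mul_self_pos.2 h

lemma isProjectorPair_sphT_devT (hd : 2 ≤ d) : IsProjectorPair (sphT d) (devT d) := by
  have hd0 : d ≠ 0 := by omega
  have h1 : tcomp (sphT d) (devT d) = 0 := by
    rw [devT, tcomp_sub, sphT_tcomp_idT, sphT_tcomp_sphT hd0, sub_self]
  have h2 : tcomp (idT d) (devT d) = devT d := by
    apply idT_tcomp
    intro i j k l
    simp only [devT, Pi.sub_apply]
    rw [idT_symm_minor, sphT_symm_minor]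
  have h3 : tcomp (devT d) (sphT d) = 0 := by
    rw [devT, sub_tcomp, idT_tcomp _ sphT_symm_minor, sphT_tcomp_sphT hd0, sub_self]
  have h01 : (⟨0, by omega⟩ : Fin d) ≠ ⟨1, by omega⟩ := by simp
  refine ⟨sphT_symm_minor, ?_, sphT_symm_major, ?_, sphT_tcomp_sphT hd0, ?_, h1, h3, ?_, ?_, ?_⟩
  · intro i j k l
    simp only [devT, Pi.sub_apply]
    rw [idT_symm_minor, sphT_symm_minor]
  · intro i j k l
    simp only [devT, Pi.sub_apply]
    rw [idT_symm_major, sphT_symm_major]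
  · nth_rw 1 [devT]
    rw [sub_tcomp, h2, h1, sub_zero]
  · simp [devT]
  · apply qdot_pos (i := ⟨0, by omega⟩) (j := ⟨0, by omega⟩) (k := ⟨0, by omega⟩)
      (l := ⟨0, by omega⟩)
    simp [sphT, kron, hd0]
  -- The component 0101 of the deviatoric projector is 1/2; a second index exists because d ≥ 2.
  · apply qdot_pos (i := ⟨0, by omega⟩) (j := ⟨1, by omega⟩) (k := ⟨0, by omega⟩)
      (l := ⟨1, by omega⟩)
    simp [devT, idT, sphT, kron]

/-! ### Tight frames and partial traces -/

/-- The tensors `P : (eᵢ ⊗ eⱼ)`, a tight frame of the range of the projector `P`. -/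
def frame (P : Tensor4 d) (i j : Fin d) : Tensor2 d := Matrix.of fun k l => P k l i j

lemma frame_apply (P : Tensor4 d) (i j k l : Fin d) : frame P i j k l = P k l i j := rfl

lemma app_frame (A P : Tensor4 d) (i j : Fin d) : A.app (frame P i j) = frame (tcomp A P) i j :=
  rfl

lemma sum4_comm (f : Fin d → Fin d → Fin d → Fin d → ℝ) :
    ∑ i, ∑ j, ∑ k, ∑ l, f i j k l = ∑ k, ∑ l, ∑ i, ∑ j, f i j k l := by
  calc ∑ i, ∑ j, ∑ k, ∑ l, f i j k l = ∑ i, ∑ k, ∑ j, ∑ l, f i j k l :=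
        Finset.sum_congr rfl fun i _ => Finset.sum_comm
    _ = ∑ i, ∑ k, ∑ l, ∑ j, f i j k l :=
        Finset.sum_congr rfl fun i _ => Finset.sum_congr rfl fun k _ => Finset.sum_comm
    _ = ∑ k, ∑ i, ∑ l, ∑ j, f i j k l := Finset.sum_comm
    _ = ∑ k, ∑ l, ∑ i, ∑ j, f i j k l := Finset.sum_congr rfl fun k _ => Finset.sum_comm

lemma sum_ddot_frame (P : Tensor4 d) : ∑ i, ∑ j, ddot (frame P i j) (frame P i j) = qdot P P := by
  simp only [ddot, frame_apply, qdot]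
  exact sum4_comm fun i j k l => P k l i j * P k l i j

/-- The sum is the trace of P A P, which by cyclicity and idempotence is the trace of A against P.
It converts a contraction with P into values of a quadratic form, and is applied to the Green's
tensor as well as to the projectors themselves. -/
lemma sum_quadForm_frame {P : Tensor4 d} (hmaj : ∀ i j k l, P i j k l = P k l i j)
    (hid : tcomp P P = P) (A : Tensor4 d) :
    ∑ i, ∑ j, quadForm A (frame P i j) = qdot A P := by
  have h1 : ∀ i j, quadForm A (frame P i j) =
      ∑ a, ∑ b, ∑ k, ∑ l, A a b k l * (P a b i j * P i j k l) := by
    intro i j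
    simp only [quadForm_eq_sum, app_frame, frame_apply, tcomp, Finset.mul_sum]
    refine Finset.sum_congr rfl fun a _ => Finset.sum_congr rfl fun b _ =>
      Finset.sum_congr rfl fun k _ => Finset.sum_congr rfl fun l _ => ?_
    rw [hmaj k l]; ring
  simp only [h1]
  rw [sum4_comm]
  simp only [qdot]
  refine Finset.sum_congr rfl fun a _ => Finset.sum_congr rfl fun b _ => ?_
  rw [sum4_comm]
  refine Finset.sum_congr rfl fun k _ => Finset.sum_congr rfl fun l _ => ?_
  simp only [← Finset.mul_sum]
  congr 1
  exact congrFun (congrFun (congrFun (congrFun hid a) b) k) l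

lemma IsProjectorPair.isSymm_frame {P P' : Tensor4 d} (h : IsProjectorPair P P') (i j : Fin d) :
    (frame P i j).IsSymm := by
  ext k l; exact h.minor _ _ _ _

/-! ### Isotropic tensors -/

lemma isotropic_diagonal {A : Tensor4 d} (hA : A.IsIsotropic) (s : Fin d → ℝ)
    (hs : ∀ i, s i * s i = 1) (i j k l : Fin d) :
    s i * s j * s k * s l * A i j k l = A i j k l := by
  have hQ : Matrix.diagonal s ∈ Matrix.orthogonalGroup (Fin d) ℝ := by
    rw [Matrix.mem_orthogonalGroup_iff]
    simp [Matrix.diagonal_transpose, hs]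
  simpa [Matrix.diagonal_apply] using hA _ hQ i j k l

lemma isotropic_perm {A : Tensor4 d} (hA : A.IsIsotropic) (π : Equiv.Perm (Fin d))
    (i j k l : Fin d) : A (π i) (π j) (π k) (π l) = A i j k l := by
  have hQ : (π.toPEquiv.toMatrix : Matrix (Fin d) (Fin d) ℝ) ∈
      Matrix.orthogonalGroup (Fin d) ℝ := by
    rw [Matrix.mem_orthogonalGroup_iff]
    rw [← PEquiv.toMatrix_symm, ← PEquiv.toMatrix_trans, ← Equiv.toPEquiv_symm,
      ← Equiv.toPEquiv_trans]
    simp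
  simpa [PEquiv.toMatrix_apply, Equiv.toPEquiv_apply] using hA _ hQ i j k l

/-- Invariance under the Householder reflection in v = e_a - 2 e_b, whose row a is (3/5, 4/5) in the
coordinates a, b. The triple 3, 4, 5 keeps all entries rational, while still mixing two axes, which
signed permutations cannot do. -/
lemma isotropic_reflection {A : Tensor4 d} (hA : A.IsIsotropic) {a b : Fin d} (hab : a ≠ b) :
    A a a a a = ∑ p, ∑ q, ∑ r, ∑ s, ((3 / 5 : ℝ) * kron a p + 4 / 5 * kron b p) *
      ((3 / 5 : ℝ) * kron a q + 4 / 5 * kron b q) * ((3 / 5 : ℝ) * kron a r + 4 / 5 * kron b r) *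
      ((3 / 5 : ℝ) * kron a s + 4 / 5 * kron b s) * A p q r s := by
  set v : Fin d → ℝ := fun i => kron a i - 2 * kron b i with hv
  set Q : Matrix (Fin d) (Fin d) ℝ := 1 - (2 / 5 : ℝ) • Matrix.vecMulVec v v with hQdef
  have hvv : v ⬝ᵥ v = 5 := by
    have : ∀ i, v i * v i = kron a i * kron a i - 4 * (kron a i * kron b i)
        + 4 * (kron b i * kron b i) := by intro i; simp only [hv]; ring
    simp only [dotProduct, this, Finset.sum_add_distrib, Finset.sum_sub_distrib, ← Finset.mul_sum,
      sum_kron_mul]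
    simp [kron, hab.symm]
    norm_num
  have hQ : Q ∈ Matrix.orthogonalGroup (Fin d) ℝ := by
    rw [Matrix.mem_orthogonalGroup_iff]
    have ht : Q.transpose = Q := by
      rw [hQdef]
      ext i j
      simp [Matrix.vecMulVec_apply, Matrix.one_apply, mul_comm, eq_comm]
    rw [ht, hQdef]
    have hm : Matrix.vecMulVec v v * Matrix.vecMulVec v v = (5 : ℝ) • Matrix.vecMulVec v v := by
      rw [Matrix.vecMulVec_mul_vecMulVec, hvv]
      ext i j
      simp [Matrix.vecMulVec_apply]
      ring
    rw [sub_mul, mul_sub, mul_sub, one_mul, one_mul, mul_one, smul_mul_smul_comm, hm, smul_smul]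
    module
  have hrow : ∀ p, Q a p = (3 / 5 : ℝ) * kron a p + 4 / 5 * kron b p := by
    intro p
    simp only [hQdef, Matrix.sub_apply, Matrix.smul_apply, Matrix.vecMulVec_apply, hv, smul_eq_mul,
      Matrix.one_apply, kron, hab.symm]
    simp
    split_ifs <;> norm_num
  have := hA Q hQ a a a a
  simp only [hrow] at this
  exact this.symm

/-- Reflecting the axis m changes the sign of every component in which m occurs an odd number of
times. -/
lemma isotropic_eq_zero {A : Tensor4 d} (hA : A.IsIsotropic) {i j k l : Fin d} (m : Fin d)
    (h : (if i = m then (-1 : ℝ) else 1) * (if j = m then (-1 : ℝ) else 1) *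
      (if k = m then (-1 : ℝ) else 1) * (if l = m then (-1 : ℝ) else 1) = -1) :
    A i j k l = 0 := by
  have := isotropic_diagonal hA (fun x => if x = m then (-1 : ℝ) else 1)
    (fun x => by split_ifs <;> norm_num) i j k l
  rw [h] at this
  linarith

lemma exists_perm_map_pair {a b i j : Fin d} (hab : a ≠ b) (hij : i ≠ j) :
    ∃ π : Equiv.Perm (Fin d), π a = i ∧ π b = j := by
  refine ⟨(Equiv.swap (Equiv.swap a i b) j) * Equiv.swap a i, ?_, ?_⟩
  · have h1 : Equiv.swap a i b ≠ i := by
      intro h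
      have : Equiv.swap a i b = Equiv.swap a i a := by rw [h, Equiv.swap_apply_left]
      exact hab ((Equiv.injective _ this).symm)
    rw [Equiv.Perm.mul_apply, Equiv.swap_apply_left, Equiv.swap_apply_of_ne_of_ne h1.symm hij]
  · rw [Equiv.Perm.mul_apply, Equiv.swap_apply_left]

/-- Coordinate reflections leave only the components whose indices pair up, and permutations reduce
these to A_aaaa, A_aabb and A_abab. One genuine mixing of two axes supplies the last relation A_aaaa
= A_aabb + 2 A_abab. -/
lemma isotropic_components (hd : 2 ≤ d) {A : Tensor4 d} (hA : A.IsIsotropic)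
    (hs : A.IsSymmetric) :
    ∃ p q : ℝ, ∀ i j k l, A i j k l =
      p * (kron i j * kron k l) + q * (kron i k * kron j l + kron i l * kron j k) := by
  obtain ⟨a, b, hab⟩ : ∃ a b : Fin d, a ≠ b := ⟨⟨0, by omega⟩, ⟨1, by omega⟩, by simp⟩
  have hP : ∀ i j, i ≠ j → A i i j j = A a a b b := by
    intro i j hij
    obtain ⟨π, rfl, rfl⟩ := exists_perm_map_pair hab hij
    exact isotropic_perm hA π a a b b
  have hQ : ∀ i j, i ≠ j → A i j i j = A a b a b := by
    intro i j hij
    obtain ⟨π, rfl, rfl⟩ := exists_perm_map_pair hab hij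
    exact isotropic_perm hA π a b a b
  have hR : ∀ i, A i i i i = A a a a a := by
    intro i
    have := isotropic_perm hA (Equiv.swap a i) a a a a
    simpa using this
  -- Once the odd components are dropped, the reflection identity reads 625 A_aaaa = (81 + 256)
  -- A_aaaa + 144 (2 A_aabb + 4 A_abab).
  have hr : A a a a a = A a a b b + 2 * A a b a b := by
    have h := isotropic_reflection hA hab
    simp only [mul_assoc, ← Finset.mul_sum] at h
    simp only [add_mul, mul_assoc, Finset.sum_add_distrib, ← Finset.mul_sum, sum_kron_mul] at h
    have z : ∀ {i j k l : Fin d} (m : Fin d), (if i = m then (-1 : ℝ) else 1) *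
      (if j = m then (-1 : ℝ) else 1) * (if k = m then (-1 : ℝ) else 1) *
      (if l = m then (-1 : ℝ) else 1) = -1 → A i j k l = 0 := fun m h => isotropic_eq_zero hA m h
    have e1 : A a b b a = A a b a b := by
      rw [(hs a b b a).2, (hs b a a b).1]
    rw [z (i := a) (j := a) (k := a) (l := b) b (by simp [hab]),
      z (i := a) (j := a) (k := b) (l := a) b (by simp [hab]),
      z (i := a) (j := b) (k := a) (l := a) b (by simp [hab]),
      z (i := b) (j := a) (k := a) (l := a) b (by simp [hab]),
      z (i := b) (j := b) (k := b) (l := a) b (by simp [hab]),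
      z (i := b) (j := b) (k := a) (l := b) b (by simp [hab]),
      z (i := b) (j := a) (k := b) (l := b) b (by simp [hab]),
      z (i := a) (j := b) (k := b) (l := b) b (by simp [hab]),
      hR b, hP b a hab.symm, (hs b a b a).1, (hs b a a b).1, e1] at h
    linarith
  refine ⟨A a a b b, A a b a b, fun i j k l => ?_⟩
  by_cases hij : i = j
  · subst hij
    by_cases hkl : k = l
    · subst hkl
      by_cases hik : i = k
      · subst hik; rw [hR, hr]; simp [kron]; ring
      · rw [hP i k hik]; simp [kron, hik]
    · have h0 : A i i k l = 0 := by
        by_cases hik : i = k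
        · subst hik
          exact isotropic_eq_zero hA l (by simp [hkl])
        · exact isotropic_eq_zero hA k (by simp [hik, Ne.symm hkl])
      rw [h0]
      by_cases hik : i = k
      · subst hik; simp [kron, hkl]
      · simp [kron, hkl, hik]
  · by_cases hik : i = k
    · subst hik
      by_cases hjl : j = l
      · subst hjl; rw [hQ i j hij]; simp [kron, hij, Ne.symm hij]
      · have h0 : A i j i l = 0 := isotropic_eq_zero hA j (by simp [hij, Ne.symm hjl])
        rw [h0]; simp [kron, hij, hjl, Ne.symm hij]
    · by_cases hil : i = l
      · subst hil
        by_cases hjk : j = k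
        · subst hjk
          rw [(hs i j j i).2, (hs j i i j).1, hQ i j hij]; simp [kron, hij]
        · have h0 : A i j k i = 0 := isotropic_eq_zero hA j (by simp [hij, Ne.symm hjk])
          rw [h0]; simp [kron, hij, hik, hjk]
      · have h0 : A i j k l = 0 :=
          isotropic_eq_zero hA i (by simp [Ne.symm hij, Ne.symm hik, Ne.symm hil])
        rw [h0]; simp [kron, hij, hik, hil]

lemma quadForm_isotropic (hd : 2 ≤ d) {A : Tensor4 d} (hA : A.IsIsotropic) (hs : A.IsSymmetric) :
    ∃ α β : ℝ, ∀ τ : Tensor2 d, τ.IsSymm →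
      quadForm A τ = α * quadForm (sphT d) τ + β * quadForm (devT d) τ := by
  obtain ⟨p, q, h⟩ := isotropic_components hd hA hs
  have hd' : (d : ℝ) ≠ 0 := by
    have : d ≠ 0 := by omega
    exact_mod_cast this
  have hA' : A = (p * d + 2 * q) • sphT d + (2 * q) • devT d := by
    ext i j k l
    rw [h]
    simp only [devT, Pi.add_apply, Pi.smul_apply, Pi.sub_apply, sphT, idT, smul_eq_mul]
    field_simp
    ring
  refine ⟨p * d + 2 * q, 2 * q, fun τ _ => ?_⟩
  rw [hA', quadForm_add, quadForm_smul, quadForm_smul]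

lemma quadForm_frame_self {P P' : Tensor4 d} (h : IsProjectorPair P P') :
    ∑ i, ∑ j, quadForm P (frame P i j) = qdot P P := sum_quadForm_frame h.major h.idem P

lemma quadForm_frame_other {P P' : Tensor4 d} (h : IsProjectorPair P P') (i j : Fin d) :
    quadForm P' (frame P i j) = 0 := by
  rw [quadForm_eq_sum, app_frame, h.orth']
  simp [frame]

/-- The frame of P sees only α and the frame of P' only β, since each projector annihilates the
frame of the other. Expressing the coefficients through values of the form is what lets the
decomposition survive differences and limits. -/
lemma quadForm_eq_frame_sum {P P' : Tensor4 d} (h : IsProjectorPair P P') {A : Tensor4 d}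
    {α β : ℝ} (hA : ∀ τ : Tensor2 d, τ.IsSymm →
      quadForm A τ = α * quadForm P τ + β * quadForm P' τ) {τ : Tensor2 d} (hτ : τ.IsSymm) :
    quadForm A τ = (∑ i, ∑ j, quadForm A (frame P i j)) / qdot P P * quadForm P τ +
      (∑ i, ∑ j, quadForm A (frame P' i j)) / qdot P' P' * quadForm P' τ := by
  have h1 : ∑ i, ∑ j, quadForm A (frame P i j) = α * qdot P P := by
    simp only [hA _ (h.isSymm_frame _ _), quadForm_frame_other h, mul_zero, add_zero,
      ← Finset.mul_sum, quadForm_frame_self h]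
  have h2 : ∑ i, ∑ j, quadForm A (frame P' i j) = β * qdot P' P' := by
    simp only [hA _ (h.swap.isSymm_frame _ _), quadForm_frame_other h.swap, mul_zero, zero_add,
      ← Finset.mul_sum, quadForm_frame_self h.swap]
  rw [h1, h2, mul_div_cancel_right₀ _ h.pos.ne', mul_div_cancel_right₀ _ h.pos'.ne', hA τ hτ]

/-! ### The Green's tensor -/

lemma norm_sq_eq_sum (ξ : Space d) : ‖ξ‖ ^ 2 = ∑ i, ξ i * ξ i := by
  rw [EuclideanSpace.real_norm_sq_eq]
  exact Finset.sum_congr rfl fun i _ => sq _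

/-- The coefficient of `ξ ⊗ ξ ⊗ ξ ⊗ ξ / |ξ|⁴` in the Green's tensor. -/
def greenCoeff (d : ℕ) (κ₀ μ₀ : ℝ) : ℝ :=
  -(1 / μ₀) * (((d : ℝ) * κ₀ + ((d : ℝ) - 2) * μ₀) / ((d : ℝ) * κ₀ + 2 * ((d : ℝ) - 1) * μ₀))

lemma sum_psi_mul (ξ : Space d) (i j k l : Fin d) :
    ∑ m, (ξ i * kron m j + kron m i * ξ j) * (ξ k * kron m l + kron m k * ξ l) =
      ξ i * ξ k * kron j l + ξ i * ξ l * kron j k + ξ j * ξ k * kron i l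
        + ξ j * ξ l * kron i k := by
  have : ∀ m, (ξ i * kron m j + kron m i * ξ j) * (ξ k * kron m l + kron m k * ξ l) =
      ξ i * ξ k * (kron m j * kron m l) + ξ i * ξ l * (kron m j * kron m k)
        + ξ j * ξ k * (kron m i * kron m l) + ξ j * ξ l * (kron m i * kron m k) := by
    intro m; ring
  simp only [this, Finset.sum_add_distrib, ← Finset.mul_sum, sum_kron_mul']

lemma greenTensor_eq (κ₀ μ₀ : ℝ) (ξ : Space d) (i j k l : Fin d) :
    greenTensor κ₀ μ₀ ξ i j k l = 1 / (4 * μ₀) / ‖ξ‖ ^ 2 *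
      (ξ i * ξ k * kron j l + ξ i * ξ l * kron j k + ξ j * ξ k * kron i l + ξ j * ξ l * kron i k)
      + greenCoeff d κ₀ μ₀ / ‖ξ‖ ^ 4 * ((ξ i * ξ j) * (ξ k * ξ l)) := by
  simp only [greenTensor, sum_psi_mul, greenCoeff]

lemma qdot_sphT (A : Tensor4 d) :
    qdot A (sphT d) = (1 / (d : ℝ)) * ∑ i, ∑ k, A i i k k := by
  have h : ∀ i j k, ∑ l, A i j k l * sphT d i j k l = (1 / (d : ℝ)) * kron i j * A i j k k := by
    intro i j k
    have : ∀ l, A i j k l * sphT d i j k l = (1 / (d : ℝ)) * kron i j * (A i j k l * kron k l) := by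
      intro l; simp only [sphT]; ring
    simp only [this, ← Finset.mul_sum, sum_mul_kron]
  have h2 : ∀ i, ∑ j, ∑ k, ∑ l, A i j k l * sphT d i j k l
      = (1 / (d : ℝ)) * ∑ k, A i i k k := by
    intro i
    simp only [h, ← Finset.mul_sum, mul_assoc, sum_kron_mul]
  simp only [qdot, h2, ← Finset.mul_sum]

lemma qdot_idT (A : Tensor4 d) :
    qdot A (idT d) = (1 / 2 : ℝ) * ∑ i, ∑ j, (A i j i j + A i j j i) := by
  have h : ∀ i j, ∑ k, ∑ l, A i j k l * idT d i j k l
      = (1 / 2 : ℝ) * (A i j i j + A i j j i) := by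
    intro i j
    have : ∀ k l, A i j k l * idT d i j k l =
        (1 / 2 : ℝ) * (kron i k * (A i j k l * kron j l))
          + (1 / 2 : ℝ) * (kron j k * (A i j k l * kron i l)) := by
      intro k l; simp only [idT]; ring
    simp only [this, Finset.sum_add_distrib, ← Finset.mul_sum, sum_mul_kron, sum_kron_mul]
    ring
  simp only [qdot, h, ← Finset.mul_sum]

/-- The contraction is homogeneous of degree zero in ξ and depends on ξ only through its norm, so
all powers of the norm cancel. -/
lemma qdot_green_sphT (hd : d ≠ 0) {κ₀ μ₀ : ℝ} {ξ : Space d} (hξ : ξ ≠ 0) :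
    qdot (greenTensor κ₀ μ₀ ξ) (sphT d) = (1 / (d : ℝ)) * (1 / μ₀ + greenCoeff d κ₀ μ₀) := by
  have hN : ‖ξ‖ ≠ 0 := norm_ne_zero_iff.2 hξ
  have h : ∀ i k, greenTensor κ₀ μ₀ ξ i i k k = 1 / μ₀ / ‖ξ‖ ^ 2 * (ξ i * (ξ k * kron i k))
      + greenCoeff d κ₀ μ₀ / ‖ξ‖ ^ 4 * ((ξ i * ξ i) * (ξ k * ξ k)) := by
    intro i k; rw [greenTensor_eq]; ring
  simp only [qdot_sphT, h, Finset.sum_add_distrib, ← Finset.mul_sum, sum_mul_kron,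
    ← norm_sq_eq_sum, ← Finset.sum_mul]
  field_simp

lemma qdot_green_idT {κ₀ μ₀ : ℝ} {ξ : Space d} (hξ : ξ ≠ 0) :
    qdot (greenTensor κ₀ μ₀ ξ) (idT d) = ((d : ℝ) + 1) / (2 * μ₀) + greenCoeff d κ₀ μ₀ := by
  have hN : ‖ξ‖ ≠ 0 := norm_ne_zero_iff.2 hξ
  have h : ∀ i j, greenTensor κ₀ μ₀ ξ i j i j + greenTensor κ₀ μ₀ ξ i j j i =
      1 / (2 * μ₀) / ‖ξ‖ ^ 2 * ((ξ i * ξ i) * 1 + 1 * (ξ j * ξ j)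
        + 2 * (ξ i * (ξ j * kron i j))) +
      2 * greenCoeff d κ₀ μ₀ / ‖ξ‖ ^ 4 * ((ξ i * ξ i) * (ξ j * ξ j)) := by
    intro i j
    rw [greenTensor_eq, greenTensor_eq, kron_comm j i]
    simp only [kron, if_true]
    ring
  simp only [qdot_idT, h, Finset.sum_add_distrib, ← Finset.mul_sum, sum_mul_kron,
    ← norm_sq_eq_sum, ← Finset.sum_mul]
  simp
  field_simp
  ring

lemma qdot_sub (A B C : Tensor4 d) : qdot A (B - C) = qdot A B - qdot A C := by
  simp [qdot, mul_sub, Finset.sum_sub_distrib]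

/-- The trace of the Green's tensor against a projector does not depend on the wave vector. -/
lemma qdot_green_eq (hd : d ≠ 0) {κ₀ μ₀ : ℝ} {P : Tensor4 d} (hP : P = sphT d ∨ P = devT d)
    {ξ ζ : Space d} (hξ : ξ ≠ 0) (hζ : ζ ≠ 0) :
    qdot (greenTensor κ₀ μ₀ ξ) P = qdot (greenTensor κ₀ μ₀ ζ) P := by
  rcases hP with rfl | rfl
  · rw [qdot_green_sphT hd hξ, qdot_green_sphT hd hζ]
  · simp only [devT, qdot_sub]
    rw [qdot_green_sphT hd hξ, qdot_green_sphT hd hζ, qdot_green_idT hξ, qdot_green_idT hζ]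

lemma green_app_apply (κ₀ μ₀ : ℝ) (ξ : Space d) {σ : Tensor2 d} (hσ : σ.IsSymm) (i j : Fin d) :
    (greenTensor κ₀ μ₀ ξ).app σ i j =
      1 / (2 * μ₀) / ‖ξ‖ ^ 2 * (ξ i * (∑ k, σ j k * ξ k) + ξ j * (∑ k, σ i k * ξ k))
      + greenCoeff d κ₀ μ₀ / ‖ξ‖ ^ 4 * (∑ k, ξ k * ∑ l, σ k l * ξ l) * (ξ i * ξ j) := by
  have hs : ∀ i j, σ j i = σ i j := fun i j => hσ.apply i j
  have h : ∀ k l, greenTensor κ₀ μ₀ ξ i j k l * σ k l =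
      1 / (4 * μ₀) / ‖ξ‖ ^ 2 * ξ i * (ξ k * (σ k l * kron j l))
      + 1 / (4 * μ₀) / ‖ξ‖ ^ 2 * ξ i * (kron j k * (σ k l * ξ l))
      + 1 / (4 * μ₀) / ‖ξ‖ ^ 2 * ξ j * (ξ k * (σ k l * kron i l))
      + 1 / (4 * μ₀) / ‖ξ‖ ^ 2 * ξ j * (kron i k * (σ k l * ξ l))
      + greenCoeff d κ₀ μ₀ / ‖ξ‖ ^ 4 * (ξ i * ξ j) * (ξ k * (σ k l * ξ l)) := by
    intro k l; rw [greenTensor_eq]; ring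
  simp only [Tensor4.app, Matrix.of_apply, h, Finset.sum_add_distrib, ← Finset.mul_sum,
    sum_mul_kron, sum_kron_mul]
  have e : ∀ i, ∑ k, ξ k * σ k i = ∑ k, σ i k * ξ k := fun i =>
    Finset.sum_congr rfl fun k _ => by rw [hs, mul_comm]
  rw [e i, e j]
  ring

/-- Fourier form of the fact that the Green operator produces compatible strains: v is the amplitude
of a displacement. -/
lemma green_app_eq_symm_outer (κ₀ μ₀ : ℝ) (ξ : Space d) {σ : Tensor2 d} (hσ : σ.IsSymm) :
    ∃ v : Fin d → ℝ, ∀ i j,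
      (greenTensor κ₀ μ₀ ξ).app σ i j = (1 / 2 : ℝ) * (v i * ξ j + v j * ξ i) := by
  refine ⟨fun i => 1 / μ₀ / ‖ξ‖ ^ 2 * (∑ k, σ i k * ξ k) +
    greenCoeff d κ₀ μ₀ / ‖ξ‖ ^ 4 * (∑ k, ξ k * ∑ l, σ k l * ξ l) * ξ i, fun i j => ?_⟩
  rw [green_app_apply _ _ _ hσ]
  ring

lemma isoStiffness_app (hd : d ≠ 0) (κ₀ μ₀ : ℝ) {τ : Tensor2 d} (hτ : τ.IsSymm) (i j : Fin d) :
    (isoStiffness d κ₀ μ₀).app τ i j =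
      (κ₀ - 2 * μ₀ / d) * (∑ k, τ k k) * kron i j + 2 * μ₀ * τ i j := by
  have hd' : (d : ℝ) ≠ 0 := by exact_mod_cast hd
  have hs : τ j i = τ i j := hτ.apply i j
  simp only [isoStiffness, app_add, app_smul, devT, app_sub, Matrix.add_apply, Matrix.smul_apply,
    Matrix.sub_apply, sphT_app_apply, idT_app_apply, smul_eq_mul, hs]
  field_simp
  ring

lemma isSymm_green_app (κ₀ μ₀ : ℝ) (ξ : Space d) {σ : Tensor2 d} (hσ : σ.IsSymm) :
    ((greenTensor κ₀ μ₀ ξ).app σ).IsSymm := by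
  ext i j
  rw [Matrix.transpose_apply, green_app_apply _ _ _ hσ, green_app_apply _ _ _ hσ]
  ring

/-- The polarization `L₀ : Γ̂₀(ξ) : σ - σ` is in equilibrium at the wave vector `ξ`. -/
lemma stiffness_green_sub_mul (hd : 2 ≤ d) {κ₀ μ₀ : ℝ} (hκ : 0 < κ₀) (hμ : 0 < μ₀) {ξ : Space d}
    (hξ : ξ ≠ 0) {σ : Tensor2 d} (hσ : σ.IsSymm) (i : Fin d) :
    ∑ j, ((isoStiffness d κ₀ μ₀).app ((greenTensor κ₀ μ₀ ξ).app σ) i j - σ i j) * ξ j = 0 := by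
  have hd2 : (2 : ℝ) ≤ d := by exact_mod_cast hd
  have hN : ‖ξ‖ ≠ 0 := norm_ne_zero_iff.2 hξ
  have hD : (d : ℝ) * κ₀ + 2 * ((d : ℝ) - 1) * μ₀ ≠ 0 := by
    have : 0 < (d : ℝ) * κ₀ + 2 * ((d : ℝ) - 1) * μ₀ := by
      have h1 : 0 < (d : ℝ) * κ₀ := by positivity
      have h2 : 0 < ((d : ℝ) - 1) * μ₀ := mul_pos (by linarith) hμ
      linarith
    exact this.ne'
  set s : Fin d → ℝ := fun i => ∑ k, σ i k * ξ k with hs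
  set q : ℝ := ∑ k, ξ k * s k with hq
  have hG : ∀ i j, (greenTensor κ₀ μ₀ ξ).app σ i j = 1 / (2 * μ₀) / ‖ξ‖ ^ 2 *
      (ξ i * s j + ξ j * s i) + greenCoeff d κ₀ μ₀ / ‖ξ‖ ^ 4 * q * (ξ i * ξ j) :=
    fun i j => green_app_apply _ _ _ hσ i j
  have htr : ∑ k, (greenTensor κ₀ μ₀ ξ).app σ k k =
      q / ‖ξ‖ ^ 2 * (1 / μ₀ + greenCoeff d κ₀ μ₀) := by
    simp only [hG, Finset.sum_add_distrib, ← Finset.mul_sum, ← hq, ← norm_sq_eq_sum]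
    field_simp
    ring
  -- The σ ξ terms of the residual cancel, leaving a multiple of ξ. This is its coefficient, and its
  -- vanishing is what determines `greenCoeff`.
  have hcoef : (κ₀ - 2 * μ₀ / d) * (1 / μ₀ + greenCoeff d κ₀ μ₀) + 1
      + 2 * μ₀ * greenCoeff d κ₀ μ₀ = 0 := by
    have hd0 : (d : ℝ) ≠ 0 := by positivity
    simp only [greenCoeff]
    generalize hDef : (d : ℝ) * κ₀ + 2 * ((d : ℝ) - 1) * μ₀ = D at hD
    field_simp
    rw [← hDef]
    ring
  have e1 : ∑ j, (κ₀ - 2 * μ₀ / d) * (q / ‖ξ‖ ^ 2 * (1 / μ₀ + greenCoeff d κ₀ μ₀)) * kron i j * ξ j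
      = (κ₀ - 2 * μ₀ / d) * (q / ‖ξ‖ ^ 2 * (1 / μ₀ + greenCoeff d κ₀ μ₀)) * ξ i := by
    simp only [mul_assoc, ← Finset.mul_sum, sum_kron_mul]
  have e2 : ∑ j, 2 * μ₀ * (1 / (2 * μ₀) / ‖ξ‖ ^ 2 * (ξ i * s j + ξ j * s i) +
      greenCoeff d κ₀ μ₀ / ‖ξ‖ ^ 4 * q * (ξ i * ξ j)) * ξ j =
      1 / ‖ξ‖ ^ 2 * (ξ i * q + ‖ξ‖ ^ 2 * s i)
        + 2 * μ₀ * (greenCoeff d κ₀ μ₀ / ‖ξ‖ ^ 4 * q * (ξ i * ‖ξ‖ ^ 2)) := by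
    have : ∀ j, 2 * μ₀ * (1 / (2 * μ₀) / ‖ξ‖ ^ 2 * (ξ i * s j + ξ j * s i) +
      greenCoeff d κ₀ μ₀ / ‖ξ‖ ^ 4 * q * (ξ i * ξ j)) * ξ j =
      1 / ‖ξ‖ ^ 2 * ξ i * (ξ j * s j) + 1 / ‖ξ‖ ^ 2 * s i * (ξ j * ξ j) +
        2 * μ₀ * (greenCoeff d κ₀ μ₀ / ‖ξ‖ ^ 4 * q * ξ i) * (ξ j * ξ j) := by
      intro j; field_simp
    simp only [this, Finset.sum_add_distrib, ← Finset.mul_sum, ← hq, ← norm_sq_eq_sum]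
    ring
  have hterm : ∀ j, ((isoStiffness d κ₀ μ₀).app ((greenTensor κ₀ μ₀ ξ).app σ) i j - σ i j) * ξ j =
      (κ₀ - 2 * μ₀ / d) * (q / ‖ξ‖ ^ 2 * (1 / μ₀ + greenCoeff d κ₀ μ₀)) * kron i j * ξ j
      + 2 * μ₀ * (1 / (2 * μ₀) / ‖ξ‖ ^ 2 * (ξ i * s j + ξ j * s i) +
      greenCoeff d κ₀ μ₀ / ‖ξ‖ ^ 4 * q * (ξ i * ξ j)) * ξ j - σ i j * ξ j := by
    intro j
    rw [isoStiffness_app (by omega : d ≠ 0) _ _ (isSymm_green_app κ₀ μ₀ ξ hσ), htr, hG]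
    ring
  have e3 : ∑ j, σ i j * ξ j = s i := rfl
  rw [Finset.sum_congr rfl fun j _ => hterm j, Finset.sum_sub_distrib, Finset.sum_add_distrib,
    e1, e2, e3]
  have hmul := congrArg (fun z => z * (ξ i * q / ‖ξ‖ ^ 2)) hcoef
  simp only [zero_mul] at hmul
  rw [← hmul]
  field_simp
  ring

end Algebra

/-! ### Coercive problems on a closed subspace of a Hilbert space -/

section Coercive

open scoped InnerProductSpace

variable {H : Type*} [NormedAddCommGroup H] [InnerProductSpace ℝ H]

/-- Lax–Milgram on a closed subspace `E`: the solution operator of `⟪T e, v⟫ = ⟪τ, v⟫`, `v ∈ E`. -/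
lemma exists_solution_operator [CompleteSpace H] (E : Submodule ℝ H) (hE : IsClosed (E : Set H)) (T : H →L[ℝ] H)
    {c : ℝ} (hc : 0 < c) (hT : ∀ e ∈ E, c * ‖e‖ ^ 2 ≤ ⟪T e, e⟫_ℝ) :
    ∃ Γ : H →L[ℝ] H, ∀ τ, Γ τ ∈ E ∧ ∀ v ∈ E, ⟪T (Γ τ), v⟫_ℝ = ⟪τ, v⟫_ℝ := by
  have : CompleteSpace E := hE.completeSpace_coe
  let B : E →L[ℝ] E →L[ℝ] ℝ := LinearMap.mkContinuous₂
    (LinearMap.mk₂ ℝ (fun x y : E => ⟪T x, (y : H)⟫_ℝ)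
      (fun x y z => by simp [inner_add_left]) (fun r x y => by simp [real_inner_smul_left])
      (fun x y z => by simp [inner_add_right]) (fun r x y => by simp [real_inner_smul_right]))
    ‖T‖ (fun x y => by
      rw [LinearMap.mk₂_apply]
      refine (norm_inner_le_norm _ _).trans ?_
      have := T.le_opNorm (x : H)
      gcongr
      · exact this
      · exact le_rfl)
  have hB : IsCoercive B := ⟨c, hc, fun u => by
    have := hT u u.2
    rw [sq, ← mul_assoc] at this
    exact this⟩
  let S := hB.continuousLinearEquivOfBilin
  -- Tested against E, τ may be replaced by its orthogonal projection onto E, to which the inverse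
  -- of the Lax–Milgram equivalence applies.
  refine ⟨E.subtypeL ∘L (S.symm : E →L[ℝ] E) ∘L E.orthogonalProjectionOnto, fun τ => ⟨?_, ?_⟩⟩
  · simp
  intro v hv
  have h := hB.continuousLinearEquivOfBilin_apply (S.symm (E.orthogonalProjectionOnto τ)) ⟨v, hv⟩
  have h2 : B (S.symm (E.orthogonalProjectionOnto τ)) ⟨v, hv⟩ =
      ⟪T ((S.symm (E.orthogonalProjectionOnto τ) : E) : H), v⟫_ℝ := rfl
  rw [h2] at h
  change ⟪T ((S.symm (E.orthogonalProjectionOnto τ) : E) : H), v⟫_ℝ = _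
  rw [← h]
  have h3 : hB.continuousLinearEquivOfBilin (S.symm (E.orthogonalProjectionOnto τ)) =
      E.orthogonalProjectionOnto τ := S.apply_symm_apply _
  rw [h3]
  exact Submodule.inner_orthogonalProjectionOnto_eq_of_mem_right (K := E) ⟨v, hv⟩ τ

/-- Test the equation with w itself. With y = 0 this is uniqueness, and it is also the only a priori
estimate used below. -/
lemma norm_le_of_coercive {E : Submodule ℝ H} {T : H →L[ℝ] H} {c : ℝ}
    (hT : ∀ e ∈ E, c * ‖e‖ ^ 2 ≤ ⟪T e, e⟫_ℝ) {w y : H} (hw : w ∈ E)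
    (h : ∀ v ∈ E, ⟪T w, v⟫_ℝ = ⟪y, v⟫_ℝ) : c * ‖w‖ ≤ ‖y‖ := by
  rcases eq_or_ne w 0 with rfl | h0
  · simp
  have hw0 : 0 < ‖w‖ := norm_pos_iff.2 h0
  have h1 := (hT w hw).trans_eq (h w hw)
  have h2 := real_inner_le_norm y w
  nlinarith

/-- Expansion of a quadratic functional of the solution to first order in the perturbation `R`. -/
lemma abs_energy_sub_le {E : Submodule ℝ H} {T R X Γ : H →L[ℝ] H} {c : ℝ} (hc : 0 < c)
    (hT : ∀ e ∈ E, c * ‖e‖ ^ 2 ≤ ⟪T e, e⟫_ℝ)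
    (hΓ : ∀ τ, Γ τ ∈ E ∧ ∀ v ∈ E, ⟪T (Γ τ), v⟫_ℝ = ⟪τ, v⟫_ℝ) (hR : ‖R‖ ≤ c / 2)
    (hX : ∀ x y, ⟪X x, y⟫_ℝ = ⟪x, X y⟫_ℝ) {s e : H} (he : e ∈ E)
    (hs : ∀ v ∈ E, ⟪T s, v⟫_ℝ = 0) (heq : ∀ v ∈ E, ⟪(T + R) (s + e), v⟫_ℝ = 0) :
    |⟪X (s + e), s + e⟫_ℝ - (⟪X s, s⟫_ℝ - 2 * ⟪X s, Γ (R s)⟫_ℝ)| ≤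
      8 * ‖X‖ * ‖s‖ ^ 2 / c ^ 2 * ‖R‖ ^ 2 := by
  -- On E, the fluctuation e solves T e = -R (s + e).
  have h1 : c * ‖e‖ ≤ ‖R‖ * (‖s‖ + ‖e‖) := by
    have h := norm_le_of_coercive hT (y := -R (s + e)) he fun v hv => by
      have h2 := heq v hv
      rw [add_apply, inner_add_left, map_add T, inner_add_left, hs v hv] at h2
      rw [inner_neg_left]
      linarith
    rw [norm_neg] at h
    refine h.trans ((R.le_opNorm _).trans ?_)
    gcongr
    exact norm_add_le _ _
  -- Subtracting the first-order approximation -Γ R s leaves the source -R e, which is smaller by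
  -- one more factor of R.
  have h2 : c * ‖e + Γ (R s)‖ ≤ ‖R‖ * ‖e‖ := by
    have h := norm_le_of_coercive hT (y := -R e) (E.add_mem he (hΓ (R s)).1) fun v hv => by
      have h2 := heq v hv
      rw [add_apply, inner_add_left, map_add T, inner_add_left, hs v hv, map_add R,
        inner_add_left] at h2
      rw [inner_neg_left, map_add, inner_add_left, (hΓ (R s)).2 v hv]
      linarith
    rw [norm_neg] at h
    exact h.trans (R.le_opNorm _)
  -- Since ‖R‖ ≤ c / 2, the term ‖R‖ ‖e‖ in `h1` is absorbed on the left at the cost of a factor 2.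
  have h3 : ‖e‖ ≤ 2 * ‖R‖ * ‖s‖ / c := by
    rw [le_div_iff₀ hc]
    have := mul_le_mul_of_nonneg_right hR (norm_nonneg e)
    nlinarith
  have h4 : ‖e + Γ (R s)‖ ≤ 2 * ‖R‖ ^ 2 * ‖s‖ / c ^ 2 := by
    have h5 : ‖e + Γ (R s)‖ ≤ ‖R‖ * ‖e‖ / c := by
      rw [le_div_iff₀ hc]; linarith
    refine h5.trans ?_
    have h6 := mul_le_mul_of_nonneg_left h3 (norm_nonneg R)
    rw [div_le_iff₀ hc]
    refine h6.trans_eq ?_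
    field_simp
  have hexp : ⟪X (s + e), s + e⟫_ℝ - (⟪X s, s⟫_ℝ - 2 * ⟪X s, Γ (R s)⟫_ℝ) =
      2 * ⟪X s, e + Γ (R s)⟫_ℝ + ⟪X e, e⟫_ℝ := by
    have h7 : ⟪X e, s⟫_ℝ = ⟪X s, e⟫_ℝ := by rw [hX, real_inner_comm]
    simp only [map_add, inner_add_left, inner_add_right, h7]
    ring
  rw [hexp]
  have h8 : |⟪X s, e + Γ (R s)⟫_ℝ| ≤ ‖X‖ * ‖s‖ * (2 * ‖R‖ ^ 2 * ‖s‖ / c ^ 2) :=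
    (abs_real_inner_le_norm _ _).trans
      (mul_le_mul (X.le_opNorm s) h4 (norm_nonneg _) (by positivity))
  have h9 : |⟪X e, e⟫_ℝ| ≤ ‖X‖ * (2 * ‖R‖ * ‖s‖ / c) * (2 * ‖R‖ * ‖s‖ / c) := by
    refine (abs_real_inner_le_norm _ _).trans ?_
    refine mul_le_mul ((X.le_opNorm e).trans ?_) h3 (norm_nonneg _) (by positivity)
    gcongr
  refine (abs_add_le _ _).trans ?_
  rw [abs_mul, abs_two]
  -- The cross term and the term quadratic in e each contribute 4 to the constant 8.
  have h10 : 2 * (‖X‖ * ‖s‖ * (2 * ‖R‖ ^ 2 * ‖s‖ / c ^ 2)) +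
      ‖X‖ * (2 * ‖R‖ * ‖s‖ / c) * (2 * ‖R‖ * ‖s‖ / c) =
      8 * ‖X‖ * ‖s‖ ^ 2 / c ^ 2 * ‖R‖ ^ 2 := by
    field_simp
    ring
  linarith

/-- Reciprocity: the exact variation of the energy under a perturbation `t X` of the operator. -/
lemma energy_sub_eq {E : Submodule ℝ H} {T X : H →L[ℝ] H} {t : ℝ}
    (hT : ∀ x y, ⟪T x, y⟫_ℝ = ⟪x, T y⟫_ℝ) (hX : ∀ x y, ⟪X x, y⟫_ℝ = ⟪x, X y⟫_ℝ) {s e e' : H}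
    (he : e ∈ E) (he' : e' ∈ E) (heq : ∀ v ∈ E, ⟪T (s + e), v⟫_ℝ = 0)
    (heq' : ∀ v ∈ E, ⟪(T + t • X) (s + e'), v⟫_ℝ = 0) :
    ⟪(T + t • X) (s + e'), s⟫_ℝ - ⟪T (s + e), s⟫_ℝ = t * ⟪X (s + e), s + e'⟫_ℝ := by
  -- Each stress is orthogonal to E, so s may be completed to the total strain of the other problem.
  -- The T terms then cancel by symmetry, leaving an exact identity.
  have h1 : ⟪(T + t • X) (s + e'), s⟫_ℝ = ⟪(T + t • X) (s + e'), s + e⟫_ℝ := by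
    rw [inner_add_right, heq' e he, add_zero]
  have h2 : ⟪T (s + e), s⟫_ℝ = ⟪T (s + e), s + e'⟫_ℝ := by
    rw [inner_add_right, heq e' he', add_zero]
  rw [h1, h2, add_apply, smul_apply, inner_add_left, real_inner_smul_left, hT (s + e'),
    hX (s + e'), real_inner_comm (T (s + e)), real_inner_comm (X (s + e))]
  ring

/-- Coercivity with a smaller constant persists under perturbations smaller than c, which gives
solvability both for small contrast and for small changes of p_φ. -/
lemma coercive_add {E : Submodule ℝ H} {T R : H →L[ℝ] H} {c b : ℝ}
    (hT : ∀ e ∈ E, c * ‖e‖ ^ 2 ≤ ⟪T e, e⟫_ℝ) (hR : ‖R‖ ≤ b) :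
    ∀ e ∈ E, (c - b) * ‖e‖ ^ 2 ≤ ⟪(T + R) e, e⟫_ℝ := by
  intro e he
  have h1 := hT e he
  have h2 : |⟪R e, e⟫_ℝ| ≤ b * ‖e‖ ^ 2 := by
    refine (abs_real_inner_le_norm _ _).trans ?_
    rw [sq, ← mul_assoc]
    exact mul_le_mul_of_nonneg_right (R.le_of_opNorm_le hR e) (norm_nonneg _)
  rw [add_apply, inner_add_left]
  have := (abs_le.1 h2).1
  linarith

/-- Continuous dependence of the solution on the operator. -/
lemma norm_solution_sub_le {E : Submodule ℝ H} {T X : H →L[ℝ] H} {c t : ℝ}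
    (hT : ∀ e ∈ E, c * ‖e‖ ^ 2 ≤ ⟪(T + t • X) e, e⟫_ℝ) {s e e' : H}
    (he : e ∈ E) (he' : e' ∈ E) (heq : ∀ v ∈ E, ⟪T (s + e), v⟫_ℝ = 0)
    (heq' : ∀ v ∈ E, ⟪(T + t • X) (s + e'), v⟫_ℝ = 0) :
    c * ‖e' - e‖ ≤ |t| * ‖X (s + e)‖ := by
  have h := norm_le_of_coercive hT (y := -(t • X (s + e))) (E.sub_mem he' he) fun v hv => by
    have h1 := heq v hv
    have h2 := heq' v hv
    have h3 : e' - e = (s + e') - (s + e) := by abel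
    rw [h3, map_sub, inner_sub_left, h2, add_apply, smul_apply, inner_add_left, h1, inner_neg_left]
    ring
  rwa [norm_neg, norm_smul, Real.norm_eq_abs] at h

end Coercive

/-! ### Fourier series on the unit cell -/

section Fourier

variable {d : ℕ} (a : Module.Basis (Fin d) ℝ (Space d))

/-- Lebesgue measure on the unit cell. -/
abbrev cellMeasure : Measure (Space d) := volume.restrict (cell a)

lemma measurableSet_cell : MeasurableSet (cell a) := ZSpan.fundamentalDomain_measurableSet a

lemma isBounded_cell : Bornology.IsBounded (cell a) := ZSpan.fundamentalDomain_isBounded a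

lemma volume_cell_ne_zero : volume (cell a) ≠ 0 := ZSpan.measure_fundamentalDomain_ne_zero a

lemma volume_cell_ne_top : volume (cell a) ≠ ⊤ := (isBounded_cell a).measure_lt_top.ne

instance isFiniteMeasure_cell : IsFiniteMeasure (cellMeasure a) :=
  ⟨by rw [Measure.restrict_apply_univ]; exact (isBounded_cell a).measure_lt_top⟩

/-- The dual lattice vector with integer coordinates `n`. -/
def dualVec (n : Fin d → ℤ) : Space d :=
  WithLp.toLp 2 fun j => 2 * Real.pi * ∑ i, (n i : ℝ) * a.repr (EuclideanSpace.single j 1) i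

/-- The phase `ξₙ · x` of the `n`-th plane wave. -/
def wave (n : Fin d → ℤ) (x : Space d) : ℝ := ∑ j, dualVec a n j * x j

lemma wave_eq (n : Fin d → ℤ) (x : Space d) :
    wave a n x = 2 * Real.pi * ∑ i, (n i : ℝ) * a.repr x i := by
  have hx : x = ∑ j, x j • EuclideanSpace.single j (1 : ℝ) := by
    ext i
    simp [Finset.sum_apply, Pi.single_apply]
  conv_rhs => rw [hx]
  simp only [wave, dualVec, map_sum, map_smul, Finsupp.coe_finsetSum, Finset.sum_apply,
    Finsupp.coe_smul, Pi.smul_apply, smul_eq_mul, Finset.mul_sum, Finset.sum_mul]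
  rw [Finset.sum_comm]
  refine Finset.sum_congr rfl fun i _ => Finset.sum_congr rfl fun j _ => ?_
  ring

lemma wave_basis (n : Fin d → ℤ) (i : Fin d) : wave a n (a i) = 2 * Real.pi * n i := by
  rw [wave_eq]
  simp [Finsupp.single_apply]

-- The torus then carries the product of Haar probability measures, the measure of the multivariate
-- Fourier basis.
local instance : MeasureSpace UnitAddCircle := ⟨AddCircle.haarAddCircle⟩

local instance : IsProbabilityMeasure (volume : Measure UnitAddCircle) :=
  inferInstanceAs (IsProbabilityMeasure AddCircle.haarAddCircle)

/-- The point of (the closure of) the unit cell with given angular coordinates. -/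
def torusPoint (y : UnitAddTorus (Fin d)) : Space d :=
  a.equivFun.symm fun i => (AddCircle.equivIoc 1 0 (y i)).1

lemma repr_torusPoint (y : UnitAddTorus (Fin d)) (i : Fin d) :
    a.repr (torusPoint a y) i = (AddCircle.equivIoc 1 0 (y i)).1 := by
  have := congrFun (a.equivFun.apply_symm_apply fun i => (AddCircle.equivIoc 1 0 (y i)).1) i
  rwa [Module.Basis.equivFun_apply] at this

/-- The angular coordinates fill the box of half-open intervals (0, 1], which agrees up to a null
set with the box [0, 1)ᵈ parametrizing the cell. A linear isomorphism maps Lebesgue measure to a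
multiple of Lebesgue measure. -/
lemma measurePreserving_torusPoint :
    MeasurePreserving (torusPoint a) volume ((cellMeasure a Set.univ)⁻¹ • cellMeasure a) := by
  set L : (Fin d → ℝ) ≃L[ℝ] Space d := a.equivFun.symm.toContinuousLinearEquiv with hL
  set I : Set (Fin d → ℝ) := {x | ∀ i, x i ∈ Set.Ioc ((0 : Fin d → ℝ) i) ((0 : Fin d → ℝ) i + 1)}
    with hI
  have hIm : MeasurableSet I := MeasurableSet.univ_pi' fun i => measurableSet_Ioc
  have h1 := UnitAddTorus.measurePreserving_equivPiIoc (0 : Fin d → ℝ)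
  have h2 : MeasurePreserving (Subtype.val : I → Fin d → ℝ) (Measure.comap Subtype.val volume)
      (volume.restrict I) := measurePreserving_subtype_coe hIm
  have h3 := h2.comp h1
  have hbox : volume.restrict I = volume.restrict (L ⁻¹' cell a) := by
    refine Measure.restrict_congr_set ?_
    have e1 : I = Set.pi Set.univ fun i => Set.Ioc ((0 : Fin d → ℝ) i) ((0 : Fin d → ℝ) i + 1) := by
      ext x; simp [hI, Set.mem_pi]
    have e2 : L ⁻¹' cell a =
        Set.pi Set.univ fun i => Set.Ico ((0 : Fin d → ℝ) i) ((0 : Fin d → ℝ) i + 1) := by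
      ext x
      simp only [Set.mem_preimage, cell, ZSpan.mem_fundamentalDomain, Set.mem_pi, Set.mem_univ,
        forall_true_left]
      refine forall_congr' fun i => ?_
      have : a.repr (L x) i = x i := by
        have := congrFun (a.equivFun.apply_symm_apply x) i
        rwa [Module.Basis.equivFun_apply] at this
      rw [this]; simp
    rw [e1, e2]
    exact (Measure.univ_pi_Ioc_ae_eq_Icc (μ := fun _ : Fin d => (volume : Measure ℝ))).trans
      (Measure.univ_pi_Ico_ae_eq_Icc (μ := fun _ : Fin d => (volume : Measure ℝ))).symm
  have hLm : Measurable L := L.continuous.measurable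
  obtain ⟨k, hk⟩ : ∃ k : ENNReal,
      Measure.map L volume = k • (volume : Measure (Space d)) := by
    have : (Measure.map L (volume : Measure (Fin d → ℝ))).IsAddHaarMeasure :=
      L.isAddHaarMeasure_map volume
    exact ⟨_, Measure.isAddLeftInvariant_eq_smul _ _⟩
  have h4 : Measure.map L (volume.restrict I) = k • cellMeasure a := by
    rw [hbox, ← Measure.restrict_map hLm (measurableSet_cell a), hk, Measure.restrict_smul]
  have h5 : MeasurePreserving (torusPoint a) volume (k • cellMeasure a) :=
    (MeasurePreserving.mk hLm h4).comp h3
  -- The scaling factor is found from the total mass 1, without evaluating a determinant.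
  have hk1 : k = (cellMeasure a Set.univ)⁻¹ := by
    have := h5.measure_preimage (s := Set.univ) MeasurableSet.univ.nullMeasurableSet
    rw [Set.preimage_univ, measure_univ, Measure.smul_apply, smul_eq_mul] at this
    exact ENNReal.eq_inv_of_mul_eq_one_left this.symm
  rw [← hk1]
  exact h5

lemma mFourier_torusPoint (n : Fin d → ℤ) (y : UnitAddTorus (Fin d)) :
    UnitAddTorus.mFourier (-n) y =
      (Real.cos (wave a n (torusPoint a y)) : ℂ) - Real.sin (wave a n (torusPoint a y)) * Complex.I
      := by
  have h : ∀ i, fourier ((-n) i) (y i) =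
      Complex.exp (-(2 * Real.pi * Complex.I * (n i) * (AddCircle.equivIoc 1 0 (y i)).1)) := by
    intro i
    have hy : y i = (((AddCircle.equivIoc 1 0 (y i)).1 : ℝ) : UnitAddCircle) :=
      ((AddCircle.equivIoc 1 0).symm_apply_apply (y i)).symm
    conv_lhs => rw [hy]
    rw [fourier_coe_apply]
    congr 1
    simp
  change ∏ i, fourier ((-n) i) (y i) = _
  simp only [h]
  rw [← Complex.exp_sum, Complex.ofReal_cos, Complex.ofReal_sin]
  have e : ∑ i, -(2 * Real.pi * Complex.I * (n i) * ((AddCircle.equivIoc 1 0 (y i)).1 : ℝ)) =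
      (-(wave a n (torusPoint a y) : ℝ) : ℂ) * Complex.I := by
    rw [wave_eq]
    push_cast
    simp only [repr_torusPoint, Finset.mul_sum, Finset.sum_mul, ← Finset.sum_neg_distrib]
    refine Finset.sum_congr rfl fun i _ => ?_
    ring
  rw [e, Complex.exp_mul_I, Complex.cos_neg, Complex.sin_neg]
  ring

lemma continuous_wave (n : Fin d → ℤ) : Continuous (wave a n) := by
  unfold wave; fun_prop

/-- **Parseval's identity** on the unit cell, in real form. -/
theorem hasSum_sq_fourier {f : Space d → ℝ} (hf : MemLp f 2 (cellMeasure a)) :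
    HasSum (fun n : Fin d → ℤ => (⨍ x in cell a, f x * Real.cos (wave a n x)) ^ 2 +
      (⨍ x in cell a, f x * Real.sin (wave a n x)) ^ 2) (⨍ x in cell a, f x ^ 2) := by
  set ν : Measure (Space d) := (cellMeasure a Set.univ)⁻¹ • cellMeasure a with hν
  have hmp : MeasurePreserving (torusPoint a) volume ν := measurePreserving_torusPoint a
  have hc : (cellMeasure a Set.univ)⁻¹ ≠ ⊤ := by
    rw [Measure.restrict_apply_univ]
    simpa using volume_cell_ne_zero a
  have hfν : MemLp f 2 ν := hf.smul_measure hc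
  have : IsFiniteMeasure ν := by
    refine ⟨?_⟩
    rw [hν, Measure.smul_apply, smul_eq_mul]
    exact ENNReal.mul_lt_top hc.lt_top (measure_lt_top _ _)
  have htr : ∀ g : Space d → ℝ, AEStronglyMeasurable g ν →
      ∫ y, g (torusPoint a y) = ⨍ x in cell a, g x := by
    intro g hg
    change _ = ∫ x, g x ∂ν
    rw [← hmp.map_eq]
    rw [← hmp.map_eq] at hg
    exact (integral_map hmp.measurable.aemeasurable hg).symm
  set F : UnitAddTorus (Fin d) → ℂ := fun y => (f (torusPoint a y) : ℂ) with hF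
  have hFm : MemLp F 2 volume := (hfν.comp_measurePreserving hmp).ofReal
  have hP := UnitAddTorus.hasSum_sq_mFourierCoeff (hFm.toLp F)
  have hI : ∫ t, ‖(hFm.toLp F) t‖ ^ 2 = ⨍ x in cell a, f x ^ 2 := by
    rw [← htr (fun x => f x ^ 2) (hfν.aestronglyMeasurable.pow 2)]
    refine integral_congr_ae ?_
    filter_upwards [hFm.coeFn_toLp] with y hy
    rw [hy]
    simp [hF]
  rw [hI] at hP
  convert! hP using 2 with n
  have hcos : Integrable (fun x => f x * Real.cos (wave a n x)) ν := by
    refine (hfν.integrable (by norm_num)).mul_bdd (c := 1)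
      (Real.continuous_cos.comp (continuous_wave a n)).aestronglyMeasurable ?_
    exact Eventually.of_forall fun x => Real.abs_cos_le_one _
  have hsin : Integrable (fun x => f x * Real.sin (wave a n x)) ν := by
    refine (hfν.integrable (by norm_num)).mul_bdd (c := 1)
      (Real.continuous_sin.comp (continuous_wave a n)).aestronglyMeasurable ?_
    exact Eventually.of_forall fun x => Real.abs_sin_le_one _
  -- As f is real, the complex coefficient has the cosine and sine averages as real and negated
  -- imaginary part; its squared modulus is the sum of their squares.
  have hcoef : UnitAddTorus.mFourierCoeff (hFm.toLp F) n =
      ((⨍ x in cell a, f x * Real.cos (wave a n x) : ℝ) : ℂ) -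
        ((⨍ x in cell a, f x * Real.sin (wave a n x) : ℝ) : ℂ) * Complex.I := by
    have h1 : UnitAddTorus.mFourierCoeff (hFm.toLp F) n = ∫ y,
        (((f (torusPoint a y) * Real.cos (wave a n (torusPoint a y)) : ℝ) : ℂ) -
        ((f (torusPoint a y) * Real.sin (wave a n (torusPoint a y)) : ℝ) : ℂ) * Complex.I) := by
      refine integral_congr_ae ?_
      filter_upwards [hFm.coeFn_toLp] with y hy
      rw [hy, mFourier_torusPoint a, smul_eq_mul]
      simp only [hF]
      push_cast
      ring
    rw [h1, integral_sub, integral_mul_const, integral_complex_ofReal, integral_complex_ofReal,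
      htr _ hcos.aestronglyMeasurable, htr _ hsin.aestronglyMeasurable]
    · exact (hmp.integrable_comp_of_integrable hcos).ofReal
    · exact ((hmp.integrable_comp_of_integrable hsin).ofReal).mul_const _
  rw [hcoef, ← Complex.normSq_eq_norm_sq]
  simp [Complex.normSq_apply]
  ring

end Fourier

/-! ### Periodic functions -/

section Periodic

variable {d : ℕ} {a : Module.Basis (Fin d) ℝ (Space d)}

lemma IsPeriodic.add_mem {X : Type*} {f : Space d → X} (hf : IsPeriodic a f) {v : Space d}
    (hv : v ∈ Submodule.span ℤ (Set.range a)) (x : Space d) : f (x + v) = f x := by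
  induction hv using Submodule.span_induction generalizing x with
  | mem v hv => obtain ⟨i, rfl⟩ := hv; exact hf i x
  | zero => simp
  | add v w _ _ hv hw => rw [← add_assoc, hw, hv]
  | smul n v _ hv =>
    induction n using Int.induction_on generalizing x with
    | zero => simp
    | succ n ih => rw [add_smul, one_smul, ← add_assoc, hv, ih]
    | pred n ih =>
      have := hv (x + (-(n : ℤ) - 1) • v)
      rw [add_assoc, sub_smul, one_smul, sub_add_cancel] at this
      rw [sub_smul, one_smul, ← this, ih]

lemma IsPeriodic.fract {X : Type*} {f : Space d → X} (hf : IsPeriodic a f) (x : Space d) :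
    f (ZSpan.fract a x) = f x := by
  rw [ZSpan.fract_apply]
  have := hf.add_mem (ZSpan.floor a x).2 (x - (ZSpan.floor a x : Space d))
  rw [sub_add_cancel] at this
  exact this.symm

variable (a) in
lemma isPeriodic_fract : IsPeriodic a (ZSpan.fract a) := fun i x =>
  ZSpan.fract_add_ZSpan a x (Submodule.subset_span ⟨i, rfl⟩)

lemma fract_of_mem_cell {x : Space d} (hx : x ∈ cell a) : ZSpan.fract a x = x :=
  ZSpan.fract_eq_self.2 hx

lemma bounded_on_cell {f : Space d → ℝ} (hf : Continuous f) : ∃ B, ∀ x ∈ cell a, |f x| ≤ B := by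
  have hc : IsCompact (closure (cell a)) := (isBounded_cell a).isCompact_closure
  obtain ⟨B, hB⟩ := hc.exists_bound_of_continuousOn hf.continuousOn
  exact ⟨B, fun x hx => hB x (subset_closure hx)⟩

lemma IsPeriodic.bounded {f : Space d → ℝ} (hp : IsPeriodic a f) (hf : Continuous f) :
    ∃ B, ∀ x, |f x| ≤ B := by
  obtain ⟨B, hB⟩ := bounded_on_cell (a := a) hf
  refine ⟨B, fun x => ?_⟩
  rw [← hp.fract x]
  exact hB _ (ZSpan.fract_mem_fundamentalDomain a x)

lemma memLp_cell_of_continuous {f : Space d → ℝ} (hf : Continuous f) :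
    MemLp f 2 (cellMeasure a) := by
  obtain ⟨B, hB⟩ := bounded_on_cell (a := a) hf
  refine MemLp.of_bound hf.aestronglyMeasurable B ?_
  exact (ae_restrict_iff' (measurableSet_cell a)).2 (Eventually.of_forall hB)

/-- The translated cell is another fundamental domain of the same lattice, and integrals of periodic
functions agree on all fundamental domains. -/
lemma IsPeriodic.setIntegral_comp_add {f : Space d → ℝ} (hf : IsPeriodic a f) (h : Space d) :
    ∫ x in cell a, f (h + x) = ∫ x in cell a, f x := by
  have hD := ZSpan.isAddFundamentalDomain a (volume : Measure (Space d))
  have hD' := hD.vadd_of_comm h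
  have hG : ∀ (g : Submodule.span ℤ (Set.range a)) (x : Space d), f (g +ᵥ x) = f x := by
    intro g x
    change f ((g : Space d) + x) = f x
    rw [add_comm]
    exact hf.add_mem g.2 x
  have hinv : VAddInvariantMeasure (Submodule.span ℤ (Set.range a)) (Space d) volume :=
    ⟨fun g s _ => measure_preimage_add volume (g : Space d) s⟩
  have hcell := hD'.setIntegral_eq hD hG
  have hm : MeasurePreserving (fun x : Space d => h + x) volume volume :=
    measurePreserving_add_left volume h
  have := hm.setIntegral_image_emb (MeasurableEquiv.addLeft h).measurableEmbedding f (cell a)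
  exact this.symm.trans hcell

namespace IsSmoothPer

variable {f g : Space d → ℝ}

lemma continuous (hf : IsSmoothPer a f) : Continuous f := hf.2.continuous

lemma memLp (hf : IsSmoothPer a f) : MemLp f 2 (cellMeasure a) :=
  memLp_cell_of_continuous hf.continuous

lemma isL2Per (hf : IsSmoothPer a f) : IsL2Per a f := ⟨hf.1, hf.memLp⟩

lemma differentiable (hf : IsSmoothPer a f) : Differentiable ℝ f :=
  hf.2.differentiable (by simp)

lemma const (c : ℝ) : IsSmoothPer a fun _ => c := ⟨fun _ _ => rfl, contDiff_const⟩

lemma mul (hf : IsSmoothPer a f) (hg : IsSmoothPer a g) : IsSmoothPer a fun x => f x * g x :=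
  ⟨fun i x => by simp only [hf.1 i x, hg.1 i x], hf.2.mul hg.2⟩

lemma const_mul (hf : IsSmoothPer a f) (c : ℝ) : IsSmoothPer a fun x => c * f x :=
  (const c).mul hf

lemma partialDeriv (hf : IsSmoothPer a f) (j : Fin d) : IsSmoothPer a (partialDeriv j f) := by
  refine ⟨fun i x => ?_, ?_⟩
  · have : (fun y => f (y + a i)) = f := funext (hf.1 i)
    simp only [_root_.partialDeriv]
    rw [← fderiv_comp_add_right, this]
  · have h : ContDiff ℝ (⊤ : ℕ∞) (fderiv ℝ f) := hf.2.fderiv_right (by simp)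
    exact h.clm_apply contDiff_const

/-- The integral of a translate of f does not depend on the translation; differentiate under the
integral sign at t = 0. This replaces the divergence theorem on the cell. -/
lemma integral_partialDeriv (hf : IsSmoothPer a f) (j : Fin d) :
    ∫ x in cell a, _root_.partialDeriv j f x = 0 := by
  set e : Space d := EuclideanSpace.single j 1 with he
  obtain ⟨B, hB⟩ := (hf.partialDeriv j).1.bounded (hf.partialDeriv j).continuous
  have key := hasDerivAt_integral_of_dominated_loc_of_deriv_le (μ := cellMeasure a) (𝕜 := ℝ)
    (F := fun t x => f (t • e + x)) (F' := fun t x => _root_.partialDeriv j f (t • e + x))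
    (x₀ := 0) (s := Set.univ) (bound := fun _ => B) Filter.univ_mem
    (Eventually.of_forall fun t =>
      (hf.continuous.comp (by fun_prop : Continuous fun x => t • e + x)).aestronglyMeasurable)
    ((memLp_cell_of_continuous
      (hf.continuous.comp (by fun_prop : Continuous fun x => (0 : ℝ) • e + x))).integrable
        (by norm_num))
    ((hf.partialDeriv j).continuous.comp
      (by fun_prop : Continuous fun x => (0 : ℝ) • e + x)).aestronglyMeasurable
    (Eventually.of_forall fun x t _ => hB _) (integrable_const B)
    (Eventually.of_forall fun x t _ => by
      have h1 : HasFDerivAt f (fderiv ℝ f (t • e + x)) (t • e + x) :=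
        (hf.differentiable _).hasFDerivAt
      have h2 : HasDerivAt (fun s : ℝ => s • e + x) e t := by
        simpa using ((hasDerivAt_id t).smul_const e).add_const x
      exact h1.comp_hasDerivAt t h2)
  have hconst : (fun t : ℝ => ∫ x in cell a, f (t • e + x)) = fun _ => ∫ x in cell a, f x :=
    funext fun t => hf.1.setIntegral_comp_add (t • e)
  have h0 := key.2
  rw [hconst] at h0
  have := h0.unique (hasDerivAt_const (0 : ℝ) _)
  simpa using this

lemma partialDeriv_mul (hf : IsSmoothPer a f) (hg : IsSmoothPer a g) (j : Fin d) (x : Space d) :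
    _root_.partialDeriv j (fun y => f y * g y) x =
      f x * _root_.partialDeriv j g x + _root_.partialDeriv j f x * g x := by
  simp only [_root_.partialDeriv]
  rw [fderiv_fun_mul (hf.differentiable x) (hg.differentiable x)]
  simp [mul_comm]

lemma integral_mul_partialDeriv (hf : IsSmoothPer a f) (hg : IsSmoothPer a g) (j : Fin d) :
    ∫ x in cell a, f x * _root_.partialDeriv j g x =
      -∫ x in cell a, _root_.partialDeriv j f x * g x := by
  have h := (hf.mul hg).integral_partialDeriv j
  simp only [hf.partialDeriv_mul hg] at h
  rw [integral_add] at h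
  · linarith
  · exact hf.memLp.integrable_mul (hg.partialDeriv j).memLp
  · exact (hf.partialDeriv j).memLp.integrable_mul hg.memLp

lemma hasWeakGradPer (hf : IsSmoothPer a f) :
    HasWeakGradPer a f fun j => _root_.partialDeriv j f :=
  ⟨hf.isL2Per, fun j => (hf.partialDeriv j).isL2Per,
    fun _ hw j => hf.integral_mul_partialDeriv hw j⟩

end IsSmoothPer

/-! ### Plane waves as smooth periodic functions -/

lemma hasFDerivAt_wave (n : Fin d → ℤ) (x : Space d) :
    HasFDerivAt (wave a n) (∑ j, dualVec a n j • (EuclideanSpace.proj j : Space d →L[ℝ] ℝ)) x := by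
  have : wave a n = ⇑(∑ j, dualVec a n j • (EuclideanSpace.proj j : Space d →L[ℝ] ℝ)) := by
    ext y; simp [wave]
  conv in wave a n => rw [this]
  exact ContinuousLinearMap.hasFDerivAt _

lemma contDiff_wave (n : Fin d → ℤ) : ContDiff ℝ (⊤ : ℕ∞) (wave a n) := by
  have : wave a n = ⇑(∑ j, dualVec a n j • (EuclideanSpace.proj j : Space d →L[ℝ] ℝ)) := by
    ext y; simp [wave]
  rw [this]
  exact ContinuousLinearMap.contDiff _

lemma wave_add_basis (n : Fin d → ℤ) (i : Fin d) (x : Space d) :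
    wave a n (x + a i) = wave a n x + n i * (2 * Real.pi) := by
  rw [← mul_comm (2 * Real.pi), ← wave_basis a n i]
  simp [wave, mul_add, Finset.sum_add_distrib]

variable (a)

lemma isSmoothPer_cos (n : Fin d → ℤ) : IsSmoothPer a fun x => Real.cos (wave a n x) :=
  ⟨fun i x => by simp only [wave_add_basis, Real.cos_add_int_mul_two_pi],
    Real.contDiff_cos.comp (contDiff_wave n)⟩

lemma isSmoothPer_sin (n : Fin d → ℤ) : IsSmoothPer a fun x => Real.sin (wave a n x) :=
  ⟨fun i x => by simp only [wave_add_basis, Real.sin_add_int_mul_two_pi],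
    Real.contDiff_sin.comp (contDiff_wave n)⟩

lemma partialDeriv_cos (n : Fin d → ℤ) (j : Fin d) (x : Space d) :
    partialDeriv j (fun x => Real.cos (wave a n x)) x =
      -(dualVec a n j * Real.sin (wave a n x)) := by
  rw [partialDeriv, ((hasFDerivAt_wave n x).cos).fderiv]
  simp [mul_comm]

lemma partialDeriv_sin (n : Fin d → ℤ) (j : Fin d) (x : Space d) :
    partialDeriv j (fun x => Real.sin (wave a n x)) x =
      dualVec a n j * Real.cos (wave a n x) := by
  rw [partialDeriv, ((hasFDerivAt_wave n x).sin).fderiv]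
  simp [mul_comm]

lemma dualVec_zero : dualVec a 0 = 0 := by
  ext j; simp [dualVec]

lemma wave_zero (x : Space d) : wave a 0 x = 0 := by
  simp [wave_eq]

/-- Nonzero dual lattice vectors are bounded away from zero. -/
lemma exists_le_norm_dualVec : ∃ m > (0 : ℝ), ∀ n : Fin d → ℤ, n ≠ 0 → m ≤ ‖dualVec a n‖ ^ 2 := by
  obtain ⟨R, hR0, hR⟩ : ∃ R > (0 : ℝ), ∀ i, ‖a i‖ ≤ R := by
    refine ⟨1 + ∑ i, ‖a i‖, by positivity, fun i => ?_⟩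
    have := Finset.single_le_sum (f := fun i => ‖a i‖) (fun i _ => norm_nonneg _)
      (Finset.mem_univ i)
    exact this.trans (by linarith)
  refine ⟨R⁻¹ ^ 2, by positivity, fun n hn => ?_⟩
  obtain ⟨i, hi⟩ := Function.ne_iff.1 hn
  have hi' : (1 : ℝ) ≤ |(n i : ℝ)| := by
    have : (1 : ℤ) ≤ |n i| := Int.one_le_abs hi
    exact_mod_cast this
  -- The wave takes the value 2π nᵢ at the lattice vector aᵢ, which is at least 1 in modulus;
  -- Cauchy–Schwarz turns this into a lower bound on the dual vector.
  have h1 : |wave a n (a i)| ≤ ‖dualVec a n‖ * ‖a i‖ := by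
    have : wave a n (a i) = inner ℝ (a i) (dualVec a n) := by
      simp [wave, PiLp.inner_apply]
    rw [this, mul_comm]
    exact abs_real_inner_le_norm _ _
  rw [wave_basis, abs_mul, abs_of_pos Real.two_pi_pos] at h1
  have h3 : 1 ≤ 2 * Real.pi * |(n i : ℝ)| := by
    have := Real.pi_gt_three
    nlinarith
  have h4 : R⁻¹ ≤ ‖dualVec a n‖ := by
    rw [inv_le_iff_one_le_mul₀ hR0]
    exact (h3.trans h1).trans (mul_le_mul_of_nonneg_left (hR i) (norm_nonneg _))
  exact pow_le_pow_left₀ (inv_nonneg.2 hR0.le) h4 2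

lemma dualVec_ne_zero {n : Fin d → ℤ} (hn : n ≠ 0) : dualVec a n ≠ 0 := by
  obtain ⟨m, hm, h⟩ := exists_le_norm_dualVec a
  intro h0
  have := h n hn
  rw [h0] at this
  simp at this
  linarith

end Periodic

/-! ### Square-integrable fields and the space of strains -/

section StrainSpace

open scoped InnerProductSpace

variable {d : ℕ} (a : Module.Basis (Fin d) ℝ (Space d))

/-- Square-integrable scalar fields on the unit cell. -/
abbrev L2Cell : Type := Lp ℝ 2 (cellMeasure a)

/-- Square-integrable second-order tensor fields on the unit cell. -/
abbrev TensorField : Type := PiLp 2 fun _ : Fin d × Fin d => L2Cell a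

variable {a}

lemma inner_L2Cell (f g : L2Cell a) : ⟪f, g⟫_ℝ = ∫ x in cell a, f x * g x := by
  rw [L2.inner_def]
  simp [mul_comm]

lemma inner_toLp {f g : Space d → ℝ} (hf : MemLp f 2 (cellMeasure a))
    (hg : MemLp g 2 (cellMeasure a)) : ⟪hf.toLp f, hg.toLp g⟫_ℝ = ∫ x in cell a, f x * g x := by
  rw [inner_L2Cell]
  refine integral_congr_ae ?_
  filter_upwards [hf.coeFn_toLp, hg.coeFn_toLp] with x h1 h2
  rw [h1, h2]

lemma inner_toLp_right (f : L2Cell a) {g : Space d → ℝ}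
    (hg : MemLp g 2 (cellMeasure a)) : ⟪f, hg.toLp g⟫_ℝ = ∫ x in cell a, f x * g x := by
  rw [inner_L2Cell]
  refine integral_congr_ae ?_
  filter_upwards [hg.coeFn_toLp] with x h2
  rw [h2]

variable (a)

/-- The constant function `1`. -/
def oneL2 : L2Cell a := (IsSmoothPer.const (a := a) 1).memLp.toLp _

/-- The function `cos (ξₙ · x)`. -/
def cosL2 (n : Fin d → ℤ) : L2Cell a := (isSmoothPer_cos a n).memLp.toLp _

/-- The function `sin (ξₙ · x)`. -/
def sinL2 (n : Fin d → ℤ) : L2Cell a := (isSmoothPer_sin a n).memLp.toLp _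

lemma cosL2_zero : cosL2 a 0 = oneL2 a := by
  refine MemLp.toLp_congr _ _ (Eventually.of_forall fun x => ?_)
  simp [wave_zero]

lemma sinL2_zero : sinL2 a 0 = 0 := by
  rw [← MemLp.toLp_zero (MemLp.zero (p := 2) (μ := cellMeasure a) (ε := ℝ))]
  refine MemLp.toLp_congr _ _ (Eventually.of_forall fun x => ?_)
  simp [wave_zero]

/-- The volume of the unit cell. -/
def cellVol : ℝ := (volume (cell a)).toReal

lemma cellVol_pos : 0 < cellVol a :=
  ENNReal.toReal_pos (volume_cell_ne_zero a) (volume_cell_ne_top a)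

lemma cell_average (f : Space d → ℝ) :
    ⨍ x in cell a, f x = (cellVol a)⁻¹ * ∫ x in cell a, f x := by
  rw [setAverage_eq]
  rfl

lemma hasSum_sq_inner (f : L2Cell a) :
    HasSum (fun n => ⟪f, cosL2 a n⟫_ℝ ^ 2 + ⟪f, sinL2 a n⟫_ℝ ^ 2) (cellVol a * ‖f‖ ^ 2) := by
  have h := (hasSum_sq_fourier a (Lp.memLp f)).mul_left (cellVol a ^ 2)
  have hV := (cellVol_pos a).ne'
  convert! h using 1
  · ext n
    rw [cosL2, sinL2, inner_toLp_right, inner_toLp_right, cell_average, cell_average]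
    field_simp
  · rw [cell_average, ← real_inner_self_eq_norm_sq, inner_L2Cell]
    field_simp

lemma eq_zero_of_inner_trig {f : L2Cell a} (hc : ∀ n, ⟪f, cosL2 a n⟫_ℝ = 0)
    (hs : ∀ n, ⟪f, sinL2 a n⟫_ℝ = 0) : f = 0 := by
  have h := hasSum_sq_inner a f
  have h' : HasSum (fun _ : Fin d → ℤ => (0 : ℝ)) (cellVol a * ‖f‖ ^ 2) := by
    simpa [hc, hs] using h
  have h0 := h'.unique hasSum_zero
  have hV := (cellVol_pos a).ne'
  simpa [hV] using h0

/-- Displacements with zero mean, together with their weak gradients. -/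
def gradSpace : Submodule ℝ ((Fin d → L2Cell a) × (Fin d → Fin d → L2Cell a)) where
  carrier := {p | (∀ i, ⟪p.1 i, oneL2 a⟫_ℝ = 0) ∧ ∀ w (hw : IsSmoothPer a w) i j,
    ⟪p.1 i, (hw.partialDeriv j).memLp.toLp _⟫_ℝ + ⟪p.2 i j, hw.memLp.toLp _⟫_ℝ = 0}
  zero_mem' := by simp
  add_mem' := by
    rintro p q ⟨hp1, hp2⟩ ⟨hq1, hq2⟩
    refine ⟨fun i => ?_, fun w hw i j => ?_⟩
    · simp only [Prod.fst_add, Pi.add_apply, inner_add_left, hp1, hq1, add_zero]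
    · have h1 := hp2 w hw i j
      have h2 := hq2 w hw i j
      simp only [Prod.fst_add, Prod.snd_add, Pi.add_apply, inner_add_left]
      linarith
  smul_mem' := by
    rintro c p ⟨hp1, hp2⟩
    refine ⟨fun i => ?_, fun w hw i j => ?_⟩
    · simp only [Prod.smul_fst, Pi.smul_apply, real_inner_smul_left, hp1, mul_zero]
    · simp only [Prod.smul_fst, Prod.smul_snd, Pi.smul_apply, real_inner_smul_left, ← mul_add,
        hp2 w hw i j, mul_zero]

/-- Writing the weak gradient relation against fixed test functions makes every defining condition
an equality of continuous functions. -/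
lemma isClosed_gradSpace :
    IsClosed (gradSpace a : Set ((Fin d → L2Cell a) × (Fin d → Fin d → L2Cell a))) := by
  have : (gradSpace a : Set ((Fin d → L2Cell a) × (Fin d → Fin d → L2Cell a))) =
      {p | ∀ i, ⟪p.1 i, oneL2 a⟫_ℝ = 0} ∩ {p | ∀ w (hw : IsSmoothPer a w) i j,
    ⟪p.1 i, (hw.partialDeriv j).memLp.toLp _⟫_ℝ + ⟪p.2 i j, hw.memLp.toLp _⟫_ℝ = 0} := rfl
  rw [this]
  refine IsClosed.inter ?_ ?_
  · simp only [Set.ofPred_forall]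
    exact isClosed_iInter fun i => isClosed_eq (by fun_prop) continuous_const
  · simp only [Set.ofPred_forall]
    exact isClosed_iInter fun w => isClosed_iInter fun hw => isClosed_iInter fun i =>
      isClosed_iInter fun j => isClosed_eq (by fun_prop) continuous_const

/-- The symmetrized gradient. -/
def symGrad : ((Fin d → L2Cell a) × (Fin d → Fin d → L2Cell a)) →L[ℝ] TensorField a :=
  (PiLp.continuousLinearEquiv 2 ℝ fun _ : Fin d × Fin d => L2Cell a).symm.toContinuousLinearMap ∘L
    { toFun := fun p ij => (1 / 2 : ℝ) • (p.2 ij.1 ij.2 + p.2 ij.2 ij.1)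
      map_add' := fun p q => by
        ext1 ij
        simp only [Prod.snd_add, Pi.add_apply]
        module
      map_smul' := fun c p => by
        ext1 ij
        simp only [Prod.smul_snd, Pi.smul_apply, RingHom.id_apply]
        module
      cont := by fun_prop }

variable {a}

/-- Testing the weak gradient with a plane wave turns differentiation into multiplication by the
dual vector and exchanges cosine and sine. -/
lemma inner_grad_cos {p : (Fin d → L2Cell a) × (Fin d → Fin d → L2Cell a)} (hp : p ∈ gradSpace a)
    (n : Fin d → ℤ) (i j : Fin d) :
    ⟪p.2 i j, cosL2 a n⟫_ℝ = dualVec a n j * ⟪p.1 i, sinL2 a n⟫_ℝ := by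
  have h := hp.2 _ (isSmoothPer_cos a n) i j
  have e : ((isSmoothPer_cos a n).partialDeriv j).memLp.toLp _ = (-dualVec a n j) • sinL2 a n := by
    rw [sinL2, ← MemLp.toLp_const_smul]
    refine MemLp.toLp_congr _ _ (Eventually.of_forall fun x => ?_)
    rw [partialDeriv_cos]
    simp
  rw [e, real_inner_smul_right] at h
  rw [cosL2]
  linarith

lemma inner_grad_sin {p : (Fin d → L2Cell a) × (Fin d → Fin d → L2Cell a)} (hp : p ∈ gradSpace a)
    (n : Fin d → ℤ) (i j : Fin d) :
    ⟪p.2 i j, sinL2 a n⟫_ℝ = -dualVec a n j * ⟪p.1 i, cosL2 a n⟫_ℝ := by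
  have h := hp.2 _ (isSmoothPer_sin a n) i j
  have e : ((isSmoothPer_sin a n).partialDeriv j).memLp.toLp _ = (dualVec a n j) • cosL2 a n := by
    rw [cosL2, ← MemLp.toLp_const_smul]
    refine MemLp.toLp_congr _ _ (Eventually.of_forall fun x => ?_)
    rw [partialDeriv_sin]
    simp
  rw [e, real_inner_smul_right] at h
  rw [sinL2]
  linarith

/-- The pointwise inequality in Fourier space behind Korn's inequality. -/
lemma korn_pointwise (ξ b : Fin d → ℝ) (i : Fin d) :
    (∑ k, ξ k ^ 2) * b i ^ 2 ≤
      2 * ∑ k : Fin d × Fin d, ((1 / 2 : ℝ) * (ξ k.2 * b k.1 + ξ k.1 * b k.2)) ^ 2 := by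
  -- The squared norm of the symmetrized product is half of |ξ|² |b|² plus half of (ξ · b)².
  -- Dropping the second square gives the constant 2.
  have h1 : ∑ k : Fin d × Fin d, ((1 / 2 : ℝ) * (ξ k.2 * b k.1 + ξ k.1 * b k.2)) ^ 2 =
      (1 / 2 : ℝ) * ((∑ k, ξ k ^ 2) * ∑ k, b k ^ 2) + (1 / 2 : ℝ) * (∑ k, ξ k * b k) ^ 2 := by
    rw [Fintype.sum_prod_type]
    have : ∀ k l, ((1 / 2 : ℝ) * (ξ l * b k + ξ k * b l)) ^ 2 = (1 / 4 : ℝ) * (ξ l ^ 2 * b k ^ 2)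
        + (1 / 4 : ℝ) * (ξ k ^ 2 * b l ^ 2) + (1 / 2 : ℝ) * ((ξ k * b k) * (ξ l * b l)) := by
      intro k l; ring
    simp only [this, Finset.sum_add_distrib, ← Finset.mul_sum, ← Finset.sum_mul]
    ring
  have h2 : b i ^ 2 ≤ ∑ k, b k ^ 2 :=
    Finset.single_le_sum (f := fun k => b k ^ 2) (fun k _ => sq_nonneg _) (Finset.mem_univ i)
  have h3 : 0 ≤ ∑ k, ξ k ^ 2 := Finset.sum_nonneg fun k _ => sq_nonneg _
  have h4 := mul_le_mul_of_nonneg_left h2 h3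
  rw [h1]
  nlinarith [sq_nonneg (∑ k, ξ k * b k)]

lemma hasSum_sq_symGrad {p : (Fin d → L2Cell a) × (Fin d → Fin d → L2Cell a)}
    (hp : p ∈ gradSpace a) :
    HasSum (fun n => ∑ k : Fin d × Fin d,
      (((1 / 2 : ℝ) * (dualVec a n k.2 * ⟪p.1 k.1, sinL2 a n⟫_ℝ
          + dualVec a n k.1 * ⟪p.1 k.2, sinL2 a n⟫_ℝ)) ^ 2
        + ((1 / 2 : ℝ) * (dualVec a n k.2 * ⟪p.1 k.1, cosL2 a n⟫_ℝ
          + dualVec a n k.1 * ⟪p.1 k.2, cosL2 a n⟫_ℝ)) ^ 2))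
      (cellVol a * ‖symGrad a p‖ ^ 2) := by
  rw [PiLp.norm_sq_eq_of_L2, Finset.mul_sum]
  refine hasSum_sum fun k _ => ?_
  have h := hasSum_sq_inner a (symGrad a p k)
  convert! h using 2 with n
  have e : symGrad a p k = (1 / 2 : ℝ) • (p.2 k.1 k.2 + p.2 k.2 k.1) := rfl
  rw [e, real_inner_smul_left, real_inner_smul_left, inner_add_left, inner_add_left,
    inner_grad_cos hp, inner_grad_cos hp, inner_grad_sin hp, inner_grad_sin hp]
  ring

/-- **Korn's inequality** for periodic displacements. -/
lemma norm_grad_le {p : (Fin d → L2Cell a) × (Fin d → Fin d → L2Cell a)} (hp : p ∈ gradSpace a)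
    (i j : Fin d) : ‖p.2 i j‖ ^ 2 ≤ 2 * ‖symGrad a p‖ ^ 2 := by
  have h1 := hasSum_sq_inner a (p.2 i j)
  have h2 := (hasSum_sq_symGrad hp).mul_left 2
  have h := hasSum_le (fun n => ?_) h1 h2
  · have hV := cellVol_pos a
    have : cellVol a * ‖p.2 i j‖ ^ 2 ≤ cellVol a * (2 * ‖symGrad a p‖ ^ 2) := by linarith
    exact le_of_mul_le_mul_left this hV
  · rw [inner_grad_cos hp, inner_grad_sin hp, Finset.sum_add_distrib, mul_add]
    have hj : dualVec a n j ^ 2 ≤ ∑ k, dualVec a n k ^ 2 :=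
      Finset.single_le_sum (f := fun k => dualVec a n k ^ 2) (fun k _ => sq_nonneg _)
        (Finset.mem_univ j)
    have k1 := korn_pointwise (fun k => dualVec a n k) (fun k => ⟪p.1 k, sinL2 a n⟫_ℝ) i
    have k2 := korn_pointwise (fun k => dualVec a n k) (fun k => ⟪p.1 k, cosL2 a n⟫_ℝ) i
    have m1 := mul_le_mul_of_nonneg_right hj (sq_nonneg ⟪p.1 i, sinL2 a n⟫_ℝ)
    have m2 := mul_le_mul_of_nonneg_right hj (sq_nonneg ⟪p.1 i, cosL2 a n⟫_ℝ)
    rw [mul_pow, mul_pow, neg_sq]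
    exact add_le_add (m1.trans k1) (m2.trans k2)

/-- **Poincaré's inequality** for periodic displacements. -/
lemma exists_norm_displacement_le : ∃ m > (0 : ℝ), ∀ p ∈ gradSpace a, ∀ i,
    m * ‖p.1 i‖ ^ 2 ≤ 2 * ‖symGrad a p‖ ^ 2 := by
  obtain ⟨m, hm, hmn⟩ := exists_le_norm_dualVec a
  refine ⟨m, hm, fun p hp i => ?_⟩
  have h1 := (hasSum_sq_inner a (p.1 i)).mul_left m
  have h2 := (hasSum_sq_symGrad hp).mul_left 2
  have h := hasSum_le (fun n => ?_) h1 h2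
  · have hV := cellVol_pos a
    have : cellVol a * (m * ‖p.1 i‖ ^ 2) ≤ cellVol a * (2 * ‖symGrad a p‖ ^ 2) := by linarith
    exact le_of_mul_le_mul_left this hV
  -- The zero mode carries no strain, so here the zero-mean normalization of displacements is
  -- indispensable.
  · by_cases hn : n = 0
    · subst hn
      rw [cosL2_zero, sinL2_zero, hp.1 i]
      simp [dualVec_zero]
    rw [Finset.sum_add_distrib, mul_add, mul_add]
    have hj : m ≤ ∑ k, dualVec a n k ^ 2 := by
      rw [← EuclideanSpace.real_norm_sq_eq]
      exact hmn n hn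
    have k1 := korn_pointwise (fun k => dualVec a n k) (fun k => ⟪p.1 k, sinL2 a n⟫_ℝ) i
    have k2 := korn_pointwise (fun k => dualVec a n k) (fun k => ⟪p.1 k, cosL2 a n⟫_ℝ) i
    have m1 := mul_le_mul_of_nonneg_right hj (sq_nonneg ⟪p.1 i, sinL2 a n⟫_ℝ)
    have m2 := mul_le_mul_of_nonneg_right hj (sq_nonneg ⟪p.1 i, cosL2 a n⟫_ℝ)
    rw [add_comm]
    exact add_le_add (m1.trans k1) (m2.trans k2)

variable (a) in
/-- The space of strain fields `∇ₛu` of periodic displacements. -/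
def strainSpace : Submodule ℝ (TensorField a) := (gradSpace a).map (symGrad a).toLinearMap

variable (a) in
-- Korn and Poincaré together bound a displacement and its gradient by the strain. So the
-- symmetrized gradient is antilipschitz on the complete space `gradSpace`, and its range is closed.
lemma isClosed_strainSpace : IsClosed (strainSpace a : Set (TensorField a)) := by
  obtain ⟨m, hm, hP⟩ := exists_norm_displacement_le (a := a)
  have : CompleteSpace (gradSpace a) := (isClosed_gradSpace a).completeSpace_coe
  set f : gradSpace a →L[ℝ] TensorField a := symGrad a ∘L (gradSpace a).subtypeL with hf
  -- A single constant whose square exceeds both 2 (Korn) and 2 / m (Poincaré).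
  set K : ℝ := 2 + 2 / m with hK
  have hK2 : 0 < 2 / m := by positivity
  have hK0 : 0 < K := by positivity
  have hbound : ∀ x, ‖x‖ ≤ (⟨K, hK0.le⟩ : NNReal) * ‖f x‖ := by
    rintro ⟨p, hp⟩
    have hfp : f ⟨p, hp⟩ = symGrad a p := rfl
    rw [hfp]
    change ‖p‖ ≤ K * ‖symGrad a p‖
    have hSn := norm_nonneg (symGrad a p)
    have hn : 0 ≤ K * ‖symGrad a p‖ := by positivity
    rw [Prod.norm_def]
    refine max_le ?_ ?_
    · refine (pi_norm_le_iff_of_nonneg hn).2 fun i => ?_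
      have h := hP p hp i
      refine abs_le_of_sq_le_sq' ?_ hn |>.2
      have h' : ‖p.1 i‖ ^ 2 ≤ 2 / m * ‖symGrad a p‖ ^ 2 := by
        rw [div_mul_eq_mul_div, le_div_iff₀ hm]; linarith
      refine h'.trans ?_
      rw [mul_pow]
      refine mul_le_mul_of_nonneg_right ?_ (sq_nonneg _)
      rw [hK]; nlinarith
    · refine (pi_norm_le_iff_of_nonneg hn).2 fun i => (pi_norm_le_iff_of_nonneg hn).2 fun j => ?_
      refine abs_le_of_sq_le_sq' ?_ hn |>.2
      refine (norm_grad_le hp i j).trans ?_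
      rw [mul_pow]
      refine mul_le_mul_of_nonneg_right ?_ (sq_nonneg _)
      rw [hK]; nlinarith
  have hcl := (f.antilipschitz_of_bound hbound).isClosed_range f.uniformContinuous
  have hr : (strainSpace a : Set (TensorField a)) = Set.range f := by
    ext x
    simp only [strainSpace, Submodule.map_coe, Set.mem_image, Set.mem_range, hf]
    constructor
    · rintro ⟨p, hp, rfl⟩; exact ⟨⟨p, hp⟩, rfl⟩
    · rintro ⟨⟨p, hp⟩, rfl⟩; exact ⟨p, hp, rfl⟩
  rw [hr]
  exact hcl

end StrainSpace

/-! ### Plane waves in the space of strains -/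

section PlaneWaves

open scoped InnerProductSpace

variable {d : ℕ} {a : Module.Basis (Fin d) ℝ (Space d)}

variable (a) in
/-- The tensor field `f(x) τ`, as a continuous linear function of `f`. -/
def outerL (τ : Tensor2 d) : L2Cell a →L[ℝ] TensorField a :=
  (PiLp.continuousLinearEquiv 2 ℝ fun _ : Fin d × Fin d => L2Cell a).symm.toContinuousLinearMap ∘L
    ContinuousLinearMap.pi fun ij => τ ij.1 ij.2 • ContinuousLinearMap.id ℝ (L2Cell a)

lemma outerL_apply (τ : Tensor2 d) (f : L2Cell a) (i j : Fin d) :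
    outerL a τ f (i, j) = τ i j • f := rfl

lemma outerL_add (σ τ : Tensor2 d) (f : L2Cell a) :
    outerL a (σ + τ) f = outerL a σ f + outerL a τ f := by
  ext1 ⟨i, j⟩
  simp only [outerL_apply, PiLp.add_apply, Matrix.add_apply, add_smul]

lemma outerL_zero (f : L2Cell a) : outerL a (0 : Tensor2 d) f = 0 := by
  ext1 ⟨i, j⟩
  simp only [outerL_apply, PiLp.zero_apply, Matrix.zero_apply, zero_smul]

lemma inner_field (σ τ : TensorField a) : ⟪σ, τ⟫_ℝ = ∑ i, ∑ j, ⟪σ (i, j), τ (i, j)⟫_ℝ := by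
  rw [PiLp.inner_apply, Fintype.sum_prod_type]

lemma inner_outerL (σ : TensorField a) (τ : Tensor2 d) (f : L2Cell a) :
    ⟪σ, outerL a τ f⟫_ℝ = ∑ i, ∑ j, τ i j * ⟪σ (i, j), f⟫_ℝ := by
  simp only [inner_field, outerL_apply, real_inner_smul_right]

lemma inner_outerL_outerL (σ τ : Tensor2 d) (f g : L2Cell a) :
    ⟪outerL a σ f, outerL a τ g⟫_ℝ = ddot σ τ * ⟪f, g⟫_ℝ := by
  simp only [inner_outerL, outerL_apply, real_inner_smul_left, ddot, Finset.sum_mul]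
  refine Finset.sum_congr rfl fun i _ => Finset.sum_congr rfl fun j _ => ?_
  ring

lemma inner_oneL2_self : ⟪oneL2 a, oneL2 a⟫_ℝ = cellVol a := by
  rw [oneL2, inner_toLp]
  simp [cellVol, measureReal_def]

/-- The strain field of a weakly differentiable displacement. -/
def weakStrain {u : Fin d → Space d → ℝ} {G : Fin d → Fin d → Space d → ℝ}
    (h : ∀ i, HasWeakGradPer a (u i) (G i)) : TensorField a :=
  WithLp.toLp 2 fun ij => (1 / 2 : ℝ) •
    (((h ij.1).2.1 ij.2).2.toLp (G ij.1 ij.2) + ((h ij.2).2.1 ij.1).2.toLp (G ij.2 ij.1))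

/-- A displacement in H¹ may have nonzero mean. Subtracting the mean keeps the weak gradient,
because derivatives of periodic test functions integrate to zero. -/
lemma weakStrain_mem {u : Fin d → Space d → ℝ} {G : Fin d → Fin d → Space d → ℝ}
    (h : ∀ i, HasWeakGradPer a (u i) (G i)) : weakStrain h ∈ strainSpace a := by
  have hV := (cellVol_pos a).ne'
  refine ⟨(fun i => (h i).1.2.toLp (u i) -
    (⟪(h i).1.2.toLp (u i), oneL2 a⟫_ℝ / cellVol a) • oneL2 a,
    fun i j => ((h i).2.1 j).2.toLp (G i j)), ⟨fun i => ?_, fun w hw i j => ?_⟩, rfl⟩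
  · rw [inner_sub_left, real_inner_smul_left, inner_oneL2_self]
    field_simp
    ring
  · have h1 : ⟪oneL2 a, (hw.partialDeriv j).memLp.toLp _⟫_ℝ = 0 := by
      rw [oneL2, inner_toLp]
      simpa using hw.integral_partialDeriv j
    simp only
    rw [inner_sub_left, real_inner_smul_left, h1, inner_toLp, inner_toLp, (h i).2.2 w hw j]
    simp

/-- Periodic representative of a square-integrable field on the cell. -/
def perRep (f : L2Cell a) : Space d → ℝ := fun x => f (ZSpan.fract a x)

lemma perRep_ae_eq (f : L2Cell a) : perRep f =ᵐ[cellMeasure a] f :=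
  (ae_restrict_iff' (measurableSet_cell a)).2 (Eventually.of_forall fun x hx => by
    simp only [perRep, fract_of_mem_cell hx])

lemma isL2Per_perRep (f : L2Cell a) : IsL2Per a (perRep f) :=
  ⟨fun i x => by simp only [perRep, isPeriodic_fract a i x],
    (memLp_congr_ae (perRep_ae_eq f)).2 (Lp.memLp f)⟩

/-- Converse of `weakStrain_mem`: almost-everywhere classes on the cell are extended periodically to
genuine functions, as the definition of a strain solution demands. -/
lemma exists_weak_of_mem_strainSpace {e : TensorField a} (he : e ∈ strainSpace a) :
    ∃ (u : Fin d → Space d → ℝ) (G : Fin d → Fin d → Space d → ℝ),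
      (∀ i, HasWeakGradPer a (u i) (G i)) ∧
        ∀ i j, e (i, j) =ᵐ[cellMeasure a] fun x => (1 / 2 : ℝ) * (G i j x + G j i x) := by
  obtain ⟨p, hp, rfl⟩ := he
  refine ⟨fun i => perRep (p.1 i), fun i j => perRep (p.2 i j), fun i =>
    ⟨isL2Per_perRep _, fun j => isL2Per_perRep _, fun w hw j => ?_⟩, fun i j => ?_⟩
  · have h := hp.2 w hw i j
    rw [inner_toLp_right, inner_toLp_right] at h
    have e1 : ∫ x in cell a, perRep (p.1 i) x * partialDeriv j w x =
        ∫ x in cell a, p.1 i x * partialDeriv j w x := by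
      refine integral_congr_ae ?_
      filter_upwards [perRep_ae_eq (p.1 i)] with x hx
      rw [hx]
    have e2 : ∫ x in cell a, perRep (p.2 i j) x * w x = ∫ x in cell a, p.2 i j x * w x := by
      refine integral_congr_ae ?_
      filter_upwards [perRep_ae_eq (p.2 i j)] with x hx
      rw [hx]
    rw [e1, e2]
    linarith
  · have e1 : (symGrad a).toLinearMap p (i, j) = (1 / 2 : ℝ) • (p.2 i j + p.2 j i) := rfl
    rw [e1]
    filter_upwards [Lp.coeFn_smul (1 / 2 : ℝ) (p.2 i j + p.2 j i), Lp.coeFn_add (p.2 i j) (p.2 j i),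
      perRep_ae_eq (p.2 i j), perRep_ae_eq (p.2 j i)] with x h1 h2 h3 h4
    rw [h1, h3, h4, Pi.smul_apply, h2, Pi.add_apply, smul_eq_mul]

lemma symm_of_mem_strainSpace {e : TensorField a} (he : e ∈ strainSpace a) (i j : Fin d) :
    e (i, j) = e (j, i) := by
  obtain ⟨p, hp, rfl⟩ := he
  change (1 / 2 : ℝ) • (p.2 i j + p.2 j i) = (1 / 2 : ℝ) • (p.2 j i + p.2 i j)
  rw [add_comm]

/-- The tensor `½ (v ⊗ ξ + ξ ⊗ v)`. -/
def symOuter (v : Fin d → ℝ) (ξ : Space d) : Tensor2 d :=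
  Matrix.of fun i j => (1 / 2 : ℝ) * (v i * ξ j + v j * ξ i)

variable (a) in
-- The displacement v sin(ξ · x) has strain ½ (v ⊗ ξ + ξ ⊗ v) cos(ξ · x). With the cosine companion
-- below, this shows that plane-wave strains lie in `strainSpace` and come from smooth test
-- displacements.
lemma weakStrain_sin (n : Fin d → ℤ) (v : Fin d → ℝ) :
    weakStrain (fun i => ((isSmoothPer_sin a n).const_mul (v i)).hasWeakGradPer) =
      outerL a (symOuter v (dualVec a n)) (cosL2 a n) := by
  have e : ∀ i j, (((isSmoothPer_sin a n).const_mul (v i)).partialDeriv j).memLp.toLp _ =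
      (v i * dualVec a n j) • cosL2 a n := by
    intro i j
    rw [cosL2, ← MemLp.toLp_const_smul]
    refine MemLp.toLp_congr _ _ (Eventually.of_forall fun x => ?_)
    rw [(IsSmoothPer.const (v i)).partialDeriv_mul (isSmoothPer_sin a n), partialDeriv_sin]
    simp [partialDeriv, mul_assoc]
  ext1 ⟨i, j⟩
  rw [outerL_apply]
  have := congrArg₂ (fun f g : L2Cell a => (1 / 2 : ℝ) • (f + g)) (e i j) (e j i)
  refine this.trans ?_
  simp only [symOuter, Matrix.of_apply, ← add_smul, smul_smul]

variable (a) in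
lemma weakStrain_cos (n : Fin d → ℤ) (v : Fin d → ℝ) :
    weakStrain (fun i => ((isSmoothPer_cos a n).const_mul (-v i)).hasWeakGradPer) =
      outerL a (symOuter v (dualVec a n)) (sinL2 a n) := by
  have e : ∀ i j, (((isSmoothPer_cos a n).const_mul (-v i)).partialDeriv j).memLp.toLp _ =
      (v i * dualVec a n j) • sinL2 a n := by
    intro i j
    rw [sinL2, ← MemLp.toLp_const_smul]
    refine MemLp.toLp_congr _ _ (Eventually.of_forall fun x => ?_)
    rw [(IsSmoothPer.const (-v i)).partialDeriv_mul (isSmoothPer_cos a n), partialDeriv_cos]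
    simp [partialDeriv, mul_assoc]
  ext1 ⟨i, j⟩
  rw [outerL_apply]
  have := congrArg₂ (fun f g : L2Cell a => (1 / 2 : ℝ) • (f + g)) (e i j) (e j i)
  refine this.trans ?_
  simp only [symOuter, Matrix.of_apply, ← add_smul, smul_smul]

/-- Plane waves whose amplitude annihilates the wave vector are orthogonal to strains. -/
lemma inner_plane_wave_eq_zero {e : TensorField a} (he : e ∈ strainSpace a) {n : Fin d → ℤ}
    {C : Tensor2 d} (hC : C.IsSymm) (hξ : ∀ i, ∑ j, C i j * dualVec a n j = 0) :
    ⟪e, outerL a C (cosL2 a n)⟫_ℝ = 0 ∧ ⟪e, outerL a C (sinL2 a n)⟫_ℝ = 0 := by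
  obtain ⟨p, hp, rfl⟩ := he
  have hs : ∀ i j, C j i = C i j := fun i j => hC.apply i j
  have key : ∀ g : Fin d → ℝ, ∑ i, ∑ j, C i j * ((1 / 2 : ℝ) *
      (dualVec a n j * g i + dualVec a n i * g j)) = 0 := by
    intro g
    have h1 : ∑ i, ∑ j, C i j * ((1 / 2 : ℝ) * (dualVec a n j * g i)) = 0 := by
      refine Finset.sum_eq_zero fun i _ => ?_
      have : ∀ j, C i j * ((1 / 2 : ℝ) * (dualVec a n j * g i)) =
          (1 / 2 : ℝ) * g i * (C i j * dualVec a n j) := fun j => by ring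
      simp only [this, ← Finset.mul_sum, hξ, mul_zero]
    have h2 : ∑ i, ∑ j, C i j * ((1 / 2 : ℝ) * (dualVec a n i * g j)) = 0 := by
      rw [Finset.sum_comm, ← h1]
      refine Finset.sum_congr rfl fun i _ => Finset.sum_congr rfl fun j _ => ?_
      rw [hs i j]
    rw [← add_zero (0 : ℝ)]
    nth_rw 1 [← h1]
    rw [← h2, ← Finset.sum_add_distrib]
    refine Finset.sum_congr rfl fun i _ => ?_
    rw [← Finset.sum_add_distrib]
    exact Finset.sum_congr rfl fun j _ => by ring
  constructor
  · rw [inner_outerL, ← key fun i => ⟪p.1 i, sinL2 a n⟫_ℝ]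
    refine Finset.sum_congr rfl fun i _ => Finset.sum_congr rfl fun j _ => ?_
    have e1 : (symGrad a).toLinearMap p (i, j) = (1 / 2 : ℝ) • (p.2 i j + p.2 j i) := rfl
    rw [e1, real_inner_smul_left, inner_add_left, inner_grad_cos hp, inner_grad_cos hp]
  · rw [inner_outerL, ← key fun i => -⟪p.1 i, cosL2 a n⟫_ℝ]
    refine Finset.sum_congr rfl fun i _ => Finset.sum_congr rfl fun j _ => ?_
    have e1 : (symGrad a).toLinearMap p (i, j) = (1 / 2 : ℝ) • (p.2 i j + p.2 j i) := rfl
    rw [e1, real_inner_smul_left, inner_add_left, inner_grad_sin hp, inner_grad_sin hp]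
    ring

/-- Every symmetric tensor splits into a plane-wave strain amplitude and a tensor that annihilates
the wave vector. -/
lemma exists_symOuter_add (hd : 2 ≤ d) (n : Fin d → ℤ) {A : Tensor2 d} (hA : A.IsSymm) :
    ∃ (v : Fin d → ℝ) (C : Tensor2 d), A = symOuter v (dualVec a n) + C ∧ C.IsSymm ∧
      ∀ i, ∑ j, C i j * dualVec a n j = 0 := by
  have hd0 : d ≠ 0 := by omega
  have hd' : (0 : ℝ) < d := by positivity
  by_cases hn : n = 0
  · subst hn
    refine ⟨0, A, ?_, hA, fun i => by simp [dualVec_zero]⟩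
    ext i j
    simp [symOuter]
  have hξ := dualVec_ne_zero a hn
  set ξ := dualVec a n
  -- With κ = 1/d and μ = 1/2 the stiffness is the identity on symmetric tensors. Equilibrium of the
  -- Green's tensor then says directly that A minus its image annihilates ξ.
  obtain ⟨v, hv⟩ := green_app_eq_symm_outer (1 / (d : ℝ)) (1 / 2) ξ hA
  have hB : (greenTensor (1 / (d : ℝ)) (1 / 2) ξ).app A = symOuter v ξ := by
    ext i j; exact hv i j
  have hBs := isSymm_green_app (1 / (d : ℝ)) (1 / 2) ξ hA
  rw [hB] at hBs
  refine ⟨v, A - symOuter v ξ, by abel, hA.sub hBs, fun i => ?_⟩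
  have h := stiffness_green_sub_mul hd (κ₀ := 1 / (d : ℝ)) (μ₀ := 1 / 2) (by positivity)
    (by norm_num) hξ hA i
  have hz : (1 / (d : ℝ) - 2 * (1 / 2) / d) = 0 := by ring
  simp only [hB, isoStiffness_app hd0 _ _ hBs, hz, zero_mul, zero_add] at h
  rw [← neg_eq_zero, ← Finset.sum_neg_distrib, ← h]
  refine Finset.sum_congr rfl fun j _ => ?_
  rw [Matrix.sub_apply]
  ring

/-- A strain field that is orthogonal to all plane-wave strains vanishes. -/
lemma eq_zero_of_inner_plane_waves (hd : 2 ≤ d) {r : TensorField a} (hr : r ∈ strainSpace a)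
    (h : ∀ n v, ⟪r, outerL a (symOuter v (dualVec a n)) (cosL2 a n)⟫_ℝ = 0 ∧
      ⟪r, outerL a (symOuter v (dualVec a n)) (sinL2 a n)⟫_ℝ = 0) : r = 0 := by
  have h1 : ∀ n (A : Tensor2 d), A.IsSymm → ⟪r, outerL a A (cosL2 a n)⟫_ℝ = 0 ∧
      ⟪r, outerL a A (sinL2 a n)⟫_ℝ = 0 := by
    intro n A hA
    obtain ⟨v, C, rfl, hC, hCξ⟩ := exists_symOuter_add (a := a) hd n hA
    have h2 := inner_plane_wave_eq_zero hr hC hCξ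
    constructor
    · rw [outerL_add, inner_add_right, (h n v).1, h2.1, add_zero]
    · rw [outerL_add, inner_add_right, (h n v).2, h2.2, add_zero]
  -- Fields in `strainSpace` are symmetric, so pairing with eᵢ ⊗ eⱼ + eⱼ ⊗ eᵢ isolates a single
  -- component.
  have h2 : ∀ (i j : Fin d) (f : L2Cell a), ⟪r, outerL a (Matrix.of fun k l =>
      kron k i * kron l j + kron k j * kron l i) f⟫_ℝ = 2 * ⟪r (i, j), f⟫_ℝ := by
    intro i j f
    rw [inner_outerL]
    simp only [Matrix.of_apply, add_mul, Finset.sum_add_distrib, mul_assoc, ← Finset.mul_sum,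
      sum_kron_mul']
    rw [symm_of_mem_strainSpace hr j i]
    ring
  have hsym : ∀ i j : Fin d, (Matrix.of fun k l =>
      kron k i * kron l j + kron k j * kron l i : Tensor2 d).IsSymm := by
    intro i j
    ext k l
    simp only [Matrix.transpose_apply, Matrix.of_apply]
    ring
  ext1 ⟨i, j⟩
  rw [PiLp.zero_apply]
  refine eq_zero_of_inner_trig a (fun n => ?_) fun n => ?_
  · have := (h1 n _ (hsym i j)).1
    rw [h2] at this
    linarith
  · have := (h1 n _ (hsym i j)).2
    rw [h2] at this
    linarith

/-- A field that is in equilibrium against plane-wave strains is in equilibrium against all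
strains. -/
lemma inner_eq_zero_of_plane_waves (hd : 2 ≤ d) {σ : TensorField a}
    (h : ∀ n v, ⟪σ, outerL a (symOuter v (dualVec a n)) (cosL2 a n)⟫_ℝ = 0 ∧
      ⟪σ, outerL a (symOuter v (dualVec a n)) (sinL2 a n)⟫_ℝ = 0) {e : TensorField a}
    (he : e ∈ strainSpace a) : ⟪σ, e⟫_ℝ = 0 := by
  have : CompleteSpace (strainSpace a) := (isClosed_strainSpace a).completeSpace_coe
  -- The projection of σ onto strains has the same pairings with plane-wave strains as σ, hence
  -- vanishes. This takes the place of a density argument for smooth displacements.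
  set r : TensorField a := ((strainSpace a).orthogonalProjectionOnto σ).1 with hr
  have hrE : r ∈ strainSpace a := Submodule.coe_mem _
  have hin : ∀ v ∈ strainSpace a, ⟪r, v⟫_ℝ = ⟪σ, v⟫_ℝ := fun v hv =>
    Submodule.inner_orthogonalProjectionOnto_eq_of_mem_right (K := strainSpace a) ⟨v, hv⟩ σ
  have h0 : r = 0 := by
    refine eq_zero_of_inner_plane_waves hd hrE fun n v => ?_
    have m1 : outerL a (symOuter v (dualVec a n)) (cosL2 a n) ∈ strainSpace a := by
      rw [← weakStrain_sin]; exact weakStrain_mem _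
    have m2 : outerL a (symOuter v (dualVec a n)) (sinL2 a n) ∈ strainSpace a := by
      rw [← weakStrain_cos]; exact weakStrain_mem _
    rw [hin _ m1, hin _ m2]
    exact h n v
  rw [← hin e he, h0, inner_zero_left]

end PlaneWaves

/-! ### Multiplication operators and stiffness operators -/

section Operators

open scoped InnerProductSpace

variable {d Φ : ℕ} {a : Module.Basis (Fin d) ℝ (Space d)} {phase : Space d → Fin Φ}

lemma abs_phase_mul_le (p : Fin Φ → ℝ) (f : Space d → ℝ) (x : Space d) :
    ‖p (phase x) * f x‖ ≤ ‖p‖ * ‖f x‖ := by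
  rw [norm_mul]
  exact mul_le_mul_of_nonneg_right (norm_le_pi_norm p _) (norm_nonneg _)

lemma memLp_phase_mul (hm : Measurable phase) (p : Fin Φ → ℝ) {f : Space d → ℝ}
    (hf : MemLp f 2 (cellMeasure a)) : MemLp (fun x => p (phase x) * f x) 2 (cellMeasure a) := by
  refine MemLp.of_le_mul (c := ‖p‖) hf ?_ (Eventually.of_forall fun x => abs_phase_mul_le p f x)
  exact ((measurable_of_finite p).comp hm).aestronglyMeasurable.mul hf.aestronglyMeasurable

variable (a) in
/-- Multiplication by the piecewise constant function with value `p ψ` on phase `ψ`. -/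
def phaseMul (hm : Measurable phase) (p : Fin Φ → ℝ) : L2Cell a →L[ℝ] L2Cell a :=
  LinearMap.mkContinuous
    { toFun := fun f => (memLp_phase_mul hm p (Lp.memLp f)).toLp _
      map_add' := fun f g => by
        rw [← MemLp.toLp_add]
        refine MemLp.toLp_congr _ _ ?_
        filter_upwards [Lp.coeFn_add f g] with x hx
        rw [hx]
        simp [mul_add]
      map_smul' := fun c f => by
        rw [RingHom.id_apply, ← MemLp.toLp_const_smul]
        refine MemLp.toLp_congr _ _ ?_
        filter_upwards [Lp.coeFn_smul c f] with x hx
        rw [hx]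
        simp [mul_left_comm] }
    ‖p‖ fun f => Lp.norm_le_mul_norm_of_ae_le_mul (by
      filter_upwards [(memLp_phase_mul hm p (Lp.memLp f)).coeFn_toLp] with x hx
      rw [LinearMap.coe_mk, AddHom.coe_mk, hx]
      exact abs_phase_mul_le p f x)

lemma phaseMul_ae (hm : Measurable phase) (p : Fin Φ → ℝ) (f : L2Cell a) :
    phaseMul a hm p f =ᵐ[cellMeasure a] fun x => p (phase x) * f x :=
  (memLp_phase_mul hm p (Lp.memLp f)).coeFn_toLp

lemma norm_phaseMul_le (hm : Measurable phase) (p : Fin Φ → ℝ) (f : L2Cell a) :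
    ‖phaseMul a hm p f‖ ≤ ‖p‖ * ‖f‖ :=
  Lp.norm_le_mul_norm_of_ae_le_mul (by
    filter_upwards [phaseMul_ae hm p f] with x hx
    rw [hx]
    exact abs_phase_mul_le p f x)

lemma phaseMul_add (hm : Measurable phase) (p q : Fin Φ → ℝ) (f : L2Cell a) :
    phaseMul a hm (p + q) f = phaseMul a hm p f + phaseMul a hm q f := by
  refine Lp.ext ?_
  filter_upwards [phaseMul_ae hm (p + q) f, phaseMul_ae hm p f, phaseMul_ae hm q f,
    Lp.coeFn_add (phaseMul a hm p f) (phaseMul a hm q f)] with x h1 h2 h3 h4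
  rw [h4, Pi.add_apply, h1, h2, h3, Pi.add_apply, add_mul]

lemma phaseMul_smul (hm : Measurable phase) (c : ℝ) (p : Fin Φ → ℝ) (f : L2Cell a) :
    phaseMul a hm (c • p) f = c • phaseMul a hm p f := by
  refine Lp.ext ?_
  filter_upwards [phaseMul_ae hm (c • p) f, phaseMul_ae hm p f,
    Lp.coeFn_smul c (phaseMul a hm p f)] with x h1 h2 h4
  rw [h4, Pi.smul_apply, h1, h2, Pi.smul_apply, smul_eq_mul, smul_eq_mul, mul_assoc]

lemma phaseMul_const (hm : Measurable phase) (c : ℝ) (f : L2Cell a) :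
    phaseMul a hm (fun _ => c) f = c • f := by
  refine Lp.ext ?_
  filter_upwards [phaseMul_ae hm (fun _ => c) f, Lp.coeFn_smul c f] with x h1 h2
  rw [h1, h2, Pi.smul_apply, smul_eq_mul]

lemma inner_phaseMul (hm : Measurable phase) (p : Fin Φ → ℝ) (f g : L2Cell a) :
    ⟪phaseMul a hm p f, g⟫_ℝ = ⟪f, phaseMul a hm p g⟫_ℝ := by
  rw [inner_L2Cell, inner_L2Cell]
  refine integral_congr_ae ?_
  filter_upwards [phaseMul_ae hm p f, phaseMul_ae hm p g] with x h1 h2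
  rw [h1, h2]
  ring

lemma phaseMul_phaseMul (hm : Measurable phase) (p q : Fin Φ → ℝ) (f : L2Cell a) :
    phaseMul a hm p (phaseMul a hm q f) = phaseMul a hm (p * q) f := by
  refine Lp.ext ?_
  filter_upwards [phaseMul_ae hm p (phaseMul a hm q f), phaseMul_ae hm q f,
    phaseMul_ae hm (p * q) f] with x h1 h2 h3
  rw [h1, h2, h3, Pi.mul_apply, mul_assoc]

variable (a) in
/-- Componentwise multiplication of a tensor field by a piecewise constant function. -/
def fieldMul (hm : Measurable phase) (p : Fin Φ → ℝ) : TensorField a →L[ℝ] TensorField a :=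
  (PiLp.continuousLinearEquiv 2 ℝ fun _ : Fin d × Fin d => L2Cell a).symm.toContinuousLinearMap ∘L
    ContinuousLinearMap.pi fun ij => phaseMul a hm p ∘L PiLp.proj 2 _ ij

lemma fieldMul_apply (hm : Measurable phase) (p : Fin Φ → ℝ) (σ : TensorField a) (i j : Fin d) :
    fieldMul a hm p σ (i, j) = phaseMul a hm p (σ (i, j)) := rfl

variable (a) in
/-- The pointwise action of a constant fourth-order tensor. -/
def actL (A : Tensor4 d) : TensorField a →L[ℝ] TensorField a :=
  (PiLp.continuousLinearEquiv 2 ℝ fun _ : Fin d × Fin d => L2Cell a).symm.toContinuousLinearMap ∘L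
    ContinuousLinearMap.pi fun ij => ∑ k, ∑ l, A ij.1 ij.2 k l • PiLp.proj 2 _ (k, l)

lemma actL_apply (A : Tensor4 d) (σ : TensorField a) (i j : Fin d) :
    actL a A σ (i, j) = ∑ k, ∑ l, A i j k l • σ (k, l) := by
  change (∑ k, ∑ l, A i j k l • (PiLp.proj 2 (fun _ : Fin d × Fin d => L2Cell a) (k, l) :
    TensorField a →L[ℝ] L2Cell a)) σ = _
  simp

lemma norm_fieldMul_le (hm : Measurable phase) (p : Fin Φ → ℝ) :
    ‖fieldMul a hm p‖ ≤ ‖p‖ := by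
  refine ContinuousLinearMap.opNorm_le_bound _ (norm_nonneg _) fun σ => ?_
  refine abs_le_of_sq_le_sq' ?_ (by positivity) |>.2
  rw [mul_pow, PiLp.norm_sq_eq_of_L2, PiLp.norm_sq_eq_of_L2, Finset.mul_sum]
  refine Finset.sum_le_sum fun ij _ => ?_
  rw [← mul_pow]
  exact pow_le_pow_left₀ (norm_nonneg _) (norm_phaseMul_le hm p _) 2

lemma fieldMul_actL (hm : Measurable phase) (p : Fin Φ → ℝ) (A : Tensor4 d) (σ : TensorField a) :
    fieldMul a hm p (actL a A σ) = actL a A (fieldMul a hm p σ) := by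
  ext1 ⟨i, j⟩
  simp only [fieldMul_apply, actL_apply, map_sum, map_smul]

lemma inner_fieldMul (hm : Measurable phase) (p : Fin Φ → ℝ) (σ τ : TensorField a) :
    ⟪fieldMul a hm p σ, τ⟫_ℝ = ⟪σ, fieldMul a hm p τ⟫_ℝ := by
  simp only [inner_field, fieldMul_apply, inner_phaseMul]

lemma inner_actL {A : Tensor4 d} (hA : ∀ i j k l, A i j k l = A k l i j) (σ τ : TensorField a) :
    ⟪actL a A σ, τ⟫_ℝ = ⟪σ, actL a A τ⟫_ℝ := by
  simp only [inner_field, actL_apply, sum_inner, inner_sum, real_inner_smul_left,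
    real_inner_smul_right]
  rw [sum4_comm]
  refine Finset.sum_congr rfl fun k _ => Finset.sum_congr rfl fun l _ =>
    Finset.sum_congr rfl fun i _ => Finset.sum_congr rfl fun j _ => ?_
  rw [hA]

lemma actL_actL (A B : Tensor4 d) (σ : TensorField a) :
    actL a A (actL a B σ) = actL a (tcomp A B) σ := by
  ext1 ⟨i, j⟩
  simp only [actL_apply, tcomp, Finset.sum_smul, Finset.smul_sum, smul_smul]
  calc ∑ m, ∑ n, ∑ k, ∑ l, (A i j m n * B m n k l) • σ (k, l)
      = ∑ m, ∑ k, ∑ n, ∑ l, (A i j m n * B m n k l) • σ (k, l) :=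
        Finset.sum_congr rfl fun _ _ => Finset.sum_comm
    _ = ∑ m, ∑ k, ∑ l, ∑ n, (A i j m n * B m n k l) • σ (k, l) :=
        Finset.sum_congr rfl fun _ _ => Finset.sum_congr rfl fun _ _ => Finset.sum_comm
    _ = ∑ k, ∑ m, ∑ l, ∑ n, (A i j m n * B m n k l) • σ (k, l) := Finset.sum_comm
    _ = ∑ k, ∑ l, ∑ m, ∑ n, (A i j m n * B m n k l) • σ (k, l) :=
        Finset.sum_congr rfl fun _ _ => Finset.sum_comm

lemma actL_add (A B : Tensor4 d) (σ : TensorField a) :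
    actL a (A + B) σ = actL a A σ + actL a B σ := by
  ext1 ⟨i, j⟩
  simp only [actL_apply, PiLp.add_apply, Pi.add_apply, add_smul, Finset.sum_add_distrib]

lemma actL_smul (c : ℝ) (A : Tensor4 d) (σ : TensorField a) :
    actL a (c • A) σ = c • actL a A σ := by
  ext1 ⟨i, j⟩
  simp only [actL_apply, PiLp.smul_apply, Pi.smul_apply, smul_eq_mul, mul_smul, Finset.smul_sum]

lemma actL_outerL (A : Tensor4 d) (τ : Tensor2 d) (f : L2Cell a) :
    actL a A (outerL a τ f) = outerL a (A.app τ) f := by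
  ext1 ⟨i, j⟩
  simp only [actL_apply, outerL_apply, smul_smul, Tensor4.app, Matrix.of_apply, Finset.sum_smul]

lemma fieldMul_outerL (hm : Measurable phase) (p : Fin Φ → ℝ) (τ : Tensor2 d) (f : L2Cell a) :
    fieldMul a hm p (outerL a τ f) = outerL a τ (phaseMul a hm p f) := by
  ext1 ⟨i, j⟩
  simp only [fieldMul_apply, outerL_apply, map_smul]

lemma actL_idT {e : TensorField a} (he : ∀ i j, e (i, j) = e (j, i)) :
    actL a (idT d) e = e := by
  ext1 ⟨i, j⟩
  rw [actL_apply]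
  have h1 : ∀ k, ∑ l, kron j l • e (k, l) = e (k, j) := fun k => by simp [kron]
  have h2 : ∀ k, ∑ l, kron i l • e (k, l) = e (k, i) := fun k => by simp [kron]
  have h3 : ∑ k, kron i k • e (k, j) = e (i, j) := by simp [kron]
  have h4 : ∑ k, kron j k • e (k, i) = e (j, i) := by simp [kron]
  have : ∀ k l, idT d i j k l • e (k, l) = (1 / 2 : ℝ) • kron i k • kron j l • e (k, l)
      + (1 / 2 : ℝ) • kron j k • kron i l • e (k, l) := by
    intro k l
    simp only [idT, smul_smul, ← add_smul]
    congr 1; ring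
  simp only [this, Finset.sum_add_distrib, ← Finset.smul_sum, h1, h2, h3, h4]
  rw [he j i, ← add_smul]
  norm_num

variable (a) in
/-- The operator `ε ↦ (p P + p' P') : ε` with piecewise constant `p`, `p'`. -/
def stiffL (hm : Measurable phase) (P P' : Tensor4 d) (p p' : Fin Φ → ℝ) :
    TensorField a →L[ℝ] TensorField a :=
  fieldMul a hm p ∘L actL a P + fieldMul a hm p' ∘L actL a P'

lemma stiffL_apply (hm : Measurable phase) (P P' : Tensor4 d) (p p' : Fin Φ → ℝ)
    (σ : TensorField a) : stiffL a hm P P' p p' σ =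
      fieldMul a hm p (actL a P σ) + fieldMul a hm p' (actL a P' σ) := rfl

lemma fieldMul_add (hm : Measurable phase) (p q : Fin Φ → ℝ) (σ : TensorField a) :
    fieldMul a hm (p + q) σ = fieldMul a hm p σ + fieldMul a hm q σ := by
  ext1 ⟨i, j⟩
  simp only [fieldMul_apply, PiLp.add_apply, phaseMul_add]

lemma fieldMul_smul (hm : Measurable phase) (c : ℝ) (p : Fin Φ → ℝ) (σ : TensorField a) :
    fieldMul a hm (c • p) σ = c • fieldMul a hm p σ := by
  ext1 ⟨i, j⟩
  simp only [fieldMul_apply, PiLp.smul_apply, phaseMul_smul]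

lemma fieldMul_const (hm : Measurable phase) (c : ℝ) (σ : TensorField a) :
    fieldMul a hm (fun _ => c) σ = c • σ := by
  ext1 ⟨i, j⟩
  simp only [fieldMul_apply, PiLp.smul_apply, phaseMul_const]

lemma stiffL_add (hm : Measurable phase) (P P' : Tensor4 d) (p p' q q' : Fin Φ → ℝ) :
    stiffL a hm P P' (p + q) (p' + q') = stiffL a hm P P' p p' + stiffL a hm P P' q q' := by
  ext1 σ
  simp only [stiffL_apply, add_apply, fieldMul_add]
  abel

lemma norm_stiffL_le (hm : Measurable phase) (P P' : Tensor4 d) {p p' : Fin Φ → ℝ} {r : ℝ}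
    (hp : ‖p‖ ≤ r) (hp' : ‖p'‖ ≤ r) :
    ‖stiffL a hm P P' p p'‖ ≤ (‖actL a P‖ + ‖actL a P'‖) * r := by
  refine (norm_add_le _ _).trans ?_
  have h1 := ContinuousLinearMap.opNorm_comp_le (fieldMul a hm p) (actL a P)
  have h2 := ContinuousLinearMap.opNorm_comp_le (fieldMul a hm p') (actL a P')
  have h3 := mul_le_mul_of_nonneg_right ((norm_fieldMul_le (a := a) hm p).trans hp)
    (norm_nonneg (actL a P))
  have h4 := mul_le_mul_of_nonneg_right ((norm_fieldMul_le (a := a) hm p').trans hp')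
    (norm_nonneg (actL a P'))
  linarith

lemma inner_stiffL {P P' : Tensor4 d} (hP : IsProjectorPair P P') (hm : Measurable phase)
    (p p' : Fin Φ → ℝ) (σ τ : TensorField a) :
    ⟪stiffL a hm P P' p p' σ, τ⟫_ℝ = ⟪σ, stiffL a hm P P' p p' τ⟫_ℝ := by
  simp only [stiffL_apply, inner_add_left, inner_add_right]
  rw [inner_fieldMul, inner_fieldMul, inner_actL hP.major, inner_actL hP.major', fieldMul_actL,
    fieldMul_actL]

/-- Coercivity of a homogeneous isotropic stiffness on strains. -/
lemma stiffL_const_coercive {P P' : Tensor4 d} (hP : IsProjectorPair P P') (hm : Measurable phase)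
    (p₀ p₀' : ℝ) {e : TensorField a} (he : e ∈ strainSpace a) :
    min p₀ p₀' * ‖e‖ ^ 2 ≤ ⟪stiffL a hm P P' (fun _ => p₀) (fun _ => p₀') e, e⟫_ℝ := by
  -- A symmetric idempotent has energy equal to the squared norm of the projection; the two energies
  -- add up to ‖e‖² because P + P' is the identity on symmetric fields.
  have h1 : ⟪actL a P e, e⟫_ℝ = ‖actL a P e‖ ^ 2 := by
    rw [← real_inner_self_eq_norm_sq, inner_actL hP.major, inner_actL hP.major, actL_actL, hP.idem]
  have h2 : ⟪actL a P' e, e⟫_ℝ = ‖actL a P' e‖ ^ 2 := by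
    rw [← real_inner_self_eq_norm_sq, inner_actL hP.major', inner_actL hP.major', actL_actL,
      hP.idem']
  have h3 : ⟪actL a P e, e⟫_ℝ + ⟪actL a P' e, e⟫_ℝ = ‖e‖ ^ 2 := by
    rw [← inner_add_left, ← actL_add, hP.add, actL_idT (symm_of_mem_strainSpace he),
      real_inner_self_eq_norm_sq]
  rw [stiffL_apply, fieldMul_const, fieldMul_const, inner_add_left, real_inner_smul_left,
    real_inner_smul_left, ← h3, h1, h2, mul_add]
  gcongr
  · exact min_le_left _ _
  · exact min_le_right _ _

end Operators

/-! ### The trace of the Green operator -/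

section GreenTrace

open scoped InnerProductSpace

variable {d : ℕ} {a : Module.Basis (Fin d) ℝ (Space d)}

lemma inner_trig_oneL2 {n : Fin d → ℤ} (hn : n ≠ 0) :
    ⟪cosL2 a n, oneL2 a⟫_ℝ = 0 ∧ ⟪sinL2 a n, oneL2 a⟫_ℝ = 0 := by
  obtain ⟨j, hj⟩ : ∃ j, dualVec a n j ≠ 0 := by
    by_contra! h
    exact dualVec_ne_zero a hn (by ext j; exact h j)
  have h1 := (isSmoothPer_sin a n).integral_partialDeriv j
  have h2 := (isSmoothPer_cos a n).integral_partialDeriv j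
  simp only [partialDeriv_sin, partialDeriv_cos, integral_const_mul, integral_neg, neg_eq_zero,
    mul_eq_zero, hj, false_or] at h1 h2
  constructor
  · rw [cosL2, oneL2, inner_toLp]; simpa using h1
  · rw [sinL2, oneL2, inner_toLp]; simpa using h2

/-- A constant field is the plane wave with zero wave vector, which every amplitude annihilates.
Thus homogeneous stresses are in equilibrium. -/
lemma inner_outerL_oneL2 {e : TensorField a} (he : e ∈ strainSpace a) {τ : Tensor2 d}
    (hτ : τ.IsSymm) : ⟪outerL a τ (oneL2 a), e⟫_ℝ = 0 := by
  rw [real_inner_comm, ← cosL2_zero]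
  exact (inner_plane_wave_eq_zero he hτ fun i => by simp [dualVec_zero]).1

variable {κ₀ μ₀ c : ℝ} {Γ : TensorField a →L[ℝ] TensorField a}

/-- The proposed image is a plane-wave strain, and its reference stress differs from σ by an
amplitude annihilating the wave vector, hence by a field orthogonal to strains. So it solves the
variational problem, and coercivity gives uniqueness. -/
lemma greenOp_plane_wave (hd : 2 ≤ d) (hκ : 0 < κ₀) (hμ : 0 < μ₀) (hc : 0 < c)
    (hT : ∀ e ∈ strainSpace a, c * ‖e‖ ^ 2 ≤ ⟪actL a (isoStiffness d κ₀ μ₀) e, e⟫_ℝ)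
    (hΓ : ∀ τ, Γ τ ∈ strainSpace a ∧
      ∀ v ∈ strainSpace a, ⟪actL a (isoStiffness d κ₀ μ₀) (Γ τ), v⟫_ℝ = ⟪τ, v⟫_ℝ)
    {n : Fin d → ℤ} (hn : n ≠ 0) {σ : Tensor2 d} (hσ : σ.IsSymm) :
    Γ (outerL a σ (cosL2 a n)) =
        outerL a ((greenTensor κ₀ μ₀ (dualVec a n)).app σ) (cosL2 a n) ∧
      Γ (outerL a σ (sinL2 a n)) =
        outerL a ((greenTensor κ₀ μ₀ (dualVec a n)).app σ) (sinL2 a n) := by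
  have hd0 : d ≠ 0 := by omega
  have hξ := dualVec_ne_zero a hn
  set B := (greenTensor κ₀ μ₀ (dualVec a n)).app σ with hBdef
  have hBs : B.IsSymm := isSymm_green_app κ₀ μ₀ _ hσ
  obtain ⟨v, hv⟩ := green_app_eq_symm_outer κ₀ μ₀ (dualVec a n) hσ
  have hB : B = symOuter v (dualVec a n) := by ext i j; exact hv i j
  have hCs : ((isoStiffness d κ₀ μ₀).app B - σ).IsSymm := by
    ext i j
    rw [Matrix.transpose_apply, Matrix.sub_apply, Matrix.sub_apply,
      isoStiffness_app hd0 _ _ hBs, isoStiffness_app hd0 _ _ hBs, hσ.apply, hBs.apply,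
      kron_comm j i]
  have hCξ := stiffness_green_sub_mul hd hκ hμ hξ hσ
  have key : ∀ f : L2Cell a, outerL a B f ∈ strainSpace a →
      (∀ e ∈ strainSpace a, ⟪e, outerL a ((isoStiffness d κ₀ μ₀).app B - σ) f⟫_ℝ = 0) →
      Γ (outerL a σ f) = outerL a B f := by
    intro f hf hort
    have h := norm_le_of_coercive hT (w := outerL a B f - Γ (outerL a σ f)) (y := 0)
      (Submodule.sub_mem _ hf (hΓ _).1) fun v hv => by
        rw [map_sub, inner_sub_left, (hΓ _).2 v hv, actL_outerL, inner_zero_left, ← inner_sub_left,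
          ← hort v hv, real_inner_comm]
        congr 1
        ext1 ⟨i, j⟩
        simp only [PiLp.sub_apply, outerL_apply, Matrix.sub_apply, sub_smul]
    rw [norm_zero] at h
    have h0 : ‖outerL a B f - Γ (outerL a σ f)‖ ≤ 0 := by
      by_contra! hlt
      exact absurd h (not_le.2 (mul_pos hc hlt))
    exact (sub_eq_zero.1 (norm_le_zero_iff.1 h0)).symm
  constructor
  · refine key _ ?_ fun e he => (inner_plane_wave_eq_zero he hCs hCξ).1
    rw [hB, ← weakStrain_sin]; exact weakStrain_mem _
  · refine key _ ?_ fun e he => (inner_plane_wave_eq_zero he hCs hCξ).2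
    rw [hB, ← weakStrain_cos]; exact weakStrain_mem _

/-- The partial trace of the Green operator over the range of a projector is a multiple of the
identity on scalar fields with zero mean. -/
lemma sum_inner_greenOp (hd : 2 ≤ d) (hκ : 0 < κ₀) (hμ : 0 < μ₀) (hc : 0 < c)
    (hT : ∀ e ∈ strainSpace a, c * ‖e‖ ^ 2 ≤ ⟪actL a (isoStiffness d κ₀ μ₀) e, e⟫_ℝ)
    (hΓ : ∀ τ, Γ τ ∈ strainSpace a ∧
      ∀ v ∈ strainSpace a, ⟪actL a (isoStiffness d κ₀ μ₀) (Γ τ), v⟫_ℝ = ⟪τ, v⟫_ℝ)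
    {P P' : Tensor4 d} (hPP : IsProjectorPair P P') (hP : P = sphT d ∨ P = devT d)
    {ξ : Space d} (hξ : ξ ≠ 0) {f : L2Cell a} (hf : ⟪f, oneL2 a⟫_ℝ = 0) (g : L2Cell a) :
    ∑ i, ∑ j, ⟪outerL a (frame P i j) g, Γ (outerL a (frame P i j) f)⟫_ℝ =
      qdot (greenTensor κ₀ μ₀ ξ) P * ⟪g, f⟫_ℝ := by
  have hd0 : d ≠ 0 := by omega
  set lam := qdot (greenTensor κ₀ μ₀ ξ) P with hlam
  -- The last term corrects for the constants, on which Γ gives 0 rather than λ. With it the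
  -- functional vanishes on all trigonometric functions, and it contributes nothing when f has zero
  -- mean.
  set Λ : L2Cell a →L[ℝ] ℝ :=
    (∑ i, ∑ j, innerSL ℝ (outerL a (frame P i j) g) ∘L Γ ∘L outerL a (frame P i j))
      - lam • innerSL ℝ g + (lam / cellVol a * ⟪g, oneL2 a⟫_ℝ) • innerSL ℝ (oneL2 a) with hΛ
  have hΛa : ∀ f, Λ f = ∑ i, ∑ j, ⟪outerL a (frame P i j) g, Γ (outerL a (frame P i j) f)⟫_ℝ
      - lam * ⟪g, f⟫_ℝ + lam / cellVol a * ⟪g, oneL2 a⟫_ℝ * ⟪oneL2 a, f⟫_ℝ := by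
    intro f
    simp [hΛ]
  have hsym := fun i j => hPP.isSymm_frame i j
  have hnz : ∀ n : Fin d → ℤ, n ≠ 0 → Λ (cosL2 a n) = 0 ∧ Λ (sinL2 a n) = 0 := by
    intro n hn
    have hG := fun i j => greenOp_plane_wave hd hκ hμ hc hT hΓ hn (hsym i j)
    have hone := inner_trig_oneL2 (a := a) hn
    have hsum : ∑ i, ∑ j, ddot (frame P i j)
        ((greenTensor κ₀ μ₀ (dualVec a n)).app (frame P i j)) = lam :=
      (sum_quadForm_frame hPP.major hPP.idem _).trans
        (qdot_green_eq hd0 hP (dualVec_ne_zero a hn) hξ)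
    constructor
    · rw [hΛa, real_inner_comm (cosL2 a n) (oneL2 a), hone.1]
      simp only [(hG _ _).1, inner_outerL_outerL, ← Finset.sum_mul, hsum]
      ring
    · rw [hΛa, real_inner_comm (sinL2 a n) (oneL2 a), hone.2]
      simp only [(hG _ _).2, inner_outerL_outerL, ← Finset.sum_mul, hsum]
      ring
  -- Γ annihilates constant symmetric fields, so the remaining two terms of Λ must cancel each
  -- other.
  have hz : Λ (cosL2 a 0) = 0 := by
    have hΓ0 : ∀ i j, Γ (outerL a (frame P i j) (oneL2 a)) = 0 := by
      intro i j
      have h := norm_le_of_coercive hT (y := 0) (hΓ (outerL a (frame P i j) (oneL2 a))).1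
        fun v hv => by
          rw [(hΓ _).2 v hv, inner_outerL_oneL2 hv (hsym i j), inner_zero_left]
      rw [norm_zero] at h
      by_contra hne
      exact absurd h (not_le.2 (mul_pos hc (norm_pos_iff.2 hne)))
    have hV := (cellVol_pos a).ne'
    rw [cosL2_zero, hΛa, inner_oneL2_self]
    simp only [hΓ0, inner_zero_right, Finset.sum_const_zero]
    field_simp
    ring
  -- By Riesz, vanishing on a complete trigonometric system forces the continuous functional to
  -- vanish.
  have hr : (InnerProductSpace.toDual ℝ (L2Cell a)).symm Λ = 0 := by
    refine eq_zero_of_inner_trig a (fun n => ?_) fun n => ?_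
    · rw [InnerProductSpace.toDual_symm_apply]
      by_cases hn : n = 0
      · rw [hn, hz]
      · exact (hnz n hn).1
    · rw [InnerProductSpace.toDual_symm_apply]
      by_cases hn : n = 0
      · rw [hn, sinL2_zero, map_zero]
      · exact (hnz n hn).2
  have h0 : Λ f = 0 := by
    rw [← InnerProductSpace.toDual_symm_apply (𝕜 := ℝ), hr, inner_zero_left]
  rw [hΛa, real_inner_comm f (oneL2 a), hf] at h0
  linarith

end GreenTrace

/-! ### Strain solutions as elements of the Hilbert space -/

section Correspondence

open scoped InnerProductSpace

variable {d Φ : ℕ} {a : Module.Basis (Fin d) ℝ (Space d)} {phase : Space d → Fin Φ}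

/-- The value of a tensor field at a point. -/
def fieldVal (σ : TensorField a) (x : Space d) : Tensor2 d := Matrix.of fun i j => σ (i, j) x

lemma inner_eq_integral_ddot (σ τ : TensorField a) :
    ⟪σ, τ⟫_ℝ = ∫ x in cell a, ddot (fieldVal σ x) (fieldVal τ x) := by
  have hint : ∀ i j, Integrable (fun x => σ (i, j) x * τ (i, j) x) (cellMeasure a) := fun i j =>
    (Lp.memLp (σ (i, j))).integrable_mul (Lp.memLp (τ (i, j)))
  simp only [inner_field, inner_L2Cell, ddot, fieldVal, Matrix.of_apply]
  rw [integral_finsetSum _ fun i _ => integrable_finsetSum _ fun j _ => hint i j]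
  refine Finset.sum_congr rfl fun i _ => ?_
  rw [integral_finsetSum _ fun j _ => hint i j]

lemma fieldVal_add_ae (σ τ : TensorField a) :
    ∀ᵐ x ∂cellMeasure a, fieldVal (σ + τ) x = fieldVal σ x + fieldVal τ x := by
  have h : ∀ᵐ x ∂cellMeasure a, ∀ ij : Fin d × Fin d, (σ + τ) ij x = σ ij x + τ ij x :=
    ae_all_iff.2 fun ij => Lp.coeFn_add (σ ij) (τ ij)
  filter_upwards [h] with x hx
  ext i j
  exact hx (i, j)

lemma fieldVal_outerL_one_ae (τ : Tensor2 d) :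
    ∀ᵐ x ∂cellMeasure a, fieldVal (outerL a τ (oneL2 a)) x = τ := by
  have h : ∀ᵐ x ∂cellMeasure a, ∀ ij : Fin d × Fin d,
      (outerL a τ (oneL2 a)) ij x = τ ij.1 ij.2 * oneL2 a x :=
    ae_all_iff.2 fun ij => Lp.coeFn_smul (τ ij.1 ij.2) (oneL2 a)
  filter_upwards [h, (IsSmoothPer.const (a := a) 1).memLp.coeFn_toLp] with x hx h1
  ext i j
  refine (hx (i, j)).trans ?_
  rw [oneL2, h1, mul_one]

lemma coeFn_finsetSum {ι : Type*} (s : Finset ι) (f : ι → L2Cell a) :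
    ∀ᵐ x ∂cellMeasure a, (∑ i ∈ s, f i : L2Cell a) x = ∑ i ∈ s, f i x := by
  filter_upwards [Lp.coeFn_finsetSum s f] with x hx
  rw [hx, Finset.sum_apply]

lemma fieldVal_actL_ae (A : Tensor4 d) (σ : TensorField a) :
    ∀ᵐ x ∂cellMeasure a, fieldVal (actL a A σ) x = A.app (fieldVal σ x) := by
  have h1 : ∀ᵐ x ∂cellMeasure a, ∀ i j : Fin d, (∑ k, ∑ l, A i j k l • σ (k, l) : L2Cell a) x =
      ∑ k, (∑ l, A i j k l • σ (k, l) : L2Cell a) x :=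
    ae_all_iff.2 fun i => ae_all_iff.2 fun j => coeFn_finsetSum _ _
  have h2 : ∀ᵐ x ∂cellMeasure a, ∀ i j k : Fin d, (∑ l, A i j k l • σ (k, l) : L2Cell a) x =
      ∑ l, (A i j k l • σ (k, l) : L2Cell a) x :=
    ae_all_iff.2 fun i => ae_all_iff.2 fun j => ae_all_iff.2 fun k => coeFn_finsetSum _ _
  have h3 : ∀ᵐ x ∂cellMeasure a, ∀ i j k l : Fin d, (A i j k l • σ (k, l) : L2Cell a) x =
      A i j k l * σ (k, l) x :=
    ae_all_iff.2 fun i => ae_all_iff.2 fun j => ae_all_iff.2 fun k => ae_all_iff.2 fun l =>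
      Lp.coeFn_smul (A i j k l) (σ (k, l))
  filter_upwards [h1, h2, h3] with x k1 k2 k3
  ext i j
  simp only [fieldVal, Matrix.of_apply, actL_apply, k1, k2, k3, Tensor4.app]

lemma fieldVal_fieldMul_ae (hm : Measurable phase) (p : Fin Φ → ℝ) (σ : TensorField a) :
    ∀ᵐ x ∂cellMeasure a, fieldVal (fieldMul a hm p σ) x = p (phase x) • fieldVal σ x := by
  have h : ∀ᵐ x ∂cellMeasure a, ∀ ij : Fin d × Fin d,
      phaseMul a hm p (σ ij) x = p (phase x) * σ ij x :=
    ae_all_iff.2 fun ij => phaseMul_ae hm p (σ ij)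
  filter_upwards [h] with x hx
  ext i j
  exact hx (i, j)

/-- The elasticity tensor field `p P + p' P'` with piecewise constant `p`, `p'`. -/
def pairStiffness (phase : Space d → Fin Φ) (P P' : Tensor4 d) (p p' : Fin Φ → ℝ) :
    Space d → Tensor4 d := fun x => p (phase x) • P + p' (phase x) • P'

lemma fieldVal_stiffL_ae (hm : Measurable phase) (P P' : Tensor4 d) (p p' : Fin Φ → ℝ)
    (σ : TensorField a) : ∀ᵐ x ∂cellMeasure a, fieldVal (stiffL a hm P P' p p' σ) x =
      (pairStiffness phase P P' p p' x).app (fieldVal σ x) := by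
  rw [stiffL_apply]
  filter_upwards [fieldVal_add_ae (fieldMul a hm p (actL a P σ)) (fieldMul a hm p' (actL a P' σ)),
    fieldVal_fieldMul_ae hm p (actL a P σ), fieldVal_fieldMul_ae hm p' (actL a P' σ),
    fieldVal_actL_ae P σ, fieldVal_actL_ae P' σ] with x h1 h2 h3 h4 h5
  rw [h1, h2, h3, h4, h5, pairStiffness, app_add, app_smul, app_smul]

/-- The class of a square-integrable tensor field. -/
def fieldClass {ε : Space d → Tensor2 d} (h : ∀ i j, IsL2Per a fun x => ε x i j) :
    TensorField a :=
  WithLp.toLp 2 fun ij => (h ij.1 ij.2).2.toLp _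

lemma fieldVal_fieldClass_ae {ε : Space d → Tensor2 d} (h : ∀ i j, IsL2Per a fun x => ε x i j) :
    ∀ᵐ x ∂cellMeasure a, fieldVal (fieldClass h) x = ε x := by
  have h1 : ∀ᵐ x ∂cellMeasure a, ∀ ij : Fin d × Fin d, fieldClass h ij x = ε x ij.1 ij.2 :=
    ae_all_iff.2 fun ij => (h ij.1 ij.2).2.coeFn_toLp
  filter_upwards [h1] with x hx
  ext i j
  exact hx (i, j)

lemma ddot_comm (σ τ : Tensor2 d) : ddot σ τ = ddot τ σ := by
  simp only [ddot, mul_comm]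

lemma pairStiffness_app_symm {P P' : Tensor4 d} (hP : IsProjectorPair P P') (p p' : Fin Φ → ℝ)
    (x : Space d) (τ : Tensor2 d) (i j : Fin d) :
    (pairStiffness phase P P' p p' x).app τ i j = (pairStiffness phase P P' p p' x).app τ j i := by
  simp only [Tensor4.app, Matrix.of_apply]
  refine Finset.sum_congr rfl fun k _ => Finset.sum_congr rfl fun l _ => ?_
  simp only [pairStiffness, Pi.add_apply, Pi.smul_apply]
  rw [hP.minor i j, hP.minor' i j]

lemma fieldVal_weakStrain_ae {u : Fin d → Space d → ℝ} {G : Fin d → Fin d → Space d → ℝ}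
    (h : ∀ i, HasWeakGradPer a (u i) (G i)) :
    ∀ᵐ x ∂cellMeasure a, ∀ i j, fieldVal (weakStrain h) x i j =
      (1 / 2 : ℝ) * (G i j x + G j i x) := by
  refine ae_all_iff.2 fun i => ae_all_iff.2 fun j => ?_
  filter_upwards [Lp.coeFn_smul (1 / 2 : ℝ) (((h i).2.1 j).2.toLp (G i j) +
    ((h j).2.1 i).2.toLp (G j i)), Lp.coeFn_add (((h i).2.1 j).2.toLp (G i j))
    (((h j).2.1 i).2.toLp (G j i)), ((h i).2.1 j).2.coeFn_toLp, ((h j).2.1 i).2.coeFn_toLp]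
    with x h1 h2 h3 h4
  refine h1.trans ?_
  rw [Pi.smul_apply, h2, Pi.add_apply, h3, h4, smul_eq_mul]

/-- The weak form of equilibrium as an inner product. -/
lemma inner_stiffL_weakStrain {P P' : Tensor4 d} (hP : IsProjectorPair P P')
    (hm : Measurable phase) (p p' : Fin Φ → ℝ) {ε : Space d → Tensor2 d}
    (h : ∀ i j, IsL2Per a fun x => ε x i j) {v : Fin d → Space d → ℝ}
    (hv : ∀ i, IsSmoothPer a (v i)) :
    ⟪stiffL a hm P P' p p' (fieldClass h), weakStrain fun i => (hv i).hasWeakGradPer⟫_ℝ =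
      ∫ x in cell a, ∑ i, ∑ j, (pairStiffness phase P P' p p' x).app (ε x) i j *
        partialDeriv j (v i) x := by
  rw [inner_eq_integral_ddot]
  refine integral_congr_ae ?_
  filter_upwards [fieldVal_stiffL_ae hm P P' p p' (fieldClass h), fieldVal_fieldClass_ae h,
    fieldVal_weakStrain_ae fun i => (hv i).hasWeakGradPer] with x h1 h2 h3
  rw [h1, h2]
  simp only [ddot, h3]
  set S := (pairStiffness phase P P' p p' x).app (ε x) with hS
  -- Because the stress is symmetric, it pairs equally with the gradient and with the symmetrized
  -- gradient.
  have hsym : ∀ i j, S i j = S j i := pairStiffness_app_symm hP p p' x (ε x)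
  have e1 : ∀ i j, S i j * ((1 / 2 : ℝ) * (partialDeriv j (v i) x + partialDeriv i (v j) x)) =
      (1 / 2 : ℝ) * (S i j * partialDeriv j (v i) x) +
        (1 / 2 : ℝ) * (S j i * partialDeriv i (v j) x) := by
    intro i j; rw [← hsym i j]; ring
  simp only [e1, Finset.sum_add_distrib, ← Finset.mul_sum]
  rw [Finset.sum_comm (f := fun i j => S j i * partialDeriv i (v j) x)]
  ring

/-- A strain solution is the sum of the macroscopic strain and an element of the space of strains,
and its stress is orthogonal to the space of strains. -/
lemma IsStrainSolution.exists_fluctuation (hd : 2 ≤ d) {P P' : Tensor4 d}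
    (hP : IsProjectorPair P P') (hm : Measurable phase) {p p' : Fin Φ → ℝ} {τ : Tensor2 d}
    {ε : Space d → Tensor2 d} (h : IsStrainSolution a (pairStiffness phase P P' p p') τ ε) :
    ∃ e ∈ strainSpace a, fieldClass h.l2 = outerL a τ (oneL2 a) + e ∧
      ∀ v ∈ strainSpace a, ⟪stiffL a hm P P' p p' (fieldClass h.l2), v⟫_ℝ = 0 := by
  obtain ⟨u, G, hG, hε⟩ := h.compatible
  refine ⟨weakStrain hG, weakStrain_mem hG, ?_, fun v hv => ?_⟩
  · ext1 ⟨i, j⟩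
    refine Lp.ext ?_
    filter_upwards [fieldVal_fieldClass_ae h.l2, fieldVal_weakStrain_ae hG,
      fieldVal_outerL_one_ae τ, ae_restrict_of_ae hε,
      fieldVal_add_ae (outerL a τ (oneL2 a)) (weakStrain hG)] with x h1 h2 h3 h4 h5
    have e1 := congrFun (congrFun h1 i) j
    have e5 := congrFun (congrFun h5 i) j
    refine e1.trans (Eq.trans ?_ e5.symm)
    rw [Matrix.add_apply, h2, h3]
    exact h4 i j
  -- Equilibrium is assumed only against smooth displacements; plane waves are among them and
  -- suffice for all strains.
  · refine inner_eq_zero_of_plane_waves hd (fun n w => ?_) hv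
    rw [← weakStrain_sin, ← weakStrain_cos]
    constructor
    · exact (inner_stiffL_weakStrain hP hm p p' h.l2 fun i =>
        (isSmoothPer_sin a n).const_mul (w i)).trans (h.equilibrium _ fun i =>
          (isSmoothPer_sin a n).const_mul (w i))
    · exact (inner_stiffL_weakStrain hP hm p p' h.l2 fun i =>
        (isSmoothPer_cos a n).const_mul (-w i)).trans (h.equilibrium _ fun i =>
          (isSmoothPer_cos a n).const_mul (-w i))

/-- Every solution of the problem in the Hilbert space comes from a strain solution. -/
lemma exists_isStrainSolution {P P' : Tensor4 d} (hP : IsProjectorPair P P')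
    (hm : Measurable phase) {p p' : Fin Φ → ℝ} {τ : Tensor2 d} {e : TensorField a}
    (he : e ∈ strainSpace a)
    (heq : ∀ v ∈ strainSpace a,
      ⟪stiffL a hm P P' p p' (outerL a τ (oneL2 a) + e), v⟫_ℝ = 0) :
    ∃ (ε : Space d → Tensor2 d) (h : IsStrainSolution a (pairStiffness phase P P' p p') τ ε),
      fieldClass h.l2 = outerL a τ (oneL2 a) + e := by
  obtain ⟨u, G, hG, hGe⟩ := exists_weak_of_mem_strainSpace he
  set ε : Space d → Tensor2 d := fun x =>
    Matrix.of fun i j => τ i j + (1 / 2 : ℝ) * (G i j x + G j i x) with hε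
  have hl2 : ∀ i j, IsL2Per a fun x => ε x i j := by
    intro i j
    have h1 := (hG i).2.1 j
    have h2 := (hG j).2.1 i
    refine ⟨fun k x => ?_, ?_⟩
    · simp only [hε, Matrix.of_apply, h1.1 k x, h2.1 k x]
    · exact (memLp_const (τ i j)).add ((h1.2.add h2.2).const_mul (1 / 2 : ℝ))
  have hcls : fieldClass hl2 = outerL a τ (oneL2 a) + e := by
    ext1 ⟨i, j⟩
    refine Lp.ext ?_
    filter_upwards [fieldVal_fieldClass_ae hl2, hGe i j, fieldVal_outerL_one_ae τ,
      fieldVal_add_ae (outerL a τ (oneL2 a)) e] with x h1 h2 h3 h5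
    have e1 := congrFun (congrFun h1 i) j
    have e5 := congrFun (congrFun h5 i) j
    refine e1.trans (Eq.trans ?_ e5.symm)
    rw [Matrix.add_apply, h3]
    have : fieldVal e x i j = e (i, j) x := rfl
    rw [this, h2]
    rfl
  refine ⟨ε, ⟨hl2, ⟨u, G, hG, Eventually.of_forall fun x i j => rfl⟩, fun v hv => ?_⟩, hcls⟩
  rw [← inner_stiffL_weakStrain hP hm p p' hl2 hv, hcls]
  exact heq _ (weakStrain_mem _)

/-- The macroscopic energy as an inner product. -/
lemma ddot_average_stress (hm : Measurable phase) (P P' : Tensor4 d) (p p' : Fin Φ → ℝ)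
    {ε : Space d → Tensor2 d} (h : ∀ i j, IsL2Per a fun x => ε x i j) (τ : Tensor2 d) :
    ∑ i, ∑ j, τ i j * ⨍ x in cell a, (pairStiffness phase P P' p p' x).app (ε x) i j =
      (cellVol a)⁻¹ * ⟪stiffL a hm P P' p p' (fieldClass h), outerL a τ (oneL2 a)⟫_ℝ := by
  rw [inner_outerL, Finset.mul_sum]
  refine Finset.sum_congr rfl fun i _ => ?_
  rw [Finset.mul_sum]
  refine Finset.sum_congr rfl fun j _ => ?_
  rw [cell_average, mul_left_comm]
  congr 2
  rw [oneL2, inner_toLp_right]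
  refine integral_congr_ae ?_
  filter_upwards [fieldVal_stiffL_ae hm P P' p p' (fieldClass h), fieldVal_fieldClass_ae h]
    with x h1 h2
  rw [mul_one, ← h2, ← h1]
  rfl

lemma measurableSet_phase (hm : Measurable phase) (φ : Fin Φ) :
    MeasurableSet {x | phase x = φ} := hm (measurableSet_singleton φ)

/-- The energy of a phase as an inner product. -/
lemma setIntegral_phase_quadForm (hm : Measurable phase) (P : Tensor4 d) (φ : Fin Φ)
    {ε : Space d → Tensor2 d} (h : ∀ i j, IsL2Per a fun x => ε x i j) :
    ∫ x in phaseDomain a phase φ, quadForm P (ε x) =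
      ⟪fieldMul a hm (Pi.single φ 1) (actL a P (fieldClass h)), fieldClass h⟫_ℝ := by
  rw [inner_eq_integral_ddot, phaseDomain, Set.inter_comm,
    ← Measure.restrict_restrict (measurableSet_phase hm φ),
    ← integral_indicator (measurableSet_phase hm φ)]
  refine integral_congr_ae ?_
  filter_upwards [fieldVal_fieldMul_ae hm (Pi.single φ 1) (actL a P (fieldClass h)),
    fieldVal_actL_ae P (fieldClass h), fieldVal_fieldClass_ae h] with x h1 h2 h3
  rw [h1, h2, h3]
  by_cases hx : phase x = φ
  · rw [Set.indicator_of_mem (by exact hx), hx, Pi.single_eq_same, one_smul, quadForm, ddot_comm]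
  · rw [Set.indicator_of_notMem (by exact hx), Pi.single_eq_of_ne hx, zero_smul]
    simp [ddot]

lemma inner_phaseMul_one (hm : Measurable phase) (p : Fin Φ → ℝ) :
    ⟪phaseMul a hm p (oneL2 a), oneL2 a⟫_ℝ = ∫ x in cell a, p (phase x) := by
  rw [inner_L2Cell]
  refine integral_congr_ae ?_
  filter_upwards [phaseMul_ae hm p (oneL2 a), (IsSmoothPer.const (a := a) 1).memLp.coeFn_toLp]
    with x h1 h2
  rw [h1, oneL2, h2]
  ring

lemma inner_phaseMul_single (hm : Measurable phase) (φ : Fin Φ) :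
    ⟪phaseMul a hm (Pi.single φ 1) (oneL2 a), oneL2 a⟫_ℝ =
      (volume (phaseDomain a phase φ)).toReal := by
  rw [inner_phaseMul_one, phaseDomain, Set.inter_comm,
    ← Measure.restrict_apply (measurableSet_phase hm φ)]
  have : (fun x => (Pi.single φ (1 : ℝ) : Fin Φ → ℝ) (phase x)) =
      Set.indicator {x | phase x = φ} fun _ => (1 : ℝ) := by
    ext x
    by_cases hx : phase x = φ
    · rw [Set.indicator_of_mem (by exact hx), hx, Pi.single_eq_same]
    · rw [Set.indicator_of_notMem (by exact hx), Pi.single_eq_of_ne hx]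
  rw [this, integral_indicator (measurableSet_phase hm φ)]
  simp [measureReal_def]

end Correspondence

/-! ### First-order expansion of the phase energy -/

section Expansion

open scoped InnerProductSpace

variable {d Φ : ℕ} {a : Module.Basis (Fin d) ℝ (Space d)} {phase : Space d → Fin Φ}

/-- The values of a quadratic functional are those of a combination of `P` and `P'`, with
coefficients read off from its partial traces. -/
def DecomposesAlong (P P' : Tensor4 d) (Q : Tensor2 d → ℝ) : Prop :=
  ∀ τ : Tensor2 d, τ.IsSymm →
    Q τ = (∑ i, ∑ j, Q (frame P i j)) / qdot P P * quadForm P τ +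
      (∑ i, ∑ j, Q (frame P' i j)) / qdot P' P' * quadForm P' τ

/-- The decomposition is linear in the functional, so a divided difference inherits it. -/
lemma DecomposesAlong.of_sub {P P' : Tensor4 d} (hP : IsProjectorPair P P')
    {Q R S : Tensor2 d → ℝ} {t : ℝ} (ht : t ≠ 0) (hQ : DecomposesAlong P P' Q)
    (hR : DecomposesAlong P P' R) (hS : ∀ τ : Tensor2 d, τ.IsSymm → Q τ - R τ = t * S τ) :
    DecomposesAlong P P' S := by
  intro τ hτ
  have hS' : ∀ τ : Tensor2 d, τ.IsSymm → S τ = t⁻¹ * (Q τ - R τ) := fun τ hτ => by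
    rw [hS τ hτ]; field_simp
  have h1 : ∑ i, ∑ j, S (frame P i j) =
      t⁻¹ * (∑ i, ∑ j, Q (frame P i j) - ∑ i, ∑ j, R (frame P i j)) := by
    simp only [hS' _ (hP.isSymm_frame _ _), ← Finset.mul_sum, Finset.sum_sub_distrib]
  have h2 : ∑ i, ∑ j, S (frame P' i j) =
      t⁻¹ * (∑ i, ∑ j, Q (frame P' i j) - ∑ i, ∑ j, R (frame P' i j)) := by
    simp only [hS' _ (hP.swap.isSymm_frame _ _), ← Finset.mul_sum, Finset.sum_sub_distrib]
  rw [hS' τ hτ, h1, h2, hQ τ hτ, hR τ hτ]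
  ring

/-- The coefficients are finite sums of values of the functional, so they converge along with it; no
compactness of unknown coefficients is needed. -/
lemma DecomposesAlong.of_tendsto {P P' : Tensor4 d} (hP : IsProjectorPair P P')
    {ι : Type*} {l : Filter ι} [l.NeBot] {F : ι → Tensor2 d → ℝ} {Q : Tensor2 d → ℝ}
    (hF : ∀ᶠ t in l, DecomposesAlong P P' (F t))
    (hlim : ∀ τ : Tensor2 d, τ.IsSymm → Tendsto (fun t => F t τ) l (𝓝 (Q τ))) :
    DecomposesAlong P P' Q := by
  intro τ hτ
  have h1 : Tendsto (fun t => ∑ i, ∑ j, F t (frame P i j)) l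
      (𝓝 (∑ i, ∑ j, Q (frame P i j))) :=
    tendsto_finsetSum _ fun i _ => tendsto_finsetSum _ fun j _ =>
      hlim _ (hP.isSymm_frame i j)
  have h2 : Tendsto (fun t => ∑ i, ∑ j, F t (frame P' i j)) l
      (𝓝 (∑ i, ∑ j, Q (frame P' i j))) :=
    tendsto_finsetSum _ fun i _ => tendsto_finsetSum _ fun j _ =>
      hlim _ (hP.swap.isSymm_frame i j)
  have h3 := ((h1.div_const (qdot P P)).mul_const (quadForm P τ)).add
    ((h2.div_const (qdot P' P')).mul_const (quadForm P' τ))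
  refine tendsto_nhds_unique (hlim τ hτ) (h3.congr' ?_)
  filter_upwards [hF] with t ht
  exact (ht τ hτ).symm

lemma quadForm_eq_of_isotropic (hd : 2 ≤ d) {P P' : Tensor4 d}
    (hPP : (P = sphT d ∧ P' = devT d) ∨ (P = devT d ∧ P' = sphT d)) {A : Tensor4 d}
    (hA : A.IsIsotropic) (hs : A.IsSymmetric) :
    ∃ α β : ℝ, ∀ τ : Tensor2 d, τ.IsSymm →
      quadForm A τ = α * quadForm P τ + β * quadForm P' τ := by
  obtain ⟨α, β, h⟩ := quadForm_isotropic hd hA hs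
  rcases hPP with ⟨rfl, rfl⟩ | ⟨rfl, rfl⟩
  · exact ⟨α, β, h⟩
  · exact ⟨β, α, fun τ hτ => by rw [h τ hτ, add_comm]⟩

/-- The macroscopic energy of a macroscopically isotropic medium. -/
lemma decomposesAlong_energy (hd : 2 ≤ d) {P P' : Tensor4 d} (hP : IsProjectorPair P P')
    (hPP : (P = sphT d ∧ P' = devT d) ∨ (P = devT d ∧ P' = sphT d)) (hm : Measurable phase)
    {p p' : Fin Φ → ℝ} (hiso : MacroscopicallyIsotropic a (pairStiffness phase P P' p p'))
    {e : Tensor2 d → TensorField a} (he : ∀ τ, τ.IsSymm → e τ ∈ strainSpace a ∧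
      ∀ v ∈ strainSpace a, ⟪stiffL a hm P P' p p' (outerL a τ (oneL2 a) + e τ), v⟫_ℝ = 0) :
    DecomposesAlong P P' fun τ =>
      ⟪stiffL a hm P P' p p' (outerL a τ (oneL2 a) + e τ), outerL a τ (oneL2 a)⟫_ℝ := by
  obtain ⟨A, ⟨hAs, hA⟩, hAi⟩ := hiso
  have hV := (cellVol_pos a).ne'
  have hE : ∀ τ : Tensor2 d, τ.IsSymm →
      ⟪stiffL a hm P P' p p' (outerL a τ (oneL2 a) + e τ), outerL a τ (oneL2 a)⟫_ℝ =
        cellVol a * quadForm A τ := by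
    intro τ hτ
    -- The effective tensor is tested only by actual strain fields, so the Hilbert-space solution is
    -- first realized as one.
    obtain ⟨ε, hε, hcls⟩ := exists_isStrainSolution hP hm (he τ hτ).1 (he τ hτ).2
    have h := ddot_average_stress hm P P' p p' hε.l2 τ
    rw [hcls] at h
    simp only [hA τ ε hτ hε] at h
    have h' : quadForm A τ = (cellVol a)⁻¹ * ⟪stiffL a hm P P' p p'
      (outerL a τ (oneL2 a) + e τ), outerL a τ (oneL2 a)⟫_ℝ := h
    rw [h']
    field_simp
  obtain ⟨α, β, hq⟩ := quadForm_eq_of_isotropic hd hPP hAi hAs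
  intro τ hτ
  simp only [hE τ hτ, hE _ (hP.isSymm_frame _ _), hE _ (hP.swap.isSymm_frame _ _),
    ← Finset.mul_sum]
  rw [quadForm_eq_frame_sum hP hq hτ]
  ring

/-- The operator `χ_φ P`. -/
def phaseL (hm : Measurable phase) (P : Tensor4 d) (φ : Fin Φ) :
    TensorField a →L[ℝ] TensorField a :=
  fieldMul a hm (Pi.single φ 1) ∘L actL a P

lemma phaseL_apply (hm : Measurable phase) (P : Tensor4 d) (φ : Fin Φ) (σ : TensorField a) :
    phaseL hm P φ σ = fieldMul a hm (Pi.single φ 1) (actL a P σ) := rfl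

lemma inner_phaseL {P P' : Tensor4 d} (hP : IsProjectorPair P P') (hm : Measurable phase)
    (φ : Fin Φ) (σ τ : TensorField a) :
    ⟪phaseL hm P φ σ, τ⟫_ℝ = ⟪σ, phaseL hm P φ τ⟫_ℝ := by
  rw [phaseL_apply, phaseL_apply, inner_fieldMul, inner_actL hP.major, fieldMul_actL]

lemma stiffL_add_single (hm : Measurable phase) (P P' : Tensor4 d) (p p' : Fin Φ → ℝ)
    (φ : Fin Φ) (t : ℝ) :
    stiffL a hm P P' (p + Pi.single φ t) p' = stiffL a hm P P' p p' + t • phaseL hm P φ := by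
  have h : (Pi.single φ t : Fin Φ → ℝ) = t • Pi.single φ 1 := by
    rw [← Pi.single_smul, smul_eq_mul, mul_one]
  ext1 σ
  rw [add_apply, smul_apply, stiffL_apply, stiffL_apply, phaseL_apply, fieldMul_add, h,
    fieldMul_smul]
  abel

lemma perturbPhase_pairStiffness (P P' : Tensor4 d) (p p' : Fin Φ → ℝ) (φ : Fin Φ) (t : ℝ) :
    perturbPhase phase (pairStiffness phase P P' p p') φ P t =
      pairStiffness phase P P' (p + Pi.single φ t) p' := by
  ext1 x
  simp only [perturbPhase, pairStiffness, Pi.add_apply, Pi.single_apply, add_smul]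
  abel

/-- If macroscopic isotropy persists under changes of the modulus `p` of phase `φ`, then the energy
of phase `φ` is an isotropic function of the macroscopic strain. -/
lemma decomposesAlong_phase_energy (hd : 2 ≤ d) {P P' : Tensor4 d} (hP : IsProjectorPair P P')
    (hPP : (P = sphT d ∧ P' = devT d) ∨ (P = devT d ∧ P' = sphT d)) (hm : Measurable phase)
    {p p' : Fin Φ → ℝ} {φ : Fin Φ} {c : ℝ} (hc : 0 < c)
    (hT : ∀ e ∈ strainSpace a, c * ‖e‖ ^ 2 ≤ ⟪stiffL a hm P P' p p' e, e⟫_ℝ)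
    (hiso : ∀ᶠ t in 𝓝 (0 : ℝ), MacroscopicallyIsotropic a
      (perturbPhase phase (pairStiffness phase P P' p p') φ P t))
    {e : Tensor2 d → TensorField a} (he : ∀ τ, τ.IsSymm → e τ ∈ strainSpace a ∧
      ∀ v ∈ strainSpace a, ⟪stiffL a hm P P' p p' (outerL a τ (oneL2 a) + e τ), v⟫_ℝ = 0) :
    DecomposesAlong P P' fun τ =>
      ⟪phaseL hm P φ (outerL a τ (oneL2 a) + e τ), outerL a τ (oneL2 a) + e τ⟫_ℝ := by
  set T := stiffL a hm P P' p p' with hTdef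
  set X : TensorField a →L[ℝ] TensorField a := phaseL hm P φ with hXdef
  have hE := isClosed_strainSpace a
  have hsmall : ∀ᶠ t in 𝓝 (0 : ℝ), ‖t • X‖ ≤ c / 2 := by
    have h1 : Tendsto (fun t : ℝ => |t| * ‖X‖) (𝓝 0) (𝓝 0) := by
      have : Continuous fun t : ℝ => |t| * ‖X‖ := by fun_prop
      simpa using this.tendsto 0
    filter_upwards [h1.eventually (gt_mem_nhds (half_pos hc))] with t ht
    rw [norm_smul, Real.norm_eq_abs]
    exact ht.le
  -- Half of the coercivity constant survives for small t, so the perturbed problem is solvable for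
  -- every macroscopic strain.
  have hsol : ∀ t : ℝ, ‖t • X‖ ≤ c / 2 → ∃ Γ : TensorField a →L[ℝ] TensorField a,
      ∀ τ, Γ τ ∈ strainSpace a ∧ ∀ v ∈ strainSpace a, ⟪(T + t • X) (Γ τ), v⟫_ℝ = ⟪τ, v⟫_ℝ :=
    fun t ht => exists_solution_operator _ hE _ (c := c - c / 2) (by linarith)
      (coercive_add hT ht)
  choose! Γ hΓ using hsol
  set et : ℝ → Tensor2 d → TensorField a := fun t τ =>
    -Γ t ((T + t • X) (outerL a τ (oneL2 a))) with het
  have het' : ∀ t : ℝ, ‖t • X‖ ≤ c / 2 → ∀ τ, et t τ ∈ strainSpace a ∧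
      ∀ v ∈ strainSpace a, ⟪(T + t • X) (outerL a τ (oneL2 a) + et t τ), v⟫_ℝ = 0 := by
    intro t ht τ
    refine ⟨Submodule.neg_mem _ (hΓ t ht _).1, fun v hv => ?_⟩
    rw [map_add, inner_add_left, het]
    simp only
    rw [map_neg, inner_neg_left, (hΓ t ht _).2 v hv, add_neg_cancel]
  have hTs : ∀ x y, ⟪T x, y⟫_ℝ = ⟪x, T y⟫_ℝ := inner_stiffL hP hm p p'
  have hXs : ∀ x y, ⟪X x, y⟫_ℝ = ⟪x, X y⟫_ℝ := inner_phaseL hP hm φ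
  have h0 : DecomposesAlong P P' fun τ =>
      ⟪T (outerL a τ (oneL2 a) + e τ), outerL a τ (oneL2 a)⟫_ℝ := by
    refine decomposesAlong_energy hd hP hPP hm ?_ he
    have := hiso.self_of_nhds
    rwa [perturbPhase_pairStiffness, Pi.single_zero, add_zero] at this
  -- By reciprocity, F t is the exact divided difference of the macroscopic energy between moduli
  -- p_φ and p_φ + t. It is isotropic for small t ≠ 0 and tends to the energy of the phase as t → 0.
  refine DecomposesAlong.of_tendsto hP (l := 𝓝[≠] (0 : ℝ)) (F := fun t τ =>
    ⟪X (outerL a τ (oneL2 a) + e τ), outerL a τ (oneL2 a) + et t τ⟫_ℝ) ?_ fun τ hτ => ?_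
  · filter_upwards [hiso.filter_mono nhdsWithin_le_nhds, hsmall.filter_mono nhdsWithin_le_nhds,
      self_mem_nhdsWithin] with t ht1 ht2 ht3
    rw [perturbPhase_pairStiffness] at ht1
    have ht : DecomposesAlong P P' fun τ =>
        ⟪(T + t • X) (outerL a τ (oneL2 a) + et t τ), outerL a τ (oneL2 a)⟫_ℝ := by
      have := decomposesAlong_energy hd hP hPP hm ht1 (e := et t)
      rw [stiffL_add_single] at this
      exact this fun τ _ => het' t ht2 τ
    exact DecomposesAlong.of_sub hP ht3 ht h0 fun τ hτ =>
      energy_sub_eq hTs hXs (he τ hτ).1 (het' t ht2 τ).1 (he τ hτ).2 (het' t ht2 τ).2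
  · refine Tendsto.mono_left ?_ nhdsWithin_le_nhds
    have hlim : Tendsto (fun t => et t τ) (𝓝 0) (𝓝 (e τ)) := by
      rw [tendsto_iff_norm_sub_tendsto_zero]
      have hb : Tendsto (fun t : ℝ => |t| * ‖X (outerL a τ (oneL2 a) + e τ)‖ / (c - c / 2)) (𝓝 0)
          (𝓝 0) := by
        have : Continuous fun t : ℝ => |t| * ‖X (outerL a τ (oneL2 a) + e τ)‖ / (c - c / 2) := by
          fun_prop
        simpa using this.tendsto 0
      refine tendsto_of_tendsto_of_tendsto_of_le_of_le' tendsto_const_nhds hb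
        (Eventually.of_forall fun t => norm_nonneg _) ?_
      filter_upwards [hsmall] with t ht
      rw [le_div_iff₀ (by linarith), mul_comm]
      exact norm_solution_sub_le (coercive_add hT ht) (he τ hτ).1 (het' t ht τ).1 (he τ hτ).2
        (het' t ht τ).2
    exact tendsto_const_nhds.inner (tendsto_const_nhds.add hlim)

/-- Links the description by a pair of projectors, which treats both cases at once, to the moduli
κ₀, μ₀ in the Green's tensor. -/
lemma stiffL_const_eq_actL (hm : Measurable phase) {P P' : Tensor4 d} {p₀ p₀' κ₀ μ₀ : ℝ}
    (hiso : isoStiffness d κ₀ μ₀ = p₀ • P + p₀' • P') :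
    stiffL a hm P P' (fun _ => p₀) (fun _ => p₀') = actL a (isoStiffness d κ₀ μ₀) := by
  ext1 σ
  rw [stiffL_apply, fieldMul_const, fieldMul_const, hiso, actL_add, actL_smul, actL_smul]

lemma app_isSymm_of_isoStiffness (hd : d ≠ 0) (κ₀ μ₀ : ℝ) {τ : Tensor2 d} (hτ : τ.IsSymm) :
    ((isoStiffness d κ₀ μ₀).app τ).IsSymm := by
  ext i j
  rw [Matrix.transpose_apply, isoStiffness_app hd _ _ hτ, isoStiffness_app hd _ _ hτ, hτ.apply,
    kron_comm j i]

/-- Second-order bound for the partial traces of the phase energy. -/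
lemma exists_trace_energy_bound (hd : 2 ≤ d) {P P' : Tensor4 d} (hP : IsProjectorPair P P')
    (hPs : P = sphT d ∨ P = devT d) (hm : Measurable phase) {κ₀ μ₀ p₀ p₀' : ℝ}
    (hκ : 0 < κ₀) (hμ : 0 < μ₀) (hp₀ : 0 < p₀) (hp₀' : 0 < p₀')
    (hiso : isoStiffness d κ₀ μ₀ = p₀ • P + p₀' • P') {ξ : Space d} (hξ : ξ ≠ 0) (φ : Fin Φ) :
    ∃ K : ℝ, ∃ δ > (0 : ℝ), 0 ≤ K ∧ ∀ (q q' : Fin Φ → ℝ) (r : ℝ), ‖q‖ ≤ r → ‖q'‖ ≤ r → r ≤ δ →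
      (∫ x in cell a, q (phase x)) = 0 →
      ∀ e : Tensor2 d → TensorField a, (∀ τ, τ.IsSymm → e τ ∈ strainSpace a ∧
        ∀ v ∈ strainSpace a, ⟪stiffL a hm P P' ((fun _ => p₀) + q) ((fun _ => p₀') + q')
          (outerL a τ (oneL2 a) + e τ), v⟫_ℝ = 0) →
      |∑ i, ∑ j, ⟪phaseL hm P φ (outerL a (frame P i j) (oneL2 a) + e (frame P i j)),
          outerL a (frame P i j) (oneL2 a) + e (frame P i j)⟫_ℝ -
        (volume (phaseDomain a phase φ)).toReal *
          (qdot P P - 2 * qdot (greenTensor κ₀ μ₀ ξ) P * q φ)| ≤ K * r ^ 2 ∧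
      |∑ i, ∑ j, ⟪phaseL hm P φ (outerL a (frame P' i j) (oneL2 a) + e (frame P' i j)),
          outerL a (frame P' i j) (oneL2 a) + e (frame P' i j)⟫_ℝ| ≤ K * r ^ 2 := by
  have hd0 : d ≠ 0 := by omega
  set X : TensorField a →L[ℝ] TensorField a := phaseL hm P φ with hXdef
  set c : ℝ := min p₀ p₀' with hcdef
  have hc : 0 < c := lt_min hp₀ hp₀'
  set T₀ : TensorField a →L[ℝ] TensorField a := actL a (isoStiffness d κ₀ μ₀) with hT₀
  have hst : stiffL a hm P P' (fun _ => p₀) (fun _ => p₀') = T₀ := stiffL_const_eq_actL hm hiso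
  have hT : ∀ e ∈ strainSpace a, c * ‖e‖ ^ 2 ≤ ⟪T₀ e, e⟫_ℝ := by
    rw [← hst]
    exact fun e he => stiffL_const_coercive hP hm p₀ p₀' he
  obtain ⟨Γ, hΓ⟩ := exists_solution_operator _ (isClosed_strainSpace a) T₀ hc hT
  have hXs : ∀ x y, ⟪X x, y⟫_ℝ = ⟪x, X y⟫_ℝ := inner_phaseL hP hm φ
  have hs : ∀ τ : Tensor2 d, τ.IsSymm → ∀ v ∈ strainSpace a,
      ⟪T₀ (outerL a τ (oneL2 a)), v⟫_ℝ = 0 := by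
    intro τ hτ v hv
    rw [hT₀, actL_outerL]
    exact inner_outerL_oneL2 hv (app_isSymm_of_isoStiffness hd0 κ₀ μ₀ hτ)
  set K₁ : ℝ := ‖actL a P‖ + ‖actL a P'‖ with hK₁
  have hK₁0 : 0 ≤ K₁ := by positivity
  set B : Tensor2 d → ℝ := fun τ =>
    8 * ‖X‖ * ‖outerL a τ (oneL2 a)‖ ^ 2 / c ^ 2 * K₁ ^ 2 with hB
  have hB0 : ∀ τ, 0 ≤ B τ := fun τ => by positivity
  have hBs : ∀ Q : Tensor4 d, 0 ≤ ∑ i, ∑ j, B (frame Q i j) := fun Q =>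
    Finset.sum_nonneg fun i _ => Finset.sum_nonneg fun j _ => hB0 _
  -- The second constant makes ‖R‖ ≤ K₁ r ≤ c / 2; the added 1 keeps the denominator positive.
  refine ⟨∑ i, ∑ j, B (frame P i j) + ∑ i, ∑ j, B (frame P' i j), c / 2 / (K₁ + 1),
    by positivity, add_nonneg (hBs P) (hBs P'), ?_⟩
  intro q q' r hq hq' hr hmean e he
  have hr0 : 0 ≤ r := (norm_nonneg q).trans hq
  set R : TensorField a →L[ℝ] TensorField a := stiffL a hm P P' q q' with hR
  have hRn : ‖R‖ ≤ K₁ * r := norm_stiffL_le hm P P' hq hq'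
  have hRc : ‖R‖ ≤ c / 2 := by
    rw [le_div_iff₀ (by positivity)] at hr
    nlinarith
  have heq : ∀ τ : Tensor2 d, τ.IsSymm → ∀ v ∈ strainSpace a,
      ⟪(T₀ + R) (outerL a τ (oneL2 a) + e τ), v⟫_ℝ = 0 := by
    intro τ hτ
    rw [← hst, hR, ← stiffL_add]
    exact (he τ hτ).2
  have hexp : ∀ τ : Tensor2 d, τ.IsSymm →
      |⟪X (outerL a τ (oneL2 a) + e τ), outerL a τ (oneL2 a) + e τ⟫_ℝ -
        (⟪X (outerL a τ (oneL2 a)), outerL a τ (oneL2 a)⟫_ℝ -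
          2 * ⟪X (outerL a τ (oneL2 a)), Γ (R (outerL a τ (oneL2 a)))⟫_ℝ)| ≤ B τ * r ^ 2 := by
    intro τ hτ
    refine (abs_energy_sub_le hc hT hΓ hRc hXs (he τ hτ).1 (hs τ hτ) (heq τ hτ)).trans ?_
    have : ‖R‖ ^ 2 ≤ K₁ ^ 2 * r ^ 2 := by
      rw [← mul_pow]
      exact pow_le_pow_left₀ (norm_nonneg _) hRn 2
    calc 8 * ‖X‖ * ‖outerL a τ (oneL2 a)‖ ^ 2 / c ^ 2 * ‖R‖ ^ 2
        ≤ 8 * ‖X‖ * ‖outerL a τ (oneL2 a)‖ ^ 2 / c ^ 2 * (K₁ ^ 2 * r ^ 2) := by gcongr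
      _ = B τ * r ^ 2 := by simp only [hB]; ring
  -- Summed form of the expansion. The first-order expression is left as g so that the P frame and
  -- the P' frame are both covered.
  have hsumexp : ∀ (Q : Tensor4 d) (g : Tensor2 d → ℝ), (∀ i j, (frame Q i j).IsSymm) →
      (∀ i j, g (frame Q i j) = ⟪X (outerL a (frame Q i j) (oneL2 a)),
          outerL a (frame Q i j) (oneL2 a)⟫_ℝ -
        2 * ⟪X (outerL a (frame Q i j) (oneL2 a)),
          Γ (R (outerL a (frame Q i j) (oneL2 a)))⟫_ℝ) →
      |∑ i, ∑ j, ⟪X (outerL a (frame Q i j) (oneL2 a) + e (frame Q i j)),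
          outerL a (frame Q i j) (oneL2 a) + e (frame Q i j)⟫_ℝ -
        ∑ i, ∑ j, g (frame Q i j)| ≤ (∑ i, ∑ j, B (frame Q i j)) * r ^ 2 := by
    intro Q g hQ hg
    rw [← Finset.sum_sub_distrib, Finset.sum_mul]
    refine (Finset.abs_sum_le_sum_abs _ _).trans (Finset.sum_le_sum fun i _ => ?_)
    rw [← Finset.sum_sub_distrib, Finset.sum_mul]
    refine (Finset.abs_sum_le_sum_abs _ _).trans (Finset.sum_le_sum fun j _ => ?_)
    rw [hg i j]
    exact hexp _ (hQ i j)
  have hr2 : 0 ≤ r ^ 2 := sq_nonneg r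
  constructor
  · have hfr : ∀ i j, P.app (frame P i j) = frame P i j := fun i j => by rw [app_frame, hP.idem]
    have hfr' : ∀ i j, P'.app (frame P i j) = 0 := fun i j => by
      rw [app_frame, hP.orth']; rfl
    have hXo : ∀ i j, X (outerL a (frame P i j) (oneL2 a)) =
        outerL a (frame P i j) (phaseMul a hm (Pi.single φ 1) (oneL2 a)) := fun i j => by
      rw [hXdef, phaseL_apply, actL_outerL, hfr, fieldMul_outerL]
    have hRo : ∀ i j, R (outerL a (frame P i j) (oneL2 a)) =
        outerL a (frame P i j) (phaseMul a hm q (oneL2 a)) := fun i j => by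
      rw [hR, stiffL_apply, actL_outerL, actL_outerL, hfr, hfr', outerL_zero, map_zero, add_zero,
        fieldMul_outerL]
    have hinner : ⟪phaseMul a hm (Pi.single φ 1) (oneL2 a), phaseMul a hm q (oneL2 a)⟫_ℝ =
        q φ * (volume (phaseDomain a phase φ)).toReal := by
      -- Multiplying by χ_φ retains only the value of q on phase φ, so the nonlocal first-order term
      -- reduces to a local quantity.
      have hqs : q * Pi.single φ 1 = q φ • (Pi.single φ 1 : Fin Φ → ℝ) := by
        ext ψ
        by_cases hψ : ψ = φ
        · subst hψ; simp
        · simp [hψ]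
      rw [← inner_phaseMul, phaseMul_phaseMul, hqs, phaseMul_smul, real_inner_smul_left,
        inner_phaseMul_single]
    -- The condition that the moduli have the reference values as means enters here: it puts the
    -- fluctuation where the partial trace of Γ is scalar.
    have hf : ⟪phaseMul a hm q (oneL2 a), oneL2 a⟫_ℝ = 0 := by
      rw [inner_phaseMul_one, hmean]
    have h := hsumexp P (fun τ => ⟪X (outerL a τ (oneL2 a)), outerL a τ (oneL2 a)⟫_ℝ -
        2 * ⟪X (outerL a τ (oneL2 a)), Γ (R (outerL a τ (oneL2 a)))⟫_ℝ) hP.isSymm_frame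
        fun i j => rfl
    have hsum : ∑ i, ∑ j, (⟪X (outerL a (frame P i j) (oneL2 a)),
          outerL a (frame P i j) (oneL2 a)⟫_ℝ -
        2 * ⟪X (outerL a (frame P i j) (oneL2 a)),
          Γ (R (outerL a (frame P i j) (oneL2 a)))⟫_ℝ) =
        (volume (phaseDomain a phase φ)).toReal *
          (qdot P P - 2 * qdot (greenTensor κ₀ μ₀ ξ) P * q φ) := by
      simp only [hXo, hRo, inner_outerL_outerL, Finset.sum_sub_distrib, ← Finset.mul_sum,
        ← Finset.sum_mul, sum_ddot_frame, inner_phaseMul_single]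
      rw [sum_inner_greenOp hd hκ hμ hc hT hΓ hP hPs hξ hf, hinner]
      ring
    rw [hsum] at h
    refine h.trans ?_
    rw [add_mul]
    exact le_add_of_nonneg_right (mul_nonneg (hBs P') hr2)
  -- P annihilates the frame of P', so the zeroth- and first-order terms both vanish and only the
  -- remainder is left.
  · have hXo : ∀ i j, X (outerL a (frame P' i j) (oneL2 a)) = 0 := fun i j => by
      rw [hXdef, phaseL_apply, actL_outerL, app_frame, hP.orth]
      have : frame (0 : Tensor4 d) i j = 0 := rfl
      rw [this, outerL_zero, map_zero]
    have h := hsumexp P' (fun _ => 0) hP.swap.isSymm_frame fun i j => by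
      rw [hXo, inner_zero_left, inner_zero_left]; ring
    simp only [Finset.sum_const_zero, sub_zero] at h
    refine h.trans ?_
    rw [add_mul]
    exact le_add_of_nonneg_left (mul_nonneg (hBs P) hr2)

/-- Second-order bound for the remainder of the expansion of the phase energy. -/
theorem exists_phase_energy_bound (hd : 2 ≤ d) {P P' : Tensor4 d}
    (hPP : (P = sphT d ∧ P' = devT d) ∨ (P = devT d ∧ P' = sphT d)) (hm : Measurable phase)
    {κ₀ μ₀ p₀ p₀' : ℝ} (hκ : 0 < κ₀) (hμ : 0 < μ₀) (hp₀ : 0 < p₀) (hp₀' : 0 < p₀')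
    (hiso : isoStiffness d κ₀ μ₀ = p₀ • P + p₀' • P') {ξ : Space d} (hξ : ξ ≠ 0) {φ : Fin Φ}
    (hpos : volume (phaseDomain a phase φ) ≠ 0) {τ : Tensor2 d} (hτ : τ.IsSymm) :
    ∃ K : ℝ, ∃ δ > (0 : ℝ), 0 ≤ K ∧ ∀ (q q' : Fin Φ → ℝ) (r : ℝ), ‖q‖ ≤ r → ‖q'‖ ≤ r → r ≤ δ →
      (∫ x in cell a, q (phase x)) = 0 →
      (∀ᶠ t in 𝓝 (0 : ℝ), MacroscopicallyIsotropic a (perturbPhase phase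
        (pairStiffness phase P P' ((fun _ => p₀) + q) ((fun _ => p₀') + q')) φ P t)) →
      ∀ ε : Space d → Tensor2 d, IsStrainSolution a
        (pairStiffness phase P P' ((fun _ => p₀) + q) ((fun _ => p₀') + q')) τ ε →
      |(⨍ x in phaseDomain a phase φ, quadForm P (ε x)) -
        (1 - 2 * qdot (greenTensor κ₀ μ₀ ξ) P * (qdot P P)⁻¹ * q φ) * quadForm P τ|
        ≤ K * r ^ 2 := by
  have hP : IsProjectorPair P P' := by
    rcases hPP with ⟨rfl, rfl⟩ | ⟨rfl, rfl⟩
    · exact isProjectorPair_sphT_devT hd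
    · exact (isProjectorPair_sphT_devT hd).swap
  have hPs : P = sphT d ∨ P = devT d := hPP.imp And.left And.left
  obtain ⟨K, δ, hδ, hK, hbound⟩ := exists_trace_energy_bound (a := a) hd hP hPs hm hκ hμ hp₀ hp₀'
    hiso hξ φ
  set v : ℝ := (volume (phaseDomain a phase φ)).toReal with hv
  have hv0 : 0 < v := ENNReal.toReal_pos hpos
    ((measure_mono Set.inter_subset_left).trans_lt (volume_cell_ne_top a).lt_top).ne
  set c : ℝ := min p₀ p₀' with hcdef
  have hc : 0 < c := lt_min hp₀ hp₀'
  set K₁ : ℝ := ‖actL a P‖ + ‖actL a P'‖ with hK₁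
  have hK₁0 : 0 ≤ K₁ := by positivity
  have hn := hP.pos
  have hn' := hP.pos'
  refine ⟨v⁻¹ * (K / qdot P P * |quadForm P τ| + K / qdot P' P' * |quadForm P' τ|),
    min δ (c / 2 / (K₁ + 1)), lt_min hδ (by positivity), by positivity, ?_⟩
  intro q q' r hq hq' hr hmean hmac ε hε
  have hr0 : 0 ≤ r := (norm_nonneg q).trans hq
  set T : TensorField a →L[ℝ] TensorField a :=
    stiffL a hm P P' ((fun _ => p₀) + q) ((fun _ => p₀') + q') with hTdef
  have hT : ∀ e ∈ strainSpace a, c / 2 * ‖e‖ ^ 2 ≤ ⟪T e, e⟫_ℝ := by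
    have hRc : ‖stiffL a hm P P' q q'‖ ≤ c / 2 := by
      have h1 := hr.trans (min_le_right _ _)
      rw [le_div_iff₀ (by positivity)] at h1
      have h2 := norm_stiffL_le (a := a) hm P P' hq hq'
      nlinarith
    have h := coercive_add (fun e he => stiffL_const_coercive hP hm p₀ p₀' he) hRc
    rw [← stiffL_add, ← hcdef, sub_half] at h
    exact h
  obtain ⟨Γ, hΓ⟩ := exists_solution_operator _ (isClosed_strainSpace a) T (half_pos hc) hT
  -- The given field solves the problem for τ only, while the partial traces require solutions for
  -- all frame tensors; these are supplied by Lax–Milgram.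
  set e : Tensor2 d → TensorField a := fun σ => -Γ (T (outerL a σ (oneL2 a))) with hedef
  have he : ∀ σ : Tensor2 d, σ.IsSymm → e σ ∈ strainSpace a ∧
      ∀ w ∈ strainSpace a, ⟪T (outerL a σ (oneL2 a) + e σ), w⟫_ℝ = 0 := by
    intro σ _
    refine ⟨Submodule.neg_mem _ (hΓ _).1, fun w hw => ?_⟩
    rw [map_add, inner_add_left, hedef]
    simp only
    rw [map_neg, inner_neg_left, (hΓ _).2 w hw, add_neg_cancel]
  obtain ⟨e', he', hcls, heq'⟩ := hε.exists_fluctuation hd hP hm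
  -- Uniqueness identifies the given strain field with the constructed one at τ.
  have hee : e' = e τ := by
    have h := norm_le_of_coercive hT (y := 0) (Submodule.sub_mem _ he' (he τ hτ).1) fun w hw => by
      have h1 : e' - e τ = (outerL a τ (oneL2 a) + e') - (outerL a τ (oneL2 a) + e τ) := by abel
      rw [h1, map_sub, inner_sub_left, (he τ hτ).2 w hw, ← hcls, heq' w hw, inner_zero_left,
        sub_zero]
    rw [norm_zero] at h
    by_contra hne
    exact absurd h (not_le.2 (mul_pos (half_pos hc) (norm_pos_iff.2 (sub_ne_zero.2 hne))))
  -- Isotropy recovers the phase energy at τ from the two partial traces, for which the bounds are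
  -- available.
  have hdec := decomposesAlong_phase_energy hd hP hPP hm (half_pos hc) hT hmac he τ hτ
  obtain ⟨hb1, hb2⟩ := hbound q q' r hq hq' (hr.trans (min_le_left _ _)) hmean e he
  have hen : v * (⨍ x in phaseDomain a phase φ, quadForm P (ε x)) =
      ⟪phaseL hm P φ (outerL a τ (oneL2 a) + e τ), outerL a τ (oneL2 a) + e τ⟫_ℝ := by
    rw [setAverage_eq, setIntegral_phase_quadForm hm P φ hε.l2, hcls, hee, smul_eq_mul,
      measureReal_def, ← hv, phaseL_apply]
    field_simp
  set S := ∑ i, ∑ j, ⟪phaseL hm P φ (outerL a (frame P i j) (oneL2 a) + e (frame P i j)),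
          outerL a (frame P i j) (oneL2 a) + e (frame P i j)⟫_ℝ with hS
  set S' := ∑ i, ∑ j, ⟪phaseL hm P φ (outerL a (frame P' i j) (oneL2 a) + e (frame P' i j)),
          outerL a (frame P' i j) (oneL2 a) + e (frame P' i j)⟫_ℝ with hS'
  set lam := qdot (greenTensor κ₀ μ₀ ξ) P with hlam
  have hdec' : v * (⨍ x in phaseDomain a phase φ, quadForm P (ε x)) =
      S / qdot P P * quadForm P τ + S' / qdot P' P' * quadForm P' τ := hen.trans hdec
  have hmain : (⨍ x in phaseDomain a phase φ, quadForm P (ε x)) -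
        (1 - 2 * lam * (qdot P P)⁻¹ * q φ) * quadForm P τ =
      v⁻¹ * ((S - v * (qdot P P - 2 * lam * q φ)) / qdot P P * quadForm P τ +
        S' / qdot P' P' * quadForm P' τ) := by
    have h1 : (⨍ x in phaseDomain a phase φ, quadForm P (ε x)) =
        v⁻¹ * (S / qdot P P * quadForm P τ + S' / qdot P' P' * quadForm P' τ) := by
      rw [← hdec']; field_simp
    rw [h1]
    field_simp
    ring
  rw [hmain, abs_mul, abs_of_pos (inv_pos.2 hv0), mul_assoc v⁻¹ (_ + _)]
  refine mul_le_mul_of_nonneg_left ?_ (inv_pos.2 hv0).le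
  refine (abs_add_le _ _).trans ?_
  rw [abs_mul, abs_mul, abs_div, abs_div, abs_of_pos hn, abs_of_pos hn', add_mul]
  refine add_le_add ?_ ?_
  · calc |S - v * (qdot P P - 2 * lam * q φ)| / qdot P P * |quadForm P τ|
        ≤ (K * r ^ 2) / qdot P P * |quadForm P τ| := by gcongr
      _ = K / qdot P P * |quadForm P τ| * r ^ 2 := by ring
  · calc |S'| / qdot P' P' * |quadForm P' τ|
        ≤ (K * r ^ 2) / qdot P' P' * |quadForm P' τ| := by gcongr
      _ = K / qdot P' P' * |quadForm P' τ| * r ^ 2 := by ring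

end Expansion

/-! ### The lemma -/

section Statement

variable {d Φ : ℕ}

lemma norm_le_contrast (κ₀ μ₀ : ℝ) (κ μ : Fin Φ → ℝ) (φ : Fin Φ) :
    ‖fun ψ => (d : ℝ) * (κ ψ - κ₀)‖ ≤ contrast d κ₀ μ₀ κ μ ∧
      ‖fun ψ => 2 * (μ ψ - μ₀)‖ ≤ contrast d κ₀ μ₀ κ μ := by
  have hb : BddAbove (Set.range fun ψ => max |(d : ℝ) * (κ ψ - κ₀)| |2 * (μ ψ - μ₀)|) :=
    Set.Finite.bddAbove (Set.finite_range _)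
  have h0 : 0 ≤ contrast d κ₀ μ₀ κ μ :=
    ((abs_nonneg _).trans (le_max_left _ _)).trans (le_ciSup hb φ)
  exact ⟨(pi_norm_le_iff_of_nonneg h0).2 fun ψ => (le_max_left _ _).trans (le_ciSup hb ψ),
    (pi_norm_le_iff_of_nonneg h0).2 fun ψ => (le_max_right _ _).trans (le_ciSup hb ψ)⟩

lemma IsProjectorPair.qdot_eq_zero {P P' : Tensor4 d} (h : IsProjectorPair P P') :
    qdot P' P = 0 := by
  rw [← sum_quadForm_frame h.major h.idem P']
  simp only [quadForm_frame_other h, Finset.sum_const_zero]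

/-- The two projectors are orthogonal for the full contraction, so contracting with P and dividing
by its squared norm reads off the coefficient of P. -/
lemma phaseContrast_eq {P P' : Tensor4 d} (hP : IsProjectorPair P P') {κ₀ μ₀ : ℝ}
    {κ μ : Fin Φ → ℝ} {φ : Fin Φ} {x y : ℝ}
    (h : isoStiffness d (κ φ) (μ φ) - isoStiffness d κ₀ μ₀ = x • P + y • P') :
    phaseContrast κ₀ μ₀ κ μ P φ = x := by
  have h1 : qdot (x • P + y • P') P = x * qdot P P + y * qdot P' P := by
    simp only [qdot, Pi.add_apply, Pi.smul_apply, smul_eq_mul, add_mul, Finset.sum_add_distrib,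
      Finset.mul_sum, mul_assoc]
  rw [phaseContrast, h, h1, hP.qdot_eq_zero, mul_zero, add_zero]
  have := hP.pos.ne'
  field_simp

variable {a : Module.Basis (Fin d) ℝ (Space d)} {phase : Space d → Fin Φ}

lemma integral_phase_sub_eq_zero (hm : Measurable phase) {f : Fin Φ → ℝ} {f₀ : ℝ}
    (h : ⨍ x in cell a, f (phase x) = f₀) (c : ℝ) :
    ∫ x in cell a, c * (f (phase x) - f₀) = 0 := by
  have hV := (cellVol_pos a).ne'
  have hint : Integrable (fun x => f (phase x)) (cellMeasure a) := by
    refine Integrable.of_bound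
      ((measurable_of_finite f).comp hm).aestronglyMeasurable ‖f‖ (Eventually.of_forall fun x => ?_)
    exact norm_le_pi_norm f _
  rw [cell_average] at h
  have hI : ∫ x in cell a, f (phase x) = cellVol a * f₀ := by
    rw [← h]; field_simp
  have hv : (cellMeasure a).real Set.univ = cellVol a := by
    simp [measureReal_def, cellVol]
  rw [integral_const_mul, integral_sub hint (integrable_const _), integral_const, hI, hv,
    smul_eq_mul, sub_self, mul_zero]

end Statement

end

/-! ### Reduction of the expansion to the second-order bound -/

theorem lemma5 {d : ℕ} (hd : d = 2 ∨ d = 3)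
    (a : Module.Basis (Fin d) ℝ (Space d))
    {Φ : ℕ} (phase : Space d → Fin Φ)
    (hmeas : Measurable phase) (hper : IsPeriodic a phase)
    (hpos : ∀ ψ, volume (phaseDomain a phase ψ) ≠ 0)
    (κ₀ μ₀ : ℝ) (hκ₀ : 0 < κ₀) (hμ₀ : 0 < μ₀)
    (P : Tensor4 d) (hP : P = sphT d ∨ P = devT d)
    (ξ : Space d) (hξ : ξ ≠ 0)
    (εbar : Tensor2 d) (hεbar : εbar.IsSymm) (φ : Fin Φ) :
    ∀ η > (0 : ℝ), ∃ δ > (0 : ℝ), ∀ κ μ : Fin Φ → ℝ,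
      (∀ ψ, 0 < κ ψ) → (∀ ψ, 0 < μ ψ) →
      (⨍ x in cell a, κ (phase x)) = κ₀ → (⨍ x in cell a, μ (phase x)) = μ₀ →
      contrast d κ₀ μ₀ κ μ < δ →
      (∀ᶠ t in 𝓝 (0 : ℝ), MacroscopicallyIsotropic a
        (perturbPhase phase (phaseStiffness phase κ μ) φ P t)) →
      ∀ ε : Space d → Tensor2 d, IsStrainSolution a (phaseStiffness phase κ μ) εbar ε →
        |(⨍ x in phaseDomain a phase φ, quadForm P (ε x)) -
            (1 - 2 * qdot (greenTensor κ₀ μ₀ ξ) P * (qdot P P)⁻¹ *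
              phaseContrast κ₀ μ₀ κ μ P φ) * quadForm P εbar|
          ≤ η * contrast d κ₀ μ₀ κ μ := by
  have hd2 : 2 ≤ d := by omega
  have hd0 : (0 : ℝ) < d := by positivity
  have h2μ : 0 < 2 * μ₀ := by positivity
  have hdκ : 0 < (d : ℝ) * κ₀ := by positivity
  -- For r below η / (K + 1), the quadratic remainder K r² is at most η r, which is the little-o
  -- statement.
  have key : ∀ K δ : ℝ, 0 < δ → 0 ≤ K → ∀ η > (0 : ℝ), ∃ δ' > (0 : ℝ), ∀ r, 0 ≤ r → r < δ' →
      r ≤ δ ∧ K * r ^ 2 ≤ η * r := by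
    intro K δ hδ hK η hη
    refine ⟨min δ (η / (K + 1)), lt_min hδ (by positivity), fun r hr0 hr =>
      ⟨(hr.trans_le (min_le_left _ _)).le, ?_⟩⟩
    have h1 := (hr.trans_le (min_le_right _ _)).le
    rw [le_div_iff₀ (by positivity)] at h1
    nlinarith
  have hsum : ∀ (c f₀ : ℝ) (f : Fin Φ → ℝ),
      ((fun _ => c * f₀) + fun ψ => c * (f ψ - f₀)) = fun ψ => c * f ψ := by
    intro c f₀ f
    ext ψ
    simp only [Pi.add_apply]
    ring
  intro η hη
  rcases hP with rfl | rfl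
  · obtain ⟨K, δ, hδ, hK, hb⟩ := exists_phase_energy_bound (a := a) hd2 (P := sphT d)
      (P' := devT d) (Or.inl ⟨rfl, rfl⟩) hmeas hκ₀ hμ₀ hdκ h2μ rfl hξ (hpos φ) hεbar
    obtain ⟨δ', hδ', hkey⟩ := key K δ hδ hK η hη
    refine ⟨δ', hδ', fun κ μ _ _ hκm hμm hcon hmac ε hε => ?_⟩
    obtain ⟨hn1, hn2⟩ := norm_le_contrast (d := d) κ₀ μ₀ κ μ φ
    obtain ⟨hr, hfin⟩ := hkey _ ((norm_nonneg _).trans hn1) hcon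
    have hst : pairStiffness phase (sphT d) (devT d)
        ((fun _ => (d : ℝ) * κ₀) + fun ψ => (d : ℝ) * (κ ψ - κ₀))
        ((fun _ => 2 * μ₀) + fun ψ => 2 * (μ ψ - μ₀)) = phaseStiffness phase κ μ := by
      rw [hsum, hsum]; rfl
    have h := hb _ _ _ hn1 hn2 hr (integral_phase_sub_eq_zero hmeas hκm _)
    rw [hst] at h
    have hc : phaseContrast κ₀ μ₀ κ μ (sphT d) φ = (d : ℝ) * (κ φ - κ₀) := by
      refine phaseContrast_eq (isProjectorPair_sphT_devT hd2) (y := 2 * (μ φ - μ₀)) ?_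
      simp only [isoStiffness]
      module
    rw [hc]
    exact (h hmac ε hε).trans hfin
  · obtain ⟨K, δ, hδ, hK, hb⟩ := exists_phase_energy_bound (a := a) hd2 (P := devT d)
      (P' := sphT d) (Or.inr ⟨rfl, rfl⟩) hmeas hκ₀ hμ₀ h2μ hdκ (add_comm _ _) hξ (hpos φ) hεbar
    obtain ⟨δ', hδ', hkey⟩ := key K δ hδ hK η hη
    refine ⟨δ', hδ', fun κ μ _ _ hκm hμm hcon hmac ε hε => ?_⟩
    obtain ⟨hn1, hn2⟩ := norm_le_contrast (d := d) κ₀ μ₀ κ μ φ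
    obtain ⟨hr, hfin⟩ := hkey _ ((norm_nonneg _).trans hn1) hcon
    have hst : pairStiffness phase (devT d) (sphT d)
        ((fun _ => 2 * μ₀) + fun ψ => 2 * (μ ψ - μ₀))
        ((fun _ => (d : ℝ) * κ₀) + fun ψ => (d : ℝ) * (κ ψ - κ₀)) = phaseStiffness phase κ μ := by
      rw [hsum, hsum]
      ext1 x
      exact add_comm _ _
    -- In the deviatoric case the roles of the moduli are exchanged: the mean of μ gives the
    -- zero-mean fluctuation, and κ provides the complementary modulus.
    have h := hb _ _ _ hn2 hn1 hr (integral_phase_sub_eq_zero hmeas hμm _)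
    rw [hst] at h
    have hc : phaseContrast κ₀ μ₀ κ μ (devT d) φ = 2 * (μ φ - μ₀) := by
      refine phaseContrast_eq (isProjectorPair_sphT_devT hd2).swap (y := (d : ℝ) * (κ φ - κ₀)) ?_
      simp only [isoStiffness]
      module
    rw [hc]
    exact (h hmac ε hε).trans hfin
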